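/- Let $M$ be a connected smooth three-dimensional manifold with a smooth Weyl structure $(h,\omega)$: $h$ is a nondegenerate symmetric tensor of any signature (a representative of the conformal class), $\omega$ is a one-form, and $D$ is the torsion-free connection with $D_i h_{jk}=\omega_i h_{jk}$. The representative may be changed by $(h,\omega)\mapsto(\phi^2h,\ \omega+2\,d\ln\phi)$ with a smooth function $\phi>0$, which does not change $D$. Let $W_{ij}$ be the Ricci tensor of $D$, $W=h^{ij}W_{ij}$ its scalar curvature, and $F_{ij}=\nabla_{[i}\omega_{j]}$ the Faraday two-form. Flat means that the curvature of $D$ vanishes. Suppose that $(h,\omega)$ is Einstein–Weyl, $W_{(ij)}=\frac13Wh_{ij}$, with $W=0$. Then either $(h,\omega)$ is flat, or, after replacing $h$ by $-h$ if necessary, $h$ has signature $(++-)$ everywhere and the following holds. Call $p\in M$ of type 1 (type 2) if, after a change of representative near $p$, there are smooth local coordinates $(y,x,t)$ around $p$ (with $y\neq0$ for type 2) in which $\omega=y\,dt$ and $h=h_1$ ($h=h_2$), where $$h_1=dy^2+2\,dx\,dt+\Big(x\big[R(t)-\tfrac y2\big]+\tfrac1{48}y^4+\tfrac1{12}R(t)y^3+S(t)y\Big)dt^2,$$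 $$h_2=dy^2+2\,dx\,dt-\frac{4x}{y}\,dy\,dt+\Big(\frac{x^2}{y^2}+\frac{xy}2+\frac18y^4+R(t)y^2+S(t)y\Big)dt^2,$$ for some smooth functions $R,S$ of one variable. (a) The points that have a flat neighbourhood, or are of type 1, or are of type 2, form an open dense subset of $M$. (b) Let $p$ be a point at which the curvature of $D$ is not zero. If $F$ is recurrent near $p$ (at each point near $p$ one has $DF=\alpha\otimes F$ for some covector $\alpha$), then $p$ is of type 1. If $(DF)_p$ is not of the form $\alpha\otimes F_p$, then $p$ is of type 2. Conversely, for arbitrary functions $R$ and $S$ with continuous second derivatives on an open set $J\subseteq\mathbb R$, the pair $(h_1,y\,dt)$ on $\{t\in J\}$, and the pair $(h_2,y\,dt)$ on $\{t\in J,\ y\ne0\}$, is an Einstein–Weyl structure of signature $(++-)$ with components of class $C^2$ and with $W=0$, and its curvature does not vanish at any point. -/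

import Mathlib

open scoped Manifold ContDiff Topology

noncomputable section

namespace EinsteinWeyl

/-- The coordinate space `ℝ³`. -/
abbrev E3 := EuclideanSpace ℝ (Fin 3)

/-! ### Weyl structures in coordinates

In coordinates a Weyl structure is a pair `(h, ω)`: the components `h x i j` of the metric and the
components `ω x i` of the one-form. -/

/-- The `i`-th partial derivative. -/
def pd (i : Fin 3) (f : E3 → ℝ) (x : E3) : ℝ :=
  fderiv ℝ f x (EuclideanSpace.single i 1)

/-- `(h, ω)` is a Weyl structure with components of class `C^n` on `U`: the metric `h` is symmetric
and nondegenerate, of any signature. -/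
structure IsWeylOn (n : WithTop ℕ∞) (U : Set E3)
    (h : E3 → Matrix (Fin 3) (Fin 3) ℝ) (om : E3 → Fin 3 → ℝ) : Prop where
  symm : ∀ x ∈ U, (h x).IsSymm
  nondeg : ∀ x ∈ U, (h x).det ≠ 0
  contDiffOn_h : ∀ i j, ContDiffOn ℝ n (fun x => h x i j) U
  contDiffOn_form : ∀ i, ContDiffOn ℝ n (fun x => om x i) U

/-- The Christoffel symbols `Γ^k_{ij}` of the Levi-Civita connection of `h`. -/
def leviCivita (h : E3 → Matrix (Fin 3) (Fin 3) ℝ) (k i j : Fin 3) (x : E3) : ℝ :=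
  (1 / 2) * ∑ m, (h x)⁻¹ k m *
    (pd i (fun z => h z m j) x + pd j (fun z => h z m i) x - pd m (fun z => h z i j) x)

/-- The connection coefficients of the Weyl connection `D`, the torsion-free connection with
`D_i h_{jk} = ω_i h_{jk}`. Here `D_i V_j = ∂_i V_j - ∑ k, weylConn k i j * V_k`, that is
`D_i V_j = ∇_i V_j + (ω_i V_j + ω_j V_i - h_{ij} ω_k V^k) / 2`. -/
def weylConn (h : E3 → Matrix (Fin 3) (Fin 3) ℝ) (om : E3 → Fin 3 → ℝ)
    (k i j : Fin 3) (x : E3) : ℝ :=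
  leviCivita h k i j x
    - (1 / 2) * ((if k = j then om x i else 0) + (if k = i then om x j else 0)
        - h x i j * ∑ m, (h x)⁻¹ k m * om x m)

/-- The curvature of the Weyl connection: `(D_i D_j - D_j D_i) ∂_k = ∑ l, weylCurv l k i j • ∂_l`. -/
def weylCurv (h : E3 → Matrix (Fin 3) (Fin 3) ℝ) (om : E3 → Fin 3 → ℝ)
    (l k i j : Fin 3) (x : E3) : ℝ :=
  pd i (weylConn h om l j k) x - pd j (weylConn h om l i k) x
    + ∑ m, (weylConn h om l i m x * weylConn h om m j k x
        - weylConn h om l j m x * weylConn h om m i k x)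

/-- The Ricci tensor `W_{kj}` of the Weyl connection. -/
def weylRicci (h : E3 → Matrix (Fin 3) (Fin 3) ℝ) (om : E3 → Fin 3 → ℝ)
    (k j : Fin 3) (x : E3) : ℝ :=
  ∑ i, weylCurv h om i k i j x

/-- The scalar curvature `W = h^{ij} W_{ij}` of the Weyl connection. -/
def weylScalar (h : E3 → Matrix (Fin 3) (Fin 3) ℝ) (om : E3 → Fin 3 → ℝ) (x : E3) : ℝ :=
  ∑ i, ∑ j, (h x)⁻¹ i j * weylRicci h om i j x

/-- The Einstein–Weyl equation `W_{(ij)} = W h_{ij} / 3` at `x`. -/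
def EWAt (h : E3 → Matrix (Fin 3) (Fin 3) ℝ) (om : E3 → Fin 3 → ℝ) (x : E3) : Prop :=
  ∀ i j, (weylRicci h om i j x + weylRicci h om j i x) / 2 = weylScalar h om x / 3 * h x i j

/-- The curvature of the Weyl connection vanishes at `x`. -/
def CurvZeroAt (h : E3 → Matrix (Fin 3) (Fin 3) ℝ) (om : E3 → Fin 3 → ℝ) (x : E3) : Prop :=
  ∀ l k i j, weylCurv h om l k i j x = 0

/-- The Faraday two-form `F_{ij} = ∇_{[i} ω_{j]} = (∂_i ω_j - ∂_j ω_i) / 2`. -/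
def faraday (om : E3 → Fin 3 → ℝ) (i j : Fin 3) (x : E3) : ℝ :=
  (pd i (fun z => om z j) x - pd j (fun z => om z i) x) / 2

/-- The covariant derivative `D_i F_{jk}` of the Faraday two-form for the Weyl connection. -/
def weylDFaraday (h : E3 → Matrix (Fin 3) (Fin 3) ℝ) (om : E3 → Fin 3 → ℝ)
    (i j k : Fin 3) (x : E3) : ℝ :=
  pd i (faraday om j k) x - ∑ m, (weylConn h om m i j x * faraday om m k x
    + weylConn h om m i k x * faraday om j m x)

/-- `F` is recurrent at `x`: there is a covector `α` with `D_i F_{jk} = α_i F_{jk}` at `x`. -/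
def RecurrentAt (h : E3 → Matrix (Fin 3) (Fin 3) ℝ) (om : E3 → Fin 3 → ℝ) (x : E3) : Prop :=
  ∃ α : Fin 3 → ℝ, ∀ i j k, weylDFaraday h om i j k x = α i * faraday om j k x

/-- A symmetric matrix has signature `(++-)`. -/
def HasSignaturePPM (A : Matrix (Fin 3) (Fin 3) ℝ) : Prop :=
  ∃ P : Matrix (Fin 3) (Fin 3) ℝ, P.det ≠ 0 ∧ P.transpose * A * P = Matrix.diagonal ![1, 1, -1]

/-! ### The two families

The coordinates are `(y, x, t) = (p 0, p 1, p 2)`. -/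

/-- The one-form `y dt`. -/
def ydt (p : E3) : Fin 3 → ℝ := ![0, 0, p 0]

/-- `dy² + 2 dx dt + (x (R - y/2) + y⁴/48 + R y³/12 + S y) dt²`. -/
def h₁ (R S : ℝ → ℝ) (p : E3) : Matrix (Fin 3) (Fin 3) ℝ :=
  !![1, 0, 0;
     0, 0, 1;
     0, 1, p 1 * (R (p 2) - p 0 / 2) + (1 / 48) * p 0 ^ 4 + (1 / 12) * R (p 2) * p 0 ^ 3
       + S (p 2) * p 0]

/-- `dy² + 2 dx dt - (4 x / y) dy dt + (x²/y² + x y / 2 + y⁴/8 + R y² + S y) dt²`, for `y ≠ 0`. -/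
def h₂ (R S : ℝ → ℝ) (p : E3) : Matrix (Fin 3) (Fin 3) ℝ :=
  !![1, 0, -2 * p 1 / p 0;
     0, 0, 1;
     -2 * p 1 / p 0, 1, p 1 ^ 2 / p 0 ^ 2 + p 1 * p 0 / 2 + (1 / 8) * p 0 ^ 4
       + R (p 2) * p 0 ^ 2 + S (p 2) * p 0]

/-! ### Weyl structures on a manifold -/

section Manifold

variable {M : Type*} [TopologicalSpace M] [ChartedSpace E3 M]

/-- The coordinate components, in a chart `e`, of a field of bilinear forms. -/
def coordMetric (h : ∀ p : M, TangentSpace (𝓡 3) p →L[ℝ] TangentSpace (𝓡 3) p →L[ℝ] ℝ)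
    (e : OpenPartialHomeomorph M E3) (x : E3) : Matrix (Fin 3) (Fin 3) ℝ :=
  Matrix.of fun i j => h (e.symm x)
    (mfderiv (𝓡 3) (𝓡 3) e.symm x (EuclideanSpace.single i (1 : ℝ) : E3))
    (mfderiv (𝓡 3) (𝓡 3) e.symm x (EuclideanSpace.single j (1 : ℝ) : E3))

/-- The coordinate components, in a chart `e`, of a one-form. -/
def coordForm (om : ∀ p : M, TangentSpace (𝓡 3) p →L[ℝ] ℝ)
    (e : OpenPartialHomeomorph M E3) (x : E3) : Fin 3 → ℝ :=
  fun i => om (e.symm x)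
    (mfderiv (𝓡 3) (𝓡 3) e.symm x (EuclideanSpace.single i (1 : ℝ) : E3))

variable (M) in
/-- A smooth Weyl structure on the 3-manifold `M`, given by a representative metric `h` of the
conformal class, of any signature, and the one-form `ω`. -/
structure WeylStructure where
  h : ∀ p : M, TangentSpace (𝓡 3) p →L[ℝ] TangentSpace (𝓡 3) p →L[ℝ] ℝ
  om : ∀ p : M, TangentSpace (𝓡 3) p →L[ℝ] ℝ
  isWeylOn : ∀ e ∈ IsManifold.maximalAtlas (𝓡 3) ∞ M,
    IsWeylOn ∞ e.target (coordMetric h e) (coordForm om e)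

namespace WeylStructure

variable (W : WeylStructure M)

/-- Components of the metric in the chart `e`. -/
def hc (e : OpenPartialHomeomorph M E3) : E3 → Matrix (Fin 3) (Fin 3) ℝ := coordMetric W.h e

/-- Components of the one-form in the chart `e`. -/
def omc (e : OpenPartialHomeomorph M E3) : E3 → Fin 3 → ℝ := coordForm W.om e

/-- The Einstein–Weyl equations hold on `M`. -/
def IsEinsteinWeyl : Prop :=
  ∀ e ∈ IsManifold.maximalAtlas (𝓡 3) ∞ M, ∀ x ∈ e.target, EWAt (W.hc e) (W.omc e) x

/-- The scalar curvature of the Weyl connection vanishes on `M`. -/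
def IsScalarFlat : Prop :=
  ∀ e ∈ IsManifold.maximalAtlas (𝓡 3) ∞ M, ∀ x ∈ e.target, weylScalar (W.hc e) (W.omc e) x = 0

/-- The curvature of the Weyl connection vanishes at `p`. -/
def FlatAt (p : M) : Prop :=
  ∀ e ∈ IsManifold.maximalAtlas (𝓡 3) ∞ M, p ∈ e.source → CurvZeroAt (W.hc e) (W.omc e) (e p)

/-- The Weyl structure is flat: the curvature of the Weyl connection vanishes identically. -/
def IsFlat : Prop := ∀ p, W.FlatAt p

/-- After a change `(h, ω) ↦ (φ² h, ω + 2 d ln φ)` of the representative, the pair `(ε h, ω)` has, in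
suitable local coordinates around `p`, the form `(h₁, y dt)`. -/
def HasForm₁ (ε : ℝ) (p : M) : Prop :=
  ∃ R S : ℝ → ℝ, ContDiff ℝ ∞ R ∧ ContDiff ℝ ∞ S ∧
    ∃ e ∈ IsManifold.maximalAtlas (𝓡 3) ∞ M, p ∈ e.source ∧
      ∃ φ : E3 → ℝ, ContDiffOn ℝ ∞ φ e.target ∧ ∀ x ∈ e.target, 0 < φ x ∧
        (φ x ^ 2 * ε) • W.hc e x = h₁ R S x ∧
        ∀ i, W.omc e x i + 2 * pd i (fun z => Real.log (φ z)) x = ydt x i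

/-- After a change `(h, ω) ↦ (φ² h, ω + 2 d ln φ)` of the representative, the pair `(ε h, ω)` has, in
suitable local coordinates around `p` with `y ≠ 0`, the form `(h₂, y dt)`. -/
def HasForm₂ (ε : ℝ) (p : M) : Prop :=
  ∃ R S : ℝ → ℝ, ContDiff ℝ ∞ R ∧ ContDiff ℝ ∞ S ∧
    ∃ e ∈ IsManifold.maximalAtlas (𝓡 3) ∞ M, p ∈ e.source ∧
      ∃ φ : E3 → ℝ, ContDiffOn ℝ ∞ φ e.target ∧ ∀ x ∈ e.target, x 0 ≠ 0 ∧ 0 < φ x ∧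
        (φ x ^ 2 * ε) • W.hc e x = h₂ R S x ∧
        ∀ i, W.omc e x i + 2 * pd i (fun z => Real.log (φ z)) x = ydt x i

/-- `F` is recurrent at `p` for the Weyl connection: `D F = α ⊗ F` at `p` for some covector `α`
(a tensorial condition, so it does not depend on the chart). -/
def IsRecurrentAt (p : M) : Prop :=
  ∀ e ∈ IsManifold.maximalAtlas (𝓡 3) ∞ M, p ∈ e.source → RecurrentAt (W.hc e) (W.omc e) (e p)

/-- `F` is not recurrent at `p` (in no chart, equivalently in some chart around `p`). -/
def IsNonrecurrentAt (p : M) : Prop :=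
  ∀ e ∈ IsManifold.maximalAtlas (𝓡 3) ∞ M, p ∈ e.source → ¬ RecurrentAt (W.hc e) (W.omc e) (e p)

end WeylStructure

end Manifold

end EinsteinWeyl

end

noncomputable section

namespace EinsteinWeyl

/-! The Faraday form F controls everything. If the symmetric part of the Ricci tensor vanishes, the
algebraic Bianchi identity gives W_{ij} = -(3/2) F_{ij} (`WeylNear.ricci_eq`). In dimension three
the Ricci tensor determines the curvature, so the curvature vanishes wherever F does
(`WeylNear.curvZeroAt`). Contracting the differential Bianchi identity twice shows that F is
divergence-free (`WeylNear.divergence_faraday`), which for the dual one-form f of dω says df =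
-(1/2) ω ∧ f (`WeylNear.d_dualForm`). Differentiating once more leaves dω ∧ f = 0, that is, F is
null (`WeylNear.curl_null`).

Near a point with F ≠ 0, let ∂_x span the kernel of F and choose the representative with ω(∂_x) = 0
(`Rep.exists_straight_curl`). Then f has no dx component and its coefficients do not depend on x, so
f is a multiple of some dt, and a rescaling makes f = dt (`Rep.exists_dual_exact`). Now df = 0,
hence ω = y dt, and dω ≠ 0 makes y and t independent coordinates. Since f is the dual of dω, a
suitable coordinate x brings the metric to dy² + 2 dx dt + 2 b dy dt + c dt²
(`Rep.ansatz_of_dual_exact`). This metric has signature (++-).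

For this form of the metric the equations are explicit (`AnsatzEquations`): b is affine in x and
b_xy = (1/2) b_x². Moreover F is recurrent exactly where b_x = 0 (`recurrentAt_ansatz_iff`). If b_x
vanishes near the point, a shift of x removes b. If b_x ≠ 0 at the point, then b_x = -2/(y - A(t)),
and a rescaling depending on t followed by shifts of x gives b = -2x/y. In both cases the remaining
equations for c are integrated in x and y, and R and S are the functions of t left over after the
last shift (`Rep.exists_family₁`, `Rep.exists_family₂`).

The signature is locally constant, so on a connected manifold one nonflat point fixes it everywhere.
Density follows because near a nonflat point either b_x vanishes identically or it is nonzero at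
points arbitrarily close by. The converse uses the same Ricci computation. The curvature of the
families vanishes nowhere because the skew part of their Ricci tensor is a nonzero constant.

The analytic tools are a smooth straightening theorem and primitives depending smoothly on
parameters. Both rest on the smoothness of γ ↦ V ∘ γ on spaces of continuous paths. The flow itself
comes from the inverse function theorem in such a space (`exists_flow`). -/

/-- `f` is smooth on a neighbourhood of `a`. -/
def SmoothNear {X Y : Type*} [NormedAddCommGroup X] [NormedSpace ℝ X] [NormedAddCommGroup Y]
    [NormedSpace ℝ Y] (f : X → Y) (a : X) : Prop :=
  ∀ᶠ x in 𝓝 a, ContDiffAt ℝ ∞ f x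

/-- The inverse function theorem at `a` gives smoothness of the inverse at the image of `a` only.
Invertibility of the derivative is an open condition, so after shrinking the source the theorem
applies at each of its points and the inverse is smooth on the whole target. -/
theorem exists_openPartialHomeomorph_of_smoothNear {X Y : Type*} [NormedAddCommGroup X]
    [NormedSpace ℝ X] [CompleteSpace X] [NormedAddCommGroup Y] [NormedSpace ℝ Y]
    {f : X → Y} {a : X} (hf : SmoothNear f a) {f' : X ≃L[ℝ] Y}
    (hf' : HasFDerivAt f (f' : X →L[ℝ] Y) a) :
    ∃ Ψ : OpenPartialHomeomorph X Y, a ∈ Ψ.source ∧ (∀ x, Ψ x = f x) ∧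
      (∀ x ∈ Ψ.source, ContDiffAt ℝ ∞ f x) ∧ ∀ y ∈ Ψ.target, ContDiffAt ℝ ∞ Ψ.symm y := by
  have hfa : ContDiffAt ℝ ∞ f a := hf.self_of_nhds
  set Φ := hfa.toOpenPartialHomeomorph f hf' (by simp) with hΦ
  have hcont : ContinuousAt (fderiv ℝ f) a :=
    (hfa.fderiv_right (m := 0) (by simp)).continuousAt
  have hinv : ∀ᶠ x in 𝓝 a, fderiv ℝ f x ∈ Set.range ((↑) : (X ≃L[ℝ] Y) → X →L[ℝ] Y) := by
    have h := ContinuousLinearEquiv.nhds f'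
    rw [← hf'.fderiv] at h
    exact hcont.eventually h
  obtain ⟨s, hs, hso, has⟩ := eventually_nhds_iff.1 (hf.and hinv)
  refine ⟨Φ.restr s, ?_, fun x => rfl, ?_, ?_⟩
  · rw [OpenPartialHomeomorph.restr_source, hso.interior_eq]
    exact ⟨hfa.mem_toOpenPartialHomeomorph_source hf' (by simp), has⟩
  · intro x hx
    rw [OpenPartialHomeomorph.restr_source, hso.interior_eq] at hx
    exact (hs x hx.2).1
  · intro y hy
    have hy' := (Φ.restr s).map_target hy
    rw [OpenPartialHomeomorph.restr_source, hso.interior_eq] at hy'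
    obtain ⟨h1, g, hg⟩ := hs _ hy'.2
    refine (Φ.restr s).contDiffAt_symm (f₀' := g) hy ?_ h1
    rw [hg]
    exact (h1.differentiableAt (by simp)).hasFDerivAt

/-! ### Superposition operators on spaces of continuous functions -/

section Superposition

variable {K : Type} [TopologicalSpace K] [CompactSpace K]
  {E F : Type} [NormedAddCommGroup E] [NormedSpace ℝ E] [NormedAddCommGroup F] [NormedSpace ℝ F]

/-- Pointwise application of a family of continuous linear maps. -/
def applyCLM : C(K, E →L[ℝ] F) →L[ℝ] C(K, E) →L[ℝ] C(K, F) :=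
  LinearMap.mkContinuous₂
    (LinearMap.mk₂ ℝ (fun (A : C(K, E →L[ℝ] F)) (γ : C(K, E)) => (⟨fun k => A k (γ k), by fun_prop⟩ : C(K, F)))
      (by intros; ext; simp) (by intros; ext; simp) (by intros; ext; simp)
      (by intros; ext; simp)) 1 (by
    intro A γ
    rw [one_mul]
    refine (ContinuousMap.norm_le _ (by positivity)).2 fun k => ?_
    exact ((A k).le_opNorm _).trans
      (mul_le_mul (A.norm_coe_le_norm k) (γ.norm_coe_le_norm k) (norm_nonneg _) (by positivity)))

@[simp] theorem applyCLM_apply (A : C(K, E →L[ℝ] F)) (γ : C(K, E)) (k : K) :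
    applyCLM A γ k = A k (γ k) := rfl

/-- Postcomposition with V' is continuous for the uniform norm, so V' along γ + tη is within ε of V'
along γ, uniformly on K and in t ∈ [0, 1]. The mean value inequality on each segment from γ(k) to
γ(k) + η(k) then bounds the remainder by ε‖η‖. -/
theorem hasFDerivAt_superposition (V : C(E, F)) (V' : C(E, E →L[ℝ] F))
    (hV : ∀ x, HasFDerivAt V (V' x) x) (γ : C(K, E)) :
    HasFDerivAt (fun γ : C(K, E) => V.comp γ) (applyCLM (V'.comp γ)) γ := by
  rw [hasFDerivAt_iff_isLittleO_nhds_zero, Asymptotics.isLittleO_iff]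
  intro ε hε
  have hc : ContinuousAt (fun η : C(K, E) => V'.comp (γ + η)) 0 :=
    ((ContinuousMap.continuous_postcomp V').comp (continuous_const.add continuous_id)).continuousAt
  obtain ⟨δ, hδ, hball⟩ := (Metric.continuousAt_iff (α := C(K, E)) (β := C(K, E →L[ℝ] F))).1 hc ε hε
  filter_upwards [Metric.ball_mem_nhds (0 : C(K, E)) hδ] with η hη
  refine (ContinuousMap.norm_le _ (by positivity)).2 fun k => ?_
  have key : ‖V (γ k + η k) - V (γ k) - V' (γ k) ((γ k + η k) - γ k)‖
      ≤ ε * ‖(γ k + η k) - γ k‖ := by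
    refine Convex.norm_image_sub_le_of_norm_hasFDerivWithin_le' (s := segment ℝ (γ k) (γ k + η k))
      (f' := V') (fun x _ => (hV x).hasFDerivWithinAt) ?_ (convex_segment _ _)
      (left_mem_segment _ _ _) (right_mem_segment _ _ _)
    intro x hx
    rw [segment_eq_image'] at hx
    obtain ⟨t, ht, rfl⟩ := hx
    have h1 : dist (t • η) 0 < δ := by
      rw [dist_zero_right, norm_smul, Real.norm_of_nonneg ht.1]
      rw [Metric.mem_ball, dist_zero_right] at hη
      nlinarith [ht.2, norm_nonneg η]
    have h2 := hball h1
    have h3 := (ContinuousMap.dist_apply_le_dist k).trans h2.le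
    simpa [dist_eq_norm] using h3
  calc _ = ‖V (γ k + η k) - V (γ k) - V' (γ k) ((γ k + η k) - γ k)‖ := by simp
    _ ≤ ε * ‖(γ k + η k) - γ k‖ := key
    _ ≤ ε * ‖η‖ := by
      rw [add_sub_cancel_left]
      exact mul_le_mul_of_nonneg_left (η.norm_coe_le_norm k) hε.le

/-- The derivative of the superposition operator of V is, up to a continuous linear map, the
superposition operator of V'. This allows induction on the order. The target space is quantified
inside the induction because V' takes values in E →L[ℝ] F. -/
theorem contDiff_superposition_nat (n : ℕ) : ∀ (F : Type) [NormedAddCommGroup F] [NormedSpace ℝ F]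
    (V : C(E, F)), ContDiff ℝ ∞ V → ContDiff ℝ n (fun γ : C(K, E) => V.comp γ) := by
  induction n with
  | zero =>
    intro F _ _ V _
    have h : Continuous (fun γ : C(K, E) => V.comp γ) := ContinuousMap.continuous_postcomp V
    exact contDiff_zero.2 h
  | succ n ih =>
    intro F _ _ V hV
    have hd : ContDiff ℝ ∞ (fderiv ℝ V) := hV.fderiv_right (by simp)
    let V' : C(E, E →L[ℝ] F) := ⟨fderiv ℝ V, hd.continuous⟩
    rw [Nat.cast_add, Nat.cast_one, contDiff_succ_iff_hasFDerivAt]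
    have h := ih _ V' hd
    have h1 : ContDiff ℝ n (fun A : C(K, E →L[ℝ] F) => applyCLM A) :=
      ContinuousLinearMap.contDiff _
    have h2 : ContDiff ℝ n (fun γ : C(K, E) => applyCLM (V'.comp γ)) := h1.comp h
    exact ⟨fun γ => applyCLM (V'.comp γ), h2, fun γ =>
      hasFDerivAt_superposition V V' (fun x => (hV.differentiable (by simp) x).hasFDerivAt) γ⟩

theorem contDiff_superposition (V : C(E, F)) (hV : ContDiff ℝ ∞ V) :
    ContDiff ℝ ∞ (fun γ : C(K, E) => V.comp γ) :=
  contDiff_infty.2 fun n => contDiff_superposition_nat n F V hV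

end Superposition

/-! ### Smooth dependence of solutions of ordinary differential equations on initial data -/

section Flow

variable {E : Type} [NormedAddCommGroup E] [NormedSpace ℝ E]

/-- The unit interval `[0, 1]`, as the domain of paths. -/
abbrev UI := Set.Icc (0 : ℝ) 1

theorem continuous_extend {E : Type} [NormedAddCommGroup E] (γ : C(UI, E)) :
    Continuous (Set.IccExtend (zero_le_one (α := ℝ)) γ) := γ.continuous.Icc_extend'

/-- The integration operator `γ ↦ (τ ↦ ∫₀^τ γ)`. -/
def volterra : C(UI, E) →L[ℝ] C(UI, E) :=
  LinearMap.mkContinuous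
    { toFun := fun γ => ⟨fun τ => ∫ r in (0 : ℝ)..τ, Set.IccExtend (zero_le_one (α := ℝ)) γ r,
        (intervalIntegral.continuous_primitive
          (fun a b => (continuous_extend γ).intervalIntegrable a b) 0).comp continuous_subtype_val⟩
      map_add' := fun γ η => by
        ext τ
        exact intervalIntegral.integral_add ((continuous_extend γ).intervalIntegrable 0 τ)
          ((continuous_extend η).intervalIntegrable 0 τ)
      map_smul' := fun c γ => by
        ext τ
        exact intervalIntegral.integral_smul c _ } 1 (by
    intro γ
    rw [one_mul]
    refine (ContinuousMap.norm_le _ (by positivity)).2 fun τ => ?_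
    refine (intervalIntegral.norm_integral_le_of_norm_le_const (C := ‖γ‖)
      fun r _ => γ.norm_coe_le_norm _).trans ?_
    rw [sub_zero, abs_of_nonneg τ.2.1]
    nlinarith [τ.2.2, norm_nonneg γ])

theorem volterra_apply (γ : C(UI, E)) (τ : UI) :
    volterra γ τ = ∫ r in (0 : ℝ)..τ, Set.IccExtend (zero_le_one (α := ℝ)) γ r := rfl

end Flow

section Flow
variable {E : Type} [NormedAddCommGroup E] [NormedSpace ℝ E] 

/-- The fixed-point equation whose solutions are the integral curves `τ ↦ γ τ` of `s • V`, starting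
at `z`, where `p = (s, z)`. -/
def flowEquation (V : C(E, E)) (q : (ℝ × E) × C(UI, E)) : (ℝ × E) × C(UI, E) :=
  (q.1, q.2 - ContinuousMap.const UI q.1.2 - q.1.1 • volterra (V.comp q.2))

/-- The linearization of `flowEquation` at `s = 0`. -/
def flowEquationDeriv (I₀ : C(UI, E)) :
    ((ℝ × E) × C(UI, E)) ≃L[ℝ] (ℝ × E) × C(UI, E) :=
  let L : (ℝ × E) →L[ℝ] C(UI, E) :=
    (ContinuousLinearMap.const ℝ UI).comp (ContinuousLinearMap.snd ℝ ℝ E)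
      + (ContinuousLinearMap.fst ℝ ℝ E).smulRight I₀
  ContinuousLinearEquiv.equivOfInverse
    ((ContinuousLinearMap.fst ℝ _ _).prod
      (ContinuousLinearMap.snd ℝ _ _ - L.comp (ContinuousLinearMap.fst ℝ _ _)))
    ((ContinuousLinearMap.fst ℝ _ _).prod
      (ContinuousLinearMap.snd ℝ _ _ + L.comp (ContinuousLinearMap.fst ℝ _ _)))
    (fun q => by ext <;> simp) (fun q => by ext <;> simp)

theorem contDiff_volterra_comp {F : Type} [NormedAddCommGroup F] [NormedSpace ℝ F] (V : C(E, F))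
    (hV : ContDiff ℝ ∞ V) : ContDiff ℝ ∞ (fun γ : C(UI, E) => volterra (V.comp γ)) := by
  have h1 : ContDiff ℝ ∞ (fun A : C(UI, F) => volterra A) := ContinuousLinearMap.contDiff _
  exact h1.comp (contDiff_superposition V hV)

theorem contDiff_const_snd : ContDiff ℝ ∞
    (fun q : (ℝ × E) × C(UI, E) => (ContinuousMap.const UI q.1.2 : C(UI, E))) := by
  have h1 : ContDiff ℝ ∞ (fun x : E => ContinuousLinearMap.const ℝ UI x) :=
    ContinuousLinearMap.contDiff _
  exact h1.comp (contDiff_snd.comp contDiff_fst)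

theorem contDiff_flowEquation (V : C(E, E)) (hV : ContDiff ℝ ∞ V) :
    ContDiff ℝ ∞ (flowEquation V) := by
  refine contDiff_fst.prodMk ((contDiff_snd.sub contDiff_const_snd).sub ?_)
  exact (contDiff_fst.comp contDiff_fst).smul ((contDiff_volterra_comp V hV).comp contDiff_snd)

/-- At s = 0 the term s ∫ V(γ) contributes only through ds. The derivative is therefore triangular
with identity blocks, hence invertible, although the path space is infinite-dimensional. -/
theorem hasFDerivAt_flowEquation (V : C(E, E)) (hV : ContDiff ℝ ∞ V) (x₀ : E) :
    HasFDerivAt (flowEquation V)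
      (flowEquationDeriv (volterra (V.comp (ContinuousMap.const UI x₀))) :
        ((ℝ × E) × C(UI, E)) →L[ℝ] (ℝ × E) × C(UI, E))
      (((0 : ℝ), x₀), ContinuousMap.const UI x₀) := by
  set q₀ : (ℝ × E) × C(UI, E) := (((0 : ℝ), x₀), ContinuousMap.const UI x₀) with hq
  have h1 : HasFDerivAt (fun q : (ℝ × E) × C(UI, E) => q.1)
    (ContinuousLinearMap.fst ℝ (ℝ × E) C(UI, E)) q₀ := hasFDerivAt_fst
  have h2 : HasFDerivAt (fun q : (ℝ × E) × C(UI, E) => q.2)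
    (ContinuousLinearMap.snd ℝ (ℝ × E) C(UI, E)) q₀ := hasFDerivAt_snd
  have h3 : HasFDerivAt (fun q : (ℝ × E) × C(UI, E) => (ContinuousMap.const UI q.1.2 : C(UI, E)))
      ((ContinuousLinearMap.const ℝ UI).comp ((ContinuousLinearMap.snd ℝ ℝ E).comp
        (ContinuousLinearMap.fst ℝ (ℝ × E) C(UI, E)))) q₀ :=
    ((ContinuousLinearMap.const ℝ UI).comp ((ContinuousLinearMap.snd ℝ ℝ E).comp
        (ContinuousLinearMap.fst ℝ (ℝ × E) C(UI, E)))).hasFDerivAt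
  have h4 := (((contDiff_volterra_comp V hV).comp
    (contDiff_snd (E := ℝ × E))).differentiable (by simp) q₀).hasFDerivAt
  have h5 : HasFDerivAt (fun q : (ℝ × E) × C(UI, E) => q.1.1)
    ((ContinuousLinearMap.fst ℝ ℝ E).comp (ContinuousLinearMap.fst ℝ (ℝ × E) C(UI, E))) q₀ :=
    ((ContinuousLinearMap.fst ℝ ℝ E).comp (ContinuousLinearMap.fst ℝ (ℝ × E) C(UI, E))).hasFDerivAt
  have h := h1.prodMk ((h2.sub h3).sub (h5.smul h4))
  refine h.congr_fderiv ?_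
  ext q <;> simp [flowEquationDeriv, hq]

/-- The substitution r ↦ τ r. It turns the restriction of a solution to [0, τ], run on the unit
interval, into a solution with parameter sτ in place of s. -/
theorem volterra_comp_reparam (V : C(E, E)) (γ : C(UI, E)) (τ σ : UI) :
    (τ : ℝ) • volterra (V.comp (γ.comp ⟨fun r => (⟨τ * r, mul_nonneg τ.2.1 r.2.1,
      mul_le_one₀ τ.2.2 r.2.1 r.2.2⟩ : UI), by fun_prop⟩)) σ =
      volterra (V.comp γ) ⟨τ * σ, mul_nonneg τ.2.1 σ.2.1, mul_le_one₀ τ.2.2 σ.2.1 σ.2.2⟩ := by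
  rw [volterra_apply, volterra_apply]
  have h := intervalIntegral.smul_integral_comp_mul_left (a := 0) (b := (σ : ℝ))
    (fun r => Set.IccExtend (zero_le_one (α := ℝ)) (V.comp γ) r) (τ : ℝ)
  rw [mul_zero] at h
  rw [← h]
  congr 1
  refine intervalIntegral.integral_congr fun r hr => ?_
  rw [Set.uIcc_of_le σ.2.1] at hr
  have hr1 : r ∈ Set.Icc (0 : ℝ) 1 := ⟨hr.1, hr.2.trans σ.2.2⟩
  have hr2 : (τ : ℝ) * r ∈ Set.Icc (0 : ℝ) 1 :=
    ⟨mul_nonneg τ.2.1 hr1.1, mul_le_one₀ τ.2.2 hr1.1 hr1.2⟩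
  simp only [Set.IccExtend_of_mem _ _ hr1, Set.IccExtend_of_mem _ _ hr2]
  rfl

/-- Smooth local flow of a smooth vector field. -/
theorem exists_flow [CompleteSpace E] (V : C(E, E)) (hV : ContDiff ℝ ∞ V) (x₀ : E) :
    ∃ Φ : ℝ × E → E, SmoothNear Φ (0, x₀) ∧
      (∀ᶠ p in 𝓝 ((0 : ℝ), x₀), HasDerivAt (fun s => Φ (s, p.2)) (V (Φ p)) p.1) ∧
      ∀ᶠ z in 𝓝 x₀, Φ (0, z) = z := by
  set q₀ : (ℝ × E) × C(UI, E) := (((0 : ℝ), x₀), ContinuousMap.const UI x₀) with hq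
  obtain ⟨Ψ, hmem, hΨ, -, hsymm⟩ := exists_openPartialHomeomorph_of_smoothNear
    (Filter.Eventually.of_forall fun x => (contDiff_flowEquation V hV).contDiffAt)
    (hasFDerivAt_flowEquation V hV x₀)
  have hΨq : Ψ q₀ = (((0 : ℝ), x₀), 0) := by
    rw [hΨ]; ext <;> simp [flowEquation, hq]
  have htarget : ((((0 : ℝ), x₀), 0) : (ℝ × E) × C(UI, E)) ∈ Ψ.target := hΨq ▸ Ψ.map_source hmem
  let j : ℝ × E → (ℝ × E) × C(UI, E) := fun p => (p, 0)
  have hj : ContDiff ℝ ∞ j := contDiff_id.prodMk contDiff_const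
  let γ : ℝ × E → C(UI, E) := fun p => (Ψ.symm (j p)).2
  have hU : ∀ᶠ p in 𝓝 ((0 : ℝ), x₀), j p ∈ Ψ.target :=
    hj.continuous.continuousAt.eventually (Ψ.open_target.mem_nhds htarget)
  have hγs : ∀ p, j p ∈ Ψ.target → ContDiffAt ℝ ∞ γ p := fun p hp =>
    contDiffAt_snd.comp p ((hsymm _ hp).comp p hj.contDiffAt)
  have hγ0 : γ (0, x₀) = ContinuousMap.const UI x₀ := by
    have : Ψ.symm (j (0, x₀)) = q₀ := by
      show Ψ.symm (((0 : ℝ), x₀), 0) = q₀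
      rw [← hΨq, Ψ.left_inv hmem]
    simp only [γ, this, hq]
  have hγeq : ∀ p, j p ∈ Ψ.target →
      γ p = ContinuousMap.const UI p.2 + p.1 • volterra (V.comp (γ p)) := by
    intro p hp
    have h := Ψ.right_inv hp
    rw [hΨ] at h
    have h1 : (Ψ.symm (j p)).1 = p := congrArg Prod.fst h
    have h2 := congrArg Prod.snd h
    simp only [flowEquation, h1, j] at h2
    rw [sub_sub, sub_eq_zero] at h2
    exact h2
  -- Uniqueness of solutions close to the constant path, from injectivity of `Ψ` on its source.
  have hγu : ∀ p (η : C(UI, E)), (p, η) ∈ Ψ.source →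
      η = ContinuousMap.const UI p.2 + p.1 • volterra (V.comp η) → γ p = η := by
    intro p η hs h
    have : Ψ (p, η) = j p := by
      rw [hΨ]
      simp only [flowEquation, j, Prod.mk.injEq, true_and]
      rw [sub_sub, sub_eq_zero]
      exact h
    simp only [γ, ← this, Ψ.left_inv hs]
  obtain ⟨r, hr, hball⟩ := Metric.isOpen_iff.1 Ψ.open_source _ hmem
  have hγc : ∀ᶠ p in 𝓝 ((0 : ℝ), x₀), dist (γ p) (ContinuousMap.const UI x₀) < r := by
    have := (hγs _ htarget).continuousAt
    rw [ContinuousAt, hγ0] at this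
    exact this.eventually (Metric.ball_mem_nhds _ hr)
  obtain ⟨δ, hδ, hδball⟩ := Metric.eventually_nhds_iff.1 (hU.and hγc)
  -- The bound `δ` guarantees that the solution exists and stays `r`-close to the constant path. The
  -- bound `r` keeps the pair inside the source of `Ψ`, where uniqueness applies.
  set ρ := min r δ with hρ
  have hρ0 : 0 < ρ := lt_min hr hδ
  have hscale : ∀ (s : ℝ) (z : E) (τ : UI), dist (s, z) ((0 : ℝ), x₀) < ρ →
      dist (s * τ, z) ((0 : ℝ), x₀) < ρ := by
    intro s z τ h
    rw [Prod.dist_eq, max_lt_iff] at h ⊢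
    refine ⟨lt_of_le_of_lt ?_ h.1, h.2⟩
    rw [dist_zero_right, dist_zero_right, norm_mul, Real.norm_of_nonneg τ.2.1]
    exact mul_le_of_le_one_right (norm_nonneg _) τ.2.2
  -- The solution with parameter s at time τ is the solution with parameter sτ at time 1, since the
  -- reparametrized path solves the same fixed-point equation. Consequently the endpoints alone form
  -- the flow.
  have hre : ∀ (s : ℝ) (z : E) (τ : UI), dist (s, z) ((0 : ℝ), x₀) < ρ →
      γ (s * τ, z) ⟨1, by simp⟩ = γ (s, z) τ := by
    intro s z τ h
    have h1 := hδball (h.trans_le (min_le_right _ _))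
    set m : C(UI, UI) := ⟨fun r => (⟨τ * r, mul_nonneg τ.2.1 r.2.1,
      mul_le_one₀ τ.2.2 r.2.1 r.2.2⟩ : UI), by fun_prop⟩ with hm
    rw [hγu (s * τ, z) ((γ (s, z)).comp m)]
    · simp [hm]
    · apply hball
      rw [Metric.mem_ball, Prod.dist_eq, max_lt_iff]
      refine ⟨(hscale s z τ h).trans_le (min_le_left _ _), lt_of_le_of_lt ?_ h1.2⟩
      exact (ContinuousMap.dist_le dist_nonneg).2 fun σ => ContinuousMap.dist_apply_le_dist
        (f := γ (s, z)) (g := ContinuousMap.const UI x₀) (m σ)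
    · ext σ
      have h2 := DFunLike.congr_fun (hγeq _ h1.1) (m σ)
      have h3 := volterra_comp_reparam V (γ (s, z)) τ σ
      simp only [ContinuousMap.comp_apply, ContinuousMap.add_apply, ContinuousMap.const_apply,
        ContinuousMap.smul_apply, mul_smul] at h2 ⊢
      rw [h3]
      exact h2
  let Φ : ℝ × E → E := fun p => γ p ⟨1, by simp⟩
  have hΦs : ∀ p, dist p ((0 : ℝ), x₀) < ρ → ContDiffAt ℝ ∞ Φ p := by
    intro p hp
    have h1 := hγs _ (hδball (hp.trans_le (min_le_right _ _))).1
    exact (ContinuousMap.evalCLM ℝ (⟨1, by simp⟩ : UI)).contDiff.contDiffAt.comp p h1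
  have hint : ∀ s z, dist (s, z) ((0 : ℝ), x₀) < ρ →
      Φ (s, z) = z + ∫ r in (0 : ℝ)..s, V (Φ (r, z)) := by
    intro s z h
    have h1 := DFunLike.congr_fun (hγeq _ (hδball (h.trans_le (min_le_right _ _))).1)
      (⟨1, by simp⟩ : UI)
    simp only [ContinuousMap.add_apply, ContinuousMap.const_apply,
      ContinuousMap.smul_apply, volterra_apply] at h1
    have h2 := intervalIntegral.smul_integral_comp_mul_left (a := 0) (b := 1)
      (fun r => V (Φ (r, z))) s
    rw [mul_zero, mul_one] at h2
    rw [← h2]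
    refine h1.trans ?_
    congr 2
    refine intervalIntegral.integral_congr fun r hr => ?_
    rw [Set.uIcc_of_le zero_le_one] at hr
    simp only [Set.IccExtend_of_mem _ _ hr, ContinuousMap.comp_apply]
    rw [← hre s z ⟨r, hr⟩ h]
  have hnear : ∀ᶠ p in 𝓝 ((0 : ℝ), x₀), dist p ((0 : ℝ), x₀) < ρ :=
    Metric.ball_mem_nhds _ hρ0
  refine ⟨Φ, hnear.mono hΦs, ?_, ?_⟩
  · filter_upwards [hnear] with p hp
    obtain ⟨s, z⟩ := p
    have hloc : ∀ᶠ r in 𝓝 s, dist (r, z) ((0 : ℝ), x₀) < ρ :=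
      (Continuous.prodMk_left z).continuousAt.eventually
        ((isOpen_lt (continuous_id.dist continuous_const) continuous_const).mem_nhds hp)
    have hcont : ∀ r, dist (r, z) ((0 : ℝ), x₀) < ρ →
        ContinuousAt (fun r => V (Φ (r, z))) r := fun r hr =>
      V.continuous.continuousAt.comp (ContinuousAt.comp (f := fun r => (r, z)) (x := r)
        (hΦs _ hr).continuousAt (Continuous.prodMk_left z).continuousAt)
    have hder : HasDerivAt (fun s => z + ∫ r in (0 : ℝ)..s, V (Φ (r, z))) (V (Φ (s, z))) s := by
      refine HasDerivAt.const_add z (intervalIntegral.integral_hasDerivAt_right ?_ ?_ (hcont s hp))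
      · refine ContinuousOn.intervalIntegrable fun r hr => (hcont r ?_).continuousWithinAt
        rw [Prod.dist_eq, max_lt_iff] at hp ⊢
        refine ⟨lt_of_le_of_lt ?_ hp.1, hp.2⟩
        simp only [dist_zero_right, Real.norm_eq_abs]
        simpa using Set.abs_sub_left_of_mem_uIcc hr
      · refine ContinuousAt.stronglyMeasurableAtFilter (s := {r | dist (r, z) ((0 : ℝ), x₀) < ρ})
          (isOpen_lt (by fun_prop) continuous_const) (fun r hr => hcont r hr) s hp
    refine hder.congr_of_eventuallyEq ?_
    filter_upwards [hloc] with r hr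
    exact hint r z hr
  · have : ∀ᶠ z in 𝓝 x₀, dist ((0 : ℝ), z) ((0 : ℝ), x₀) < ρ :=
      (Continuous.prodMk_right (0 : ℝ)).continuousAt.eventually hnear
    filter_upwards [this] with z hz
    rw [hint 0 z hz]
    simp

end Flow

/-! ### Germs of smooth functions -/

section Germs
variable {X Y Z : Type*} [NormedAddCommGroup X] [NormedSpace ℝ X] [NormedAddCommGroup Y]
    [NormedSpace ℝ Y] [NormedAddCommGroup Z] [NormedSpace ℝ Z] {f g : X → Y} {a : X}

theorem SmoothNear.contDiffAt (hf : SmoothNear f a) : ContDiffAt ℝ ∞ f a := hf.self_of_nhds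

theorem SmoothNear.continuousAt (hf : SmoothNear f a) : ContinuousAt f a :=
  hf.contDiffAt.continuousAt

theorem SmoothNear.eventually (hf : SmoothNear f a) : ∀ᶠ x in 𝓝 a, SmoothNear f x :=
  eventually_eventually_nhds.2 hf

theorem smoothNear_of_contDiff (hf : ContDiff ℝ ∞ f) (a : X) : SmoothNear f a :=
  Filter.Eventually.of_forall fun _ => hf.contDiffAt

theorem SmoothNear.congr (hf : SmoothNear f a) (h : g =ᶠ[𝓝 a] f) : SmoothNear g a := by
  filter_upwards [hf, h.eventuallyEq_nhds] with x hx hx' using hx.congr_of_eventuallyEq hx'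

theorem SmoothNear.comp {u : Y → Z} (hu : SmoothNear u (f a)) (hf : SmoothNear f a) :
    SmoothNear (fun x => u (f x)) a := by
  filter_upwards [hf, hf.continuousAt.eventually hu] with x hx hx' using hx'.comp x hx

theorem SmoothNear.add (hf : SmoothNear f a) (hg : SmoothNear g a) :
    SmoothNear (fun x => f x + g x) a := by
  filter_upwards [hf, hg] with x hx hx' using hx.add hx'

theorem SmoothNear.sub (hf : SmoothNear f a) (hg : SmoothNear g a) :
    SmoothNear (fun x => f x - g x) a := by
  filter_upwards [hf, hg] with x hx hx' using hx.sub hx'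

theorem SmoothNear.neg (hf : SmoothNear f a) : SmoothNear (fun x => - f x) a := by
  filter_upwards [hf] with x hx using hx.neg

theorem SmoothNear.const (c : Y) : SmoothNear (fun _ : X => c) a :=
  Filter.Eventually.of_forall fun _ => contDiffAt_const

theorem SmoothNear.sum {ι : Type*} {s : Finset ι} {f : ι → X → Y}
    (hf : ∀ i ∈ s, SmoothNear (f i) a) : SmoothNear (fun x => ∑ i ∈ s, f i x) a := by
  filter_upwards [(Filter.eventually_all_finset s).2 hf] with x hx using ContDiffAt.sum hx

variable {u v : X → ℝ}

theorem SmoothNear.mul (hf : SmoothNear u a) (hg : SmoothNear v a) :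
    SmoothNear (fun x => u x * v x) a := by
  filter_upwards [hf, hg] with x hx hx' using hx.mul hx'

theorem SmoothNear.inv (hf : SmoothNear u a) (h0 : u a ≠ 0) :
    SmoothNear (fun x => (u x)⁻¹) a := by
  filter_upwards [hf, hf.continuousAt.eventually_ne h0] with x hx hx' using hx.inv hx'

theorem SmoothNear.div (hf : SmoothNear u a) (hg : SmoothNear v a) (h0 : v a ≠ 0) :
    SmoothNear (fun x => u x / v x) a := by
  simpa [div_eq_mul_inv] using hf.mul (hg.inv h0)

theorem SmoothNear.pow (hf : SmoothNear u a) (n : ℕ) : SmoothNear (fun x => u x ^ n) a := by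
  filter_upwards [hf] with x hx using hx.pow n

/-- A smooth germ at a point of a finite-dimensional space has a smooth representative that is
defined everywhere. -/
theorem SmoothNear.exists_contDiff [FiniteDimensional ℝ X] (hf : SmoothNear f a) :
    ∃ F : X → Y, ContDiff ℝ ∞ F ∧ F =ᶠ[𝓝 a] f := by
  obtain ⟨r, hr, hball⟩ := Metric.eventually_nhds_iff_ball.1 hf
  let χ : ContDiffBump a := ⟨r / 4, r / 2, by positivity, by linarith⟩
  refine ⟨fun x => χ x • f x, contDiff_iff_contDiffAt.2 fun x => ?_, ?_⟩
  · by_cases hx : x ∈ Metric.ball a r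
    · exact χ.contDiff.contDiffAt.smul (hball x hx)
    · have : (fun x => χ x • f x) =ᶠ[𝓝 x] fun _ => 0 := by
        have h1 : ∀ᶠ z in 𝓝 x, r / 2 < dist z a :=
          (isOpen_lt continuous_const (continuous_id.dist continuous_const)).mem_nhds
            (by rw [Metric.mem_ball, not_lt] at hx; simp only [id]; exact lt_of_lt_of_le (by linarith) hx)
        filter_upwards [h1] with z hz
        rw [χ.zero_of_le_dist hz.le, zero_smul]
      exact contDiffAt_const.congr_of_eventuallyEq this
  · filter_upwards [χ.eventuallyEq_one] with x hx
    rw [hx, Pi.one_apply, one_smul]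

end Germs

/-! ### Partial derivatives -/

section PartialDerivatives

variable {f g : E3 → ℝ} {x a : E3} {i j : Fin 3}

theorem sum_coord_smul (v : E3) : ∑ i, v i • EuclideanSpace.single i (1 : ℝ) = v := by
  ext j
  simp [Fin.sum_univ_three]
  fin_cases j <;> simp

theorem fderiv_eq_sum_pd (f : E3 → ℝ) (x v : E3) : fderiv ℝ f x v = ∑ i, v i * pd i f x := by
  conv_lhs => rw [← sum_coord_smul v]
  simp [pd]

theorem pd_congr (h : f =ᶠ[𝓝 x] g) (i : Fin 3) : pd i f x = pd i g x := by
  rw [pd, pd, h.fderiv_eq]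

theorem pd_eventuallyEq (h : f =ᶠ[𝓝 x] g) (i : Fin 3) : pd i f =ᶠ[𝓝 x] pd i g :=
  h.eventuallyEq_nhds.mono fun _ hy => pd_congr hy i

theorem contDiffAt_pd {m n : WithTop ℕ∞} (hf : ContDiffAt ℝ n f x) (hmn : m + 1 ≤ n)
    (i : Fin 3) : ContDiffAt ℝ m (pd i f) x :=
  (hf.fderiv_right hmn).clm_apply contDiffAt_const

theorem SmoothNear.pd (hf : SmoothNear f x) (i : Fin 3) : SmoothNear (pd i f) x :=
  hf.mono fun _ h => contDiffAt_pd h (by simp) i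

theorem pd_add (hf : DifferentiableAt ℝ f x) (hg : DifferentiableAt ℝ g x) :
    pd i (fun z => f z + g z) x = pd i f x + pd i g x := by
  simp only [pd, fderiv_fun_add hf hg, add_apply]

theorem pd_sub (hf : DifferentiableAt ℝ f x) (hg : DifferentiableAt ℝ g x) :
    pd i (fun z => f z - g z) x = pd i f x - pd i g x := by
  simp only [pd, fderiv_fun_sub hf hg, sub_apply]

theorem pd_neg : pd i (fun z => - f z) x = - pd i f x := by
  simp only [pd, fderiv_fun_neg, neg_apply]

theorem pd_mul (hf : DifferentiableAt ℝ f x) (hg : DifferentiableAt ℝ g x) :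
    pd i (fun z => f z * g z) x = pd i f x * g x + f x * pd i g x := by
  simp only [pd, fderiv_fun_mul hf hg, add_apply,
    smul_apply, smul_eq_mul]
  ring

theorem pd_const (c : ℝ) : pd i (fun _ => c) x = 0 := by simp [pd]

theorem pd_const_mul (c : ℝ) (hf : DifferentiableAt ℝ f x) :
    pd i (fun z => c * f z) x = c * pd i f x := by
  simp [pd, fderiv_const_mul hf]

theorem pd_sum {ι : Type*} {s : Finset ι} {f : ι → E3 → ℝ}
    (hf : ∀ k ∈ s, DifferentiableAt ℝ (f k) x) :
    pd i (fun z => ∑ k ∈ s, f k z) x = ∑ k ∈ s, pd i (f k) x := by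
  simp [pd, fderiv_fun_sum hf]

theorem pd_coord (i j : Fin 3) (x : E3) : pd i (fun z : E3 => z j) x = if j = i then 1 else 0 := by
  have : HasFDerivAt (fun z : E3 => z j) (EuclideanSpace.proj j : E3 →L[ℝ] ℝ) x :=
    (EuclideanSpace.proj j : E3 →L[ℝ] ℝ).hasFDerivAt
  rw [pd, this.fderiv]
  simp

theorem pd_comp_real {u : ℝ → ℝ} {d : ℝ} (hu : HasDerivAt u d (f x)) (hf : DifferentiableAt ℝ f x) :
    pd i (fun z => u (f z)) x = d * pd i f x := by
  have := hu.comp_hasFDerivAt x hf.hasFDerivAt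
  rw [pd, show (fun z => u (f z)) = u ∘ f from rfl, this.fderiv]
  simp [pd]

theorem pd_inv (hf : DifferentiableAt ℝ f x) (h0 : f x ≠ 0) :
    pd i (fun z => (f z)⁻¹) x = - pd i f x / f x ^ 2 := by
  rw [pd_comp_real (hasDerivAt_inv h0) hf]
  ring

theorem pd_comm (hf : ContDiffAt ℝ 2 f x) (i j : Fin 3) : pd i (pd j f) x = pd j (pd i f) x := by
  have hd : DifferentiableAt ℝ (fderiv ℝ f) x :=
    (hf.fderiv_right (m := 1) (by norm_num)).differentiableAt (by simp)
  have key : ∀ i j : Fin 3, pd i (pd j f) x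
      = fderiv ℝ (fderiv ℝ f) x (EuclideanSpace.single i 1) (EuclideanSpace.single j 1) := by
    intro i j
    have h : HasFDerivAt (pd j f) ((ContinuousLinearMap.apply ℝ ℝ
        (EuclideanSpace.single j (1 : ℝ) : E3)).comp (fderiv ℝ (fderiv ℝ f) x)) x :=
      (ContinuousLinearMap.apply ℝ ℝ
        (EuclideanSpace.single j (1 : ℝ) : E3)).hasFDerivAt.comp x hd.hasFDerivAt
    rw [pd, h.fderiv]
    rfl
  rw [key, key]
  exact (hf.isSymmSndFDerivAt (by simp)) _ _

theorem pd_eq_of_hasDerivAt {d : ℝ} (hf : DifferentiableAt ℝ f x)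
    (h : HasDerivAt (fun t : ℝ => f (x + t • EuclideanSpace.single i 1)) d 0) : pd i f x = d := by
  have h1 : HasDerivAt (fun t : ℝ => x + t • (EuclideanSpace.single i (1 : ℝ) : E3))
      (EuclideanSpace.single i 1) 0 := by
    simpa using ((hasDerivAt_id (0 : ℝ)).smul_const
      (EuclideanSpace.single i (1 : ℝ) : E3)).const_add x
  have h2 : HasFDerivAt f (fderiv ℝ f x) (x + (0 : ℝ) • (EuclideanSpace.single i (1 : ℝ) : E3)) := by
    simpa using hf.hasFDerivAt
  exact (h2.comp_hasDerivAt (0 : ℝ) h1).unique h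

theorem hasDerivAt_line (hf : DifferentiableAt ℝ f x) {y : E3} {t : ℝ}
    (hx : x = y + t • EuclideanSpace.single i 1) :
    HasDerivAt (fun t : ℝ => f (y + t • EuclideanSpace.single i 1)) (pd i f x) t := by
  have h1 : HasDerivAt (fun t : ℝ => y + t • (EuclideanSpace.single i (1 : ℝ) : E3))
      (EuclideanSpace.single i 1) t := by
    simpa using ((hasDerivAt_id t).smul_const
      (EuclideanSpace.single i (1 : ℝ) : E3)).const_add y
  have h2 : HasFDerivAt f (fderiv ℝ f x) (y + t • (EuclideanSpace.single i (1 : ℝ) : E3)) := by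
    rw [← hx]; exact hf.hasFDerivAt
  exact h2.comp_hasDerivAt t h1

/-- The Jacobian matrix. -/
def jac (ψ : E3 → E3) (x : E3) : Matrix (Fin 3) (Fin 3) ℝ :=
  Matrix.of fun a i => pd i (fun z => ψ z a) x

theorem jac_apply (ψ : E3 → E3) (x : E3) (a i : Fin 3) :
    jac ψ x a i = pd i (fun z => ψ z a) x := rfl

theorem hasFDerivAt_coord {ψ : E3 → E3} (hψ : DifferentiableAt ℝ ψ x) (j : Fin 3) :
    HasFDerivAt (fun z => ψ z j) ((EuclideanSpace.proj j : E3 →L[ℝ] ℝ).comp (fderiv ℝ ψ x)) x :=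
  (EuclideanSpace.proj j : E3 →L[ℝ] ℝ).hasFDerivAt.comp x hψ.hasFDerivAt

theorem SmoothNear.coord {X : Type*} [NormedAddCommGroup X] [NormedSpace ℝ X] {ψ : X → E3} {x : X}
    (hψ : SmoothNear ψ x) (j : Fin 3) : SmoothNear (fun z => ψ z j) x :=
  hψ.mono fun y hy => (EuclideanSpace.proj j : E3 →L[ℝ] ℝ).contDiff.contDiffAt.comp y hy

theorem smoothNear_of_coord {X : Type*} [NormedAddCommGroup X] [NormedSpace ℝ X] {ψ : X → E3}
    {x : X} (h : ∀ j, SmoothNear (fun z => ψ z j) x) : SmoothNear ψ x := by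
  filter_upwards [Filter.eventually_all.2 h] with y hy
  exact contDiffAt_euclidean.2 hy

theorem smoothNear_coord (j : Fin 3) : SmoothNear (fun z : E3 => z j) x :=
  SmoothNear.coord (ψ := fun z => z) (smoothNear_of_contDiff contDiff_id x) j

theorem fderiv_apply_eq_jac {ψ : E3 → E3} (hψ : DifferentiableAt ℝ ψ x) (v : E3) (j : Fin 3) :
    fderiv ℝ ψ x v j = ∑ i, jac ψ x j i * v i := by
  have h := (hasFDerivAt_coord hψ j).fderiv
  have h1 := fderiv_eq_sum_pd (fun z => ψ z j) x v
  rw [h] at h1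
  simp only [jac_apply]
  refine h1.trans (Finset.sum_congr rfl fun i _ => mul_comm _ _)

theorem pd_comp {ψ : E3 → E3} (hf : DifferentiableAt ℝ f (ψ x)) (hψ : DifferentiableAt ℝ ψ x)
    (i : Fin 3) : pd i (fun z => f (ψ z)) x = ∑ a, pd a f (ψ x) * jac ψ x a i := by
  have h := (hf.hasFDerivAt.comp x hψ.hasFDerivAt).fderiv
  rw [pd, show (fun z => f (ψ z)) = f ∘ ψ from rfl, h, ContinuousLinearMap.comp_apply,
    fderiv_eq_sum_pd]
  refine Finset.sum_congr rfl fun a _ => ?_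
  rw [fderiv_apply_eq_jac hψ, mul_comm]
  congr 1
  simp

theorem jac_comp {ψ χ : E3 → E3} (hχ : DifferentiableAt ℝ χ (ψ x)) (hψ : DifferentiableAt ℝ ψ x) :
    jac (fun z => χ (ψ z)) x = jac χ (ψ x) * jac ψ x := by
  ext a i
  rw [jac_apply, Matrix.mul_apply, pd_comp (f := fun z => χ z a)
    (hasFDerivAt_coord hχ a).differentiableAt hψ]
  rfl

theorem jac_id : jac (fun z => z) x = 1 := by
  ext a i
  rw [jac_apply, pd_coord, Matrix.one_apply]

theorem jac_congr {ψ χ : E3 → E3} (h : ψ =ᶠ[𝓝 x] χ) : jac ψ x = jac χ x := by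
  ext a i
  exact pd_congr (h.mono fun z hz => by simp only [hz]) i

/-- The derivative of a map with invertible Jacobian matrix, as an equivalence. -/
theorem exists_equiv_of_jac_det_ne_zero {ψ : E3 → E3} (hψ : DifferentiableAt ℝ ψ x)
    (h : (jac ψ x).det ≠ 0) : ∃ L : E3 ≃L[ℝ] E3, HasFDerivAt ψ (L : E3 →L[ℝ] E3) x := by
  have hinj : Function.Injective (fderiv ℝ ψ x) := by
    rw [injective_iff_map_eq_zero]
    intro v hv
    have h1 : (jac ψ x).mulVec (fun i => v i) = 0 := by
      ext j
      have := fderiv_apply_eq_jac hψ v j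
      rw [hv] at this
      simpa [Matrix.mulVec, dotProduct] using this.symm
    have h2 := Matrix.eq_zero_of_mulVec_eq_zero h h1
    ext i
    exact congrFun h2 i
  refine ⟨(LinearEquiv.ofInjectiveEndo (fderiv ℝ ψ x : E3 →ₗ[ℝ] E3)
    hinj).toContinuousLinearEquiv, ?_⟩
  convert! hψ.hasFDerivAt using 1

/-- The map that sets the `i`-th coordinate to `c`. -/
def freeze (i : Fin 3) (c : ℝ) (x : E3) : E3 := x + (c - x i) • EuclideanSpace.single i 1

theorem freeze_apply (i : Fin 3) (c : ℝ) (x : E3) (j : Fin 3) :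
    freeze i c x j = if j = i then c else x j := by
  by_cases h : j = i
  · subst h; simp [freeze]
  · simp [freeze, h]

theorem freeze_self (i : Fin 3) (x : E3) : freeze i (x i) x = x := by simp [freeze]

theorem contDiff_freeze (i : Fin 3) (c : ℝ) : ContDiff ℝ ∞ (freeze i c) := by
  have h : ContDiff ℝ ∞ (fun x : E3 => x i) := (EuclideanSpace.proj i : E3 →L[ℝ] ℝ).contDiff
  exact contDiff_id.add ((contDiff_const.sub h).smul contDiff_const)

theorem freeze_add_single (i : Fin 3) (c t : ℝ) (x : E3) :
    freeze i c (x + t • EuclideanSpace.single i 1) = freeze i c x := by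
  ext j
  rw [freeze_apply, freeze_apply]
  split_ifs with h
  · rfl
  · simp [h]

theorem eq_freeze_add (i : Fin 3) (c : ℝ) (x : E3) :
    x = freeze i c x + (x i - c) • EuclideanSpace.single i 1 := by
  rw [freeze, add_assoc, ← add_smul]
  simp

/-- A function whose `i`-th partial derivative vanishes does not depend on the `i`-th coordinate. -/
theorem eventually_eq_freeze (hf : SmoothNear f a) (h : ∀ᶠ x in 𝓝 a, pd i f x = 0) :
    ∀ᶠ x in 𝓝 a, f x = f (freeze i (a i) x) := by
  obtain ⟨r, hr, hball⟩ := Metric.eventually_nhds_iff_ball.1 (hf.and h)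
  have hc : ∀ᶠ x in 𝓝 a, freeze i (a i) x ∈ Metric.ball a r := by
    have h1 : ContinuousAt (freeze i (a i)) a := (contDiff_freeze i (a i)).continuous.continuousAt
    have h2 := h1.eventually (p := fun y => y ∈ Metric.ball a r)
    rw [freeze_self] at h2
    exact h2 (Metric.ball_mem_nhds a hr)
  filter_upwards [hc, Metric.ball_mem_nhds a hr] with x hx1 hx2
  set y := freeze i (a i) x with hy
  set l := x i - a i
  have hx : x = y + l • EuclideanSpace.single i 1 := eq_freeze_add i (a i) x
  have hseg : ∀ t ∈ Set.Icc (0 : ℝ) 1,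
      y + (t * l) • (EuclideanSpace.single i 1 : E3) ∈ Metric.ball a r := by
    intro t ht
    have := (convex_ball a r).add_smul_sub_mem hx1 hx2 ht
    rwa [show x - y = l • EuclideanSpace.single i 1 by rw [hx]; simp, smul_smul] at this
  have hder : ∀ t ∈ Set.Icc (0 : ℝ) 1, HasDerivAt
      (fun t : ℝ => f (y + (t * l) • EuclideanSpace.single i 1)) 0 t := by
    intro t ht
    have hb := hball _ (hseg t ht)
    have h1 := hasDerivAt_line (i := i) (y := y) (t := t * l) (hb.1.differentiableAt (by simp)) rfl
    rw [hb.2] at h1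
    have h2 := HasDerivAt.comp (h₂ := fun s : ℝ => f (y + s • EuclideanSpace.single i 1))
      (h := fun t : ℝ => t * l) t h1 ((hasDerivAt_id t).mul_const l)
    rw [zero_mul] at h2
    exact h2
  have h2 := constant_of_has_deriv_right_zero (f := fun t : ℝ =>
    f (y + (t * l) • EuclideanSpace.single i 1)) (a := 0) (b := 1)
    (fun t ht => (hder t ht).continuousAt.continuousWithinAt)
    (fun t ht => (hder t ⟨ht.1, ht.2.le⟩).hasDerivWithinAt) 1 (by simp)
  simp only [one_mul, zero_mul, zero_smul, add_zero] at h2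
  rw [← hx] at h2
  exact h2

end PartialDerivatives

/-! ### Local inverses, primitives and straightening of vector fields -/

section Constructions
variable {f g : E3 → ℝ} {x a : E3} {i j : Fin 3}

/-- Smooth local inverse of a map of `ℝ³` with invertible Jacobian matrix. -/
theorem exists_local_inverse {ψ : E3 → E3} (hψ : SmoothNear ψ a) (h : (jac ψ a).det ≠ 0) :
    ∃ Ψ : OpenPartialHomeomorph E3 E3, a ∈ Ψ.source ∧ (∀ x, Ψ x = ψ x) ∧
      (∀ x ∈ Ψ.source, ContDiffAt ℝ ∞ ψ x) ∧ ∀ y ∈ Ψ.target, ContDiffAt ℝ ∞ Ψ.symm y := by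
  obtain ⟨L, hL⟩ := exists_equiv_of_jac_det_ne_zero (hψ.contDiffAt.differentiableAt (by simp)) h
  exact exists_openPartialHomeomorph_of_smoothNear hψ hL

/-- The integral from c to x_i is rescaled to (x_i - c) times an integral over the unit interval. In
this form it is a composition of smooth maps with a superposition operator, so smooth dependence on
all coordinates needs no differentiation under the integral. -/
theorem exists_primitive_of_contDiff (hg : ContDiff ℝ ∞ g) (i : Fin 3) (c : ℝ) :
    ∃ G : E3 → ℝ, ContDiff ℝ ∞ G ∧ ∀ x, pd i G x = g x := by
  let g' : C(E3, ℝ) := ⟨g, hg.continuous⟩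
  let e : E3 := EuclideanSpace.single i 1
  let ray : C(UI, E3) := ⟨fun τ => (τ : ℝ) • e, by fun_prop⟩
  let path : E3 → C(UI, E3) := fun x => ContinuousMap.const UI (freeze i c x) + (x i - c) • ray
  have hci : ContDiff ℝ ∞ (fun x : E3 => x i) := (EuclideanSpace.proj i : E3 →L[ℝ] ℝ).contDiff
  have hpath : ContDiff ℝ ∞ path := by
    have h1 : ContDiff ℝ ∞ (fun x : E3 => ContinuousLinearMap.const ℝ UI x) :=
      ContinuousLinearMap.contDiff _
    exact (h1.comp (contDiff_freeze i c)).add ((hci.sub contDiff_const).smul contDiff_const)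
  let G : E3 → ℝ := fun x => (x i - c) * volterra (g'.comp (path x)) ⟨1, by simp⟩
  have hG : ContDiff ℝ ∞ G := by
    refine (hci.sub contDiff_const).mul ?_
    exact (ContinuousMap.evalCLM ℝ (⟨1, by simp⟩ : UI)).contDiff.comp
      ((contDiff_volterra_comp g' hg).comp hpath)
  have hGint : ∀ x, G x = ∫ r in (0 : ℝ)..(x i - c), g (freeze i c x + r • e) := by
    intro x
    have h2 := intervalIntegral.smul_integral_comp_mul_left (a := 0) (b := 1)
      (fun r => g (freeze i c x + r • e)) (x i - c)
    rw [mul_zero, mul_one] at h2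
    rw [← h2, smul_eq_mul]
    simp only [G, volterra_apply]
    congr 1
    refine intervalIntegral.integral_congr fun r hr => ?_
    rw [Set.uIcc_of_le zero_le_one] at hr
    simp only [Set.IccExtend_of_mem _ _ hr]
    show g (freeze i c x + (x i - c) • r • e) = _
    rw [smul_smul]
  refine ⟨G, hG, fun x => pd_eq_of_hasDerivAt (hG.differentiable (by simp) x) ?_⟩
  have hcont : Continuous fun r : ℝ => g (freeze i c x + r • e) :=
    hg.continuous.comp (by fun_prop)
  have h1 : HasDerivAt (fun s => ∫ r in (0 : ℝ)..s, g (freeze i c x + r • e))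
      (g (freeze i c x + (x i - c) • e)) (x i + 0 - c) := by
    rw [add_zero]
    exact intervalIntegral.integral_hasDerivAt_right (hcont.intervalIntegrable _ _)
      hcont.stronglyMeasurable.stronglyMeasurableAtFilter hcont.continuousAt
  rw [show freeze i c x + (x i - c) • e = x from (eq_freeze_add i c x).symm] at h1
  have h2 : HasDerivAt (fun t : ℝ => x i + t - c) 1 0 :=
    ((hasDerivAt_id (0 : ℝ)).const_add (x i)).sub_const c
  have h3 := HasDerivAt.comp (h := fun t : ℝ => x i + t - c) (0 : ℝ) h1 h2
  rw [mul_one] at h3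
  refine h3.congr_of_eventuallyEq (Filter.Eventually.of_forall fun t => ?_)
  show G (x + t • e) = _
  rw [hGint, freeze_add_single]
  simp [e]

theorem exists_primitive (hg : SmoothNear g a) (i : Fin 3) :
    ∃ G : E3 → ℝ, SmoothNear G a ∧ ∀ᶠ x in 𝓝 a, pd i G x = g x := by
  obtain ⟨g', hg', he⟩ := hg.exists_contDiff
  obtain ⟨G, hG, h⟩ := exists_primitive_of_contDiff hg' i 0
  exact ⟨G, smoothNear_of_contDiff hG a, he.mono fun x hx => (h x).trans hx⟩

/-- A germ that depends on the third coordinate only is a smooth function of that coordinate. -/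
theorem exists_eq_comp_coord_two (hf : SmoothNear f a) (h0 : ∀ᶠ x in 𝓝 a, pd 0 f x = 0)
    (h1 : ∀ᶠ x in 𝓝 a, pd 1 f x = 0) :
    ∃ R : ℝ → ℝ, ContDiff ℝ ∞ R ∧ ∀ᶠ x in 𝓝 a, f x = R (x 2) := by
  obtain ⟨F, hF, he⟩ := hf.exists_contDiff
  have hF0 : ∀ᶠ x in 𝓝 a, pd 0 F x = 0 := by
    filter_upwards [pd_eventuallyEq he 0, h0] with x hx hx' using hx.trans hx'
  have hF1 : ∀ᶠ x in 𝓝 a, pd 1 F x = 0 := by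
    filter_upwards [pd_eventuallyEq he 1, h1] with x hx hx' using hx.trans hx'
  have e0 := eventually_eq_freeze (smoothNear_of_contDiff hF a) hF0
  have e1 := eventually_eq_freeze (smoothNear_of_contDiff hF a) hF1
  let c : ℝ → E3 := fun t => WithLp.toLp 2 ![a 0, a 1, t]
  have hc : ContDiff ℝ ∞ c := by
    rw [contDiff_euclidean]
    intro i
    fin_cases i
    · exact contDiff_const
    · exact contDiff_const
    · exact contDiff_id
  refine ⟨fun t => F (c t), hF.comp hc, ?_⟩
  have hfz : ContinuousAt (freeze 0 (a 0)) a := (contDiff_freeze _ _).continuous.continuousAt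
  have h2 := hfz.eventually (p := fun y => F y = F (freeze 1 (a 1) y)) (by rwa [freeze_self])
  filter_upwards [he, e0, h2] with x hx hx0 hx1
  rw [← hx, hx0, hx1]
  congr 1
  ext i
  fin_cases i <;> simp [freeze_apply, c]

/-- Straightening of a nonvanishing smooth vector field. -/
theorem exists_straighten {V : E3 → E3} (hV : SmoothNear V a) (h0 : V a ≠ 0) :
    ∃ ψ : E3 → E3, SmoothNear ψ a ∧ (jac ψ a).det ≠ 0 ∧
      ∀ᶠ x in 𝓝 a, ∀ b, ∑ i, jac ψ x b i * V x i = if b = 1 then 1 else 0 := by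
  -- The hyperplane x_k = a_k is transversal to V at `a`. Flowing from it, with x_k - a_k as time,
  -- gives the map `Θ` that carries ∂_k to V.
  obtain ⟨k, hk⟩ : ∃ k, V a k ≠ 0 := by
    by_contra! h
    exact h0 (by ext k; simpa using h k)
  obtain ⟨V', hV', he⟩ := hV.exists_contDiff
  obtain ⟨Φ, hΦ, hode, hinit⟩ := exists_flow ⟨V', hV'.continuous⟩ hV' a
  let e : E3 := EuclideanSpace.single k 1
  let j : E3 → ℝ × E3 := fun q => (q k - a k, freeze k (a k) q)
  have hck : ContDiff ℝ ∞ (fun x : E3 => x k) := (EuclideanSpace.proj k : E3 →L[ℝ] ℝ).contDiff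
  have hj : ContDiff ℝ ∞ j := (hck.sub contDiff_const).prodMk (contDiff_freeze _ _)
  have hja : j a = (0, a) := by simp [j, freeze_self]
  let Θ : E3 → E3 := fun q => Φ (j q)
  have hΘ : SmoothNear Θ a := SmoothNear.comp (by rwa [hja]) (smoothNear_of_contDiff hj a)
  have hΘa : Θ a = a := by
    show Φ (j a) = a
    rw [hja]; exact hinit.self_of_nhds
  have hjc : Filter.Tendsto j (𝓝 a) (𝓝 ((0 : ℝ), a)) := hja ▸ hj.continuous.tendsto a
  have hΘk : ∀ᶠ q in 𝓝 a, ∀ b, jac Θ q b k = V' (Θ q) b := by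
    filter_upwards [hΘ, hjc.eventually hode] with q hq hd b
    refine pd_eq_of_hasDerivAt (hasFDerivAt_coord (hq.differentiableAt (by simp)) b).differentiableAt
      ?_
    have h1 : HasDerivAt (fun s => Φ (s, freeze k (a k) q)) (V' (Θ q)) (q k + 0 - a k) := by
      rw [add_zero]; exact hd
    have h2 : HasDerivAt (fun t : ℝ => q k + t - a k) 1 0 :=
      ((hasDerivAt_id (0 : ℝ)).const_add (q k)).sub_const (a k)
    have h3 := HasDerivAt.scomp (h := fun t : ℝ => q k + t - a k) (0 : ℝ) h1 h2
    rw [one_smul] at h3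
    have h4 : HasDerivAt (fun t : ℝ => Θ (q + t • EuclideanSpace.single k 1)) (V' (Θ q)) 0 := by
      refine h3.congr_of_eventuallyEq (Filter.Eventually.of_forall fun t => ?_)
      show Φ (j _) = _
      simp [j, freeze_add_single]
    exact (EuclideanSpace.proj b : E3 →L[ℝ] ℝ).hasFDerivAt.comp_hasDerivAt (0 : ℝ) h4
  have hΘi : ∀ i, i ≠ k → ∀ b, jac Θ a b i = if b = i then 1 else 0 := by
    intro i hi b
    refine pd_eq_of_hasDerivAt (hasFDerivAt_coord (hΘ.contDiffAt.differentiableAt (by simp))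
      b).differentiableAt ?_
    have hl : Continuous fun t : ℝ => a + t • (EuclideanSpace.single i 1 : E3) := by fun_prop
    have hl0 : Filter.Tendsto (fun t : ℝ => a + t • (EuclideanSpace.single i 1 : E3)) (𝓝 0) (𝓝 a) := by
      simpa using hl.tendsto 0
    have h1 : HasDerivAt (fun t : ℝ => a b + t * (if b = i then 1 else 0))
        (if b = i then 1 else 0) 0 := by
      simpa using ((hasDerivAt_id (0 : ℝ)).mul_const (if b = i then (1 : ℝ) else 0)).const_add (a b)
    refine h1.congr_of_eventuallyEq ?_
    filter_upwards [hl0.eventually hinit] with t ht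
    have h2 : j (a + t • (EuclideanSpace.single i 1 : E3)) = (0, a + t • EuclideanSpace.single i 1) := by
      have h3 : (a + t • (EuclideanSpace.single i 1 : E3)) k = a k := by simp [hi.symm]
      have h4 := freeze_self k (a + t • (EuclideanSpace.single i 1 : E3))
      rw [h3] at h4
      simp only [j, h3, h4, sub_self]
    show Φ (j _) b = _
    rw [h2, ht]
    simp
  -- At `a` the columns of the Jacobian are the basis vectors, except that the k-th column is V(a).
  have hdet : (jac Θ a).det ≠ 0 := by
    have hka : ∀ b, jac Θ a b k = V a b := fun b => by
      rw [hΘk.self_of_nhds b, hΘa, he.self_of_nhds]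
    have : (jac Θ a).det = V a k := by
      rw [Matrix.det_fin_three]
      fin_cases k <;> simp_all (config := { decide := true })
    rwa [this]
  obtain ⟨Ψ, ha, hΨ, hs, hsymm⟩ := exists_local_inverse hΘ hdet
  have hΨa : Ψ a = a := (hΨ a).trans hΘa
  have hat : a ∈ Ψ.target := hΨa ▸ Ψ.map_source ha
  have hsa : Ψ.symm a = a := by
    conv_lhs => rw [← hΨa]
    exact Ψ.left_inv ha
  have hjm : ∀ x ∈ Ψ.target, jac Ψ.symm x * jac Θ (Ψ.symm x) = 1 ∧
      jac Θ (Ψ.symm x) * jac Ψ.symm x = 1 := by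
    intro x hx
    have hx' := Ψ.map_target hx
    have h1 : (fun z => Θ (Ψ.symm z)) =ᶠ[𝓝 x] fun z => z := by
      filter_upwards [Ψ.open_target.mem_nhds hx] with z hz
      rw [← hΨ, Ψ.right_inv hz]
    have h2 := jac_comp ((hs _ hx').differentiableAt (by simp))
      ((hsymm x hx).differentiableAt (by simp))
    rw [jac_congr h1, jac_id] at h2
    exact ⟨mul_eq_one_comm.1 h2.symm, h2.symm⟩
  have htar : ∀ᶠ x in 𝓝 a, x ∈ Ψ.target := Ψ.open_target.mem_nhds hat
  have hsm : SmoothNear Ψ.symm a := htar.mono fun x hx => hsymm x hx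
  -- The flow time is moved from position k to position 1, which is the place of the coordinate x in
  -- (y, x, t).
  let σ := Equiv.swap k 1
  let ψ : E3 → E3 := fun x => WithLp.toLp 2 fun b => Ψ.symm x (σ b)
  have hjψ : ∀ x b i, jac ψ x b i = jac Ψ.symm x (σ b) i := fun x b i => rfl
  refine ⟨ψ, smoothNear_of_coord fun b => hsm.coord (σ b), ?_, ?_⟩
  · have h1 : jac ψ a = (jac Ψ.symm a).submatrix σ id := by ext b i; exact hjψ a b i
    rw [h1, Matrix.det_permute]
    refine mul_ne_zero ?_ ?_
    · exact_mod_cast (Equiv.Perm.sign σ).ne_zero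
    · have h3 := congrArg Matrix.det (hjm a hat).1
      rw [Matrix.det_mul, Matrix.det_one] at h3
      exact left_ne_zero_of_mul_eq_one h3
  · have hsc : Filter.Tendsto Ψ.symm (𝓝 a) (𝓝 a) := by
      have := hsm.continuousAt
      rwa [ContinuousAt, hsa] at this
    filter_upwards [htar, hsc.eventually hΘk, he] with x hx hxk hxe b
    have h1 : Θ (Ψ.symm x) = x := by rw [← hΨ, Ψ.right_inv hx]
    have h2 : ∑ i, jac Ψ.symm x (σ b) i * jac Θ (Ψ.symm x) i k = if σ b = k then 1 else 0 := by
      have := congrFun (congrFun (hjm x hx).1 (σ b)) k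
      rwa [Matrix.mul_apply, Matrix.one_apply] at this
    simp only [hxk, h1, hxe] at h2
    simp only [hjψ, h2]
    have : σ b = k ↔ b = 1 := by
      rw [Equiv.swap_apply_eq_iff, Equiv.swap_apply_left]
    simp only [this]

end Constructions

/-! ### Pointwise algebra of the curvature -/

section Algebra

variable (h H dh C : Fin 3 → Fin 3 → ℝ) (K dK : Fin 3 → Fin 3 → Fin 3 → Fin 3 → ℝ)
  (F dF : Fin 3 → Fin 3 → ℝ) (w : ℝ)

/-- The covariant derivative, in a fixed direction, of an array of the type of the curvature:
`C` are the connection coefficients in this direction, `dK` the partial derivatives. -/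
def covCurv (l k i j : Fin 3) : ℝ :=
  dK l k i j + ∑ p, (C l p * K p k i j - C p k * K l p i j - C p i * K l k p j - C p j * K l k i p)

/-- The covariant derivative, in a fixed direction, of a covariant two-tensor. -/
def covTwo (i j : Fin 3) : ℝ := dF i j - ∑ p, (C p i * F p j + C p j * F i p)

/-- This is the Leibniz rule for the identity expressing that the curvature preserves the conformal
class. Since D h is w times h, both sides acquire the same extra term with factor w, and these terms
cancel. -/
theorem covCurv_skew (hsym : ∀ i j, h i j = h j i)
    (hK : ∀ n k i j, ∑ l, (h n l * K l k i j + h k l * K l n i j) = -2 * F i j * h n k)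
    (hdK : ∀ n k i j, ∑ l, (dh n l * K l k i j + h n l * dK l k i j + dh k l * K l n i j
      + h k l * dK l n i j) = -2 * (dF i j * h n k + F i j * dh n k))
    (hdh : ∀ i j, dh i j = ∑ k, (C k i * h k j + C k j * h i k) + w * h i j) (n k i j : Fin 3) :
    ∑ l, (h n l * covCurv C K dK l k i j + h k l * covCurv C K dK l n i j)
      = -2 * covTwo C F dF i j * h n k := by
  have e1 := hdK n k i j
  have a0 := hK 0 k i j
  have a1 := hK 1 k i j
  have a2 := hK 2 k i j
  have b0 := hK n 0 i j
  have b1 := hK n 1 i j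
  have b2 := hK n 2 i j
  have c0 := hK n k 0 j
  have c1 := hK n k 1 j
  have c2 := hK n k 2 j
  have d0 := hK n k i 0
  have d1 := hK n k i 1
  have d2 := hK n k i 2
  have a5 := hK n k i j
  clear hK hdK
  simp only [covCurv, covTwo, hdh, Fin.sum_univ_three, hsym k 0, hsym k 1, hsym k 2, hsym n 0,
    hsym n 1, hsym n 2, hsym 1 0, hsym 2 0, hsym 2 1] at e1 a0 a1 a2 b0 b1 b2 c0 c1 c2 d0 d1 d2 a5 ⊢
  linear_combination e1 - C 0 n * a0 - C 1 n * a1 - C 2 n * a2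
    - C 0 k * b0 - C 1 k * b1 - C 2 k * b2 - C 0 i * c0 - C 1 i * c1 - C 2 i * c2
    - C 0 j * d0 - C 1 j * d1 - C 2 j * d2 - w * a5

/-- Covariant differentiation commutes with the contraction of an upper with a lower index, so the
connection terms at the contracted pair cancel. -/
theorem covCurv_trace (hK : ∀ k j, ∑ i, K i k i j = -(3 / 2) * F k j)
    (hdK : ∀ k j, ∑ i, dK i k i j = -(3 / 2) * dF k j) (k j : Fin 3) :
    ∑ i, covCurv C K dK i k i j = -(3 / 2) * covTwo C F dF k j := by
  have e1 := hdK k j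
  have a1 : ∀ p, _ := fun p => hK p j
  have a2 : ∀ p, _ := fun p => hK k p
  simp only [covCurv, covTwo, Fin.sum_univ_three] at *
  linear_combination e1 - C 0 k * a1 0 - C 1 k * a1 1 - C 2 k * a1 2
    - C 0 j * a2 0 - C 1 j * a2 1 - C 2 j * a2 2

/-- The differential Bianchi identity. -/
theorem bianchi_matrix {R : Type*} [Ring R] (A : Fin 3 → R) (dA : Fin 3 → Fin 3 → R)
    (ddA : Fin 3 → Fin 3 → Fin 3 → R) (hdd : ∀ m i j, ddA m i j = ddA i m j) (m i j : Fin 3) :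
    let Q := fun i j => dA i j - dA j i + (A i * A j - A j * A i)
    let dQ := fun m i j => ddA m i j - ddA m j i + (dA m i * A j + A i * dA m j
      - (dA m j * A i + A j * dA m i))
    (dQ m i j + A m * Q i j - Q i j * A m) + (dQ i j m + A i * Q j m - Q j m * A i)
      + (dQ j m i + A j * Q m i - Q m i * A j) = 0 := by
  intro Q dQ
  simp only [Q, dQ]
  rw [hdd m i j, hdd i j m, hdd j m i]
  noncomm_ring

/-- These are the connection terms acting on the two form indices of the curvature. They cancel in
the cyclic sum because the connection is symmetric and the curvature is skew, so the matrix identity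
`bianchi_matrix`, which omits them, suffices. -/
theorem torsion_free_cyclic (B : Fin 3 → Fin 3 → Fin 3 → ℝ) (hB : ∀ n i j, B n i j = B n j i)
    (T : Fin 3 → Fin 3 → ℝ) (hT : ∀ i j, T i j = - T j i) (m i j : Fin 3) :
    ∑ p, (B p m i * T p j + B p m j * T i p) + ∑ p, (B p i j * T p m + B p i m * T j p)
      + ∑ p, (B p j m * T p i + B p j i * T m p) = 0 := by
  rw [← Finset.sum_add_distrib, ← Finset.sum_add_distrib]
  refine Finset.sum_eq_zero fun p _ => ?_
  rw [hB p m i, hB p j m, hB p j i, hT i p, hT j p, hT m p]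
  ring

/-- Contracting the differential Bianchi identity twice. -/
theorem divergence_eq_zero (DK : Fin 3 → Fin 3 → Fin 3 → Fin 3 → Fin 3 → ℝ)
    (DF : Fin 3 → Fin 3 → Fin 3 → ℝ) (hH : ∀ i j, H i j = H j i)
    (hinv : ∀ i j, ∑ k, H i k * h k j = if i = j then 1 else 0)
    (hDFa : ∀ m i j, DF m i j = - DF m j i) (hDKa : ∀ m l k i j, DK m l k i j = - DK m l k j i)
    (hb : ∀ l k m i j, DK m l k i j + DK i l k j m + DK j l k m i = 0)
    (hskew : ∀ m n k i j, ∑ l, (h n l * DK m l k i j + h k l * DK m l n i j)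
      = -2 * DF m i j * h n k)
    (htr : ∀ m k j, ∑ i, DK m i k i j = -(3 / 2) * DF m k j) (j : Fin 3) :
    ∑ i, ∑ k, H i k * DF i k j = 0 := by
  -- raising an index in `hskew`
  have hraise : ∀ m i j, ∀ l k, ∑ q, H q k * DK m l q i j
      = - ∑ n, H l n * DK m k n i j - 2 * DF m i j * H l k := by
    intro m i j l k
    have e : ∀ n q, _ := fun n q => hskew m n q i j
    have e2 : ∑ n, ∑ q, H l n * H q k * ∑ p, (h n p * DK m p q i j + h q p * DK m p n i j)
        = ∑ n, ∑ q, H l n * H q k * (-2 * DF m i j * h n q) := by simp only [e]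
    have f1 : ∀ l p, ∑ n, H l n * h n p = if l = p then 1 else 0 := hinv
    have f2 : ∀ k p, ∑ q, H q k * h q p = if k = p then 1 else 0 := fun k p => by
      rw [← hinv k p]; simp only [hH]
    have g1 : ∑ n, ∑ q, H l n * H q k * ∑ p, (h n p * DK m p q i j + h q p * DK m p n i j)
        = ∑ q, H q k * ∑ p, (∑ n, H l n * h n p) * DK m p q i j
          + ∑ n, H l n * ∑ p, (∑ q, H q k * h q p) * DK m p n i j := by
      simp only [Fin.sum_univ_three]; ring
    have g2 : ∑ n, ∑ q, H l n * H q k * (-2 * DF m i j * h n q)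
        = -2 * DF m i j * ∑ q, H q k * ∑ n, H l n * h n q := by
      simp only [Fin.sum_univ_three]; ring
    rw [g1, g2] at e2
    simp only [f1, f2, ite_mul, one_mul, zero_mul, Finset.sum_ite_eq, Finset.mem_univ, if_true,
      mul_ite, mul_one, mul_zero] at e2
    linarith
  -- The Bianchi identity contracted over the upper index and the derivative index. The other two
  -- terms become traces of the curvature.
  have b1 : ∀ i k, ∑ l, DK l l k i j = -(3 / 2) * DF i k j + (3 / 2) * DF j k i := by
    intro i k
    have e : ∑ l, (DK l l k i j + DK i l k j l + DK j l k l i) = 0 :=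
      Finset.sum_eq_zero fun l _ => hb l k l i j
    rw [Finset.sum_add_distrib, Finset.sum_add_distrib, htr j k i] at e
    have e2 : ∑ l, DK i l k j l = - ∑ l, DK i l k l j := by
      rw [← Finset.sum_neg_distrib]
      exact Finset.sum_congr rfl fun l _ => hDKa i l k j l
    rw [e2, htr i k j] at e
    linarith
  set δ := ∑ i, ∑ k, H i k * DF i k j with hδ
  have c1 : ∑ i, ∑ k, H i k * ∑ l, DK l l k i j = -(3 / 2) * δ := by
    simp only [b1]
    have z : ∑ i, ∑ k, H i k * DF j k i = 0 := by
      have z1 : ∑ i, ∑ k, H i k * DF j k i = - ∑ i, ∑ k, H i k * DF j k i := by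
        conv_lhs => rw [Finset.sum_comm]
        rw [← Finset.sum_neg_distrib]
        refine Finset.sum_congr rfl fun i _ => ?_
        rw [← Finset.sum_neg_distrib]
        refine Finset.sum_congr rfl fun k _ => ?_
        rw [hH k i, hDFa j i k]; ring
      linarith
    have z2 : ∑ i, ∑ k, H i k * (-(3 / 2) * DF i k j + (3 / 2) * DF j k i)
        = -(3 / 2) * (∑ i, ∑ k, H i k * DF i k j) + (3 / 2) * ∑ i, ∑ k, H i k * DF j k i := by
      simp only [Fin.sum_univ_three]; ring
    rw [z2, z, hδ]; ring
  have c2 : ∑ i, ∑ k, H i k * ∑ l, DK l l k i j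
      = ∑ l, ∑ i, ∑ q, H q i * DK l l q i j := by
    simp only [Fin.sum_univ_three, hH 1 0, hH 2 0, hH 2 1]; ring
  have c3 : ∑ l, ∑ i, ∑ q, H q i * DK l l q i j
      = - (∑ l, ∑ n, H l n * ∑ i, DK l i n i j) - 2 * ∑ l, ∑ i, H l i * DF l i j := by
    simp only [hraise]
    simp only [Fin.sum_univ_three]; ring
  have c4 : ∑ l, ∑ n, H l n * ∑ i, DK l i n i j = -(3 / 2) * δ := by
    simp only [htr, hδ, Fin.sum_univ_three]; ring
  -- The double contraction has been evaluated in two ways, by the Bianchi identity as -(3/2)δ and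
  -- by skewness of the curvature as (3/2)δ - 2δ. Hence δ = 0.
  rw [c2, c3, c4, ← hδ] at c1
  linarith

end Algebra

/-! ### The Weyl connection of a smooth germ of a Weyl structure -/

/-- A germ at `a` of a smooth Weyl structure in coordinates. -/
structure WeylNear (h : E3 → Matrix (Fin 3) (Fin 3) ℝ) (om : E3 → Fin 3 → ℝ) (a : E3) : Prop where
  symm : ∀ᶠ x in 𝓝 a, (h x).IsSymm
  nondeg : ∀ᶠ x in 𝓝 a, (h x).det ≠ 0
  smooth_h : ∀ i j, SmoothNear (fun x => h x i j) a
  smooth_form : ∀ i, SmoothNear (fun x => om x i) a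

section
variable {h : E3 → Matrix (Fin 3) (Fin 3) ℝ} {om : E3 → Fin 3 → ℝ} {a x : E3}

theorem WeylNear.eventually (W : WeylNear h om a) : ∀ᶠ x in 𝓝 a, WeylNear h om x := by
  filter_upwards [eventually_eventually_nhds.2 W.symm, eventually_eventually_nhds.2 W.nondeg,
    Filter.eventually_all.2 fun i => Filter.eventually_all.2 fun j => (W.smooth_h i j).eventually,
    Filter.eventually_all.2 fun i => (W.smooth_form i).eventually] with x h1 h2 h3 h4
  exact ⟨h1, h2, h3, h4⟩

theorem inv_apply_fin_three (A : Matrix (Fin 3) (Fin 3) ℝ) (i j : Fin 3) :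
    A⁻¹ i j = A.det⁻¹ * A.adjugate i j := by
  rw [Matrix.inv_def, Ring.inverse_eq_inv', Matrix.smul_apply, smul_eq_mul]

theorem smoothNear_det {A : E3 → Matrix (Fin 3) (Fin 3) ℝ}
    (hA : ∀ i j, SmoothNear (fun x => A x i j) a) : SmoothNear (fun x => (A x).det) a := by
  simp only [Matrix.det_fin_three]
  exact ((((((hA _ _).mul (hA _ _)).mul (hA _ _)).sub (((hA _ _).mul (hA _ _)).mul (hA _ _))).sub
    (((hA _ _).mul (hA _ _)).mul (hA _ _))).add (((hA _ _).mul (hA _ _)).mul (hA _ _))).add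
    (((hA _ _).mul (hA _ _)).mul (hA _ _)) |>.sub (((hA _ _).mul (hA _ _)).mul (hA _ _))

theorem smoothNear_inv {A : E3 → Matrix (Fin 3) (Fin 3) ℝ}
    (hA : ∀ i j, SmoothNear (fun x => A x i j) a) (hd : (A a).det ≠ 0) (i j : Fin 3) :
    SmoothNear (fun x => (A x)⁻¹ i j) a := by
  simp only [inv_apply_fin_three, Matrix.adjugate_apply]
  refine ((smoothNear_det hA).inv hd).mul (smoothNear_det fun k l => ?_)
  simp only [Matrix.updateRow_apply]
  split_ifs
  · exact SmoothNear.const _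
  · exact hA k l

theorem WeylNear.smooth_inv (W : WeylNear h om a) (i j : Fin 3) :
    SmoothNear (fun x => (h x)⁻¹ i j) a := smoothNear_inv W.smooth_h W.nondeg.self_of_nhds i j

theorem WeylNear.smooth_conn (W : WeylNear h om a) (k i j : Fin 3) :
    SmoothNear (weylConn h om k i j) a := by
  unfold weylConn leviCivita
  refine ((SmoothNear.const _).mul (SmoothNear.sum fun m _ => (W.smooth_inv k m).mul
    ((((W.smooth_h _ _).pd _).add ((W.smooth_h _ _).pd _)).sub ((W.smooth_h _ _).pd _)))).sub
    ((SmoothNear.const _).mul ((SmoothNear.add ?_ ?_).sub ((W.smooth_h _ _).mul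
      (SmoothNear.sum fun m _ => (W.smooth_inv k m).mul (W.smooth_form m)))))
  · split_ifs
    · exact W.smooth_form i
    · exact SmoothNear.const _
  · split_ifs
    · exact W.smooth_form j
    · exact SmoothNear.const _

theorem WeylNear.smooth_curv (W : WeylNear h om a) (l k i j : Fin 3) :
    SmoothNear (weylCurv h om l k i j) a := by
  unfold weylCurv
  exact (((W.smooth_conn _ _ _).pd _).sub ((W.smooth_conn _ _ _).pd _)).add (SmoothNear.sum
    fun m _ => ((W.smooth_conn _ _ _).mul (W.smooth_conn _ _ _)).sub
      ((W.smooth_conn _ _ _).mul (W.smooth_conn _ _ _)))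

theorem WeylNear.smooth_faraday (W : WeylNear h om a) (i j : Fin 3) :
    SmoothNear (faraday om i j) a := by
  unfold faraday
  simp only [div_eq_mul_inv]
  exact (((W.smooth_form _).pd _).sub ((W.smooth_form _).pd _)).mul (SmoothNear.const _)

theorem WeylNear.sym (W : WeylNear h om a) (i j : Fin 3) : h a i j = h a j i :=
  W.symm.self_of_nhds.apply j i

theorem WeylNear.pd_sym (W : WeylNear h om a) (m i j : Fin 3) :
    pd m (fun z => h z i j) a = pd m (fun z => h z j i) a :=
  pd_congr (W.symm.mono fun _ hz => hz.apply j i) m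

theorem WeylNear.inv_sym (W : WeylNear h om a) (i j : Fin 3) : (h a)⁻¹ i j = (h a)⁻¹ j i := by
  have : ((h a)⁻¹).IsSymm := by
    rw [Matrix.IsSymm, Matrix.transpose_nonsing_inv, W.symm.self_of_nhds.eq]
  exact this.apply j i

theorem WeylNear.inv_mul (W : WeylNear h om a) (i j : Fin 3) :
    ∑ k, (h a)⁻¹ i k * h a k j = if i = j then 1 else 0 := by
  rw [← Matrix.mul_apply, Matrix.nonsing_inv_mul _ (W.nondeg.self_of_nhds.isUnit),
    Matrix.one_apply]

theorem WeylNear.lower_inv (W : WeylNear h om a) (X : Fin 3 → ℝ) (j : Fin 3) :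
    ∑ k, h a j k * ∑ m, (h a)⁻¹ k m * X m = X j := by
  have := congrFun (Matrix.mulVec_mulVec X (h a) (h a)⁻¹) j
  rw [Matrix.mul_nonsing_inv _ (W.nondeg.self_of_nhds.isUnit), Matrix.one_mulVec] at this
  exact this

theorem WeylNear.conn_sym (W : WeylNear h om a) (k i j : Fin 3) :
    weylConn h om k i j a = weylConn h om k j i a := by
  unfold weylConn leviCivita
  rw [W.sym i j]
  simp only [W.pd_sym _ i j]
  congr 1
  · congr 1
    exact Finset.sum_congr rfl fun m _ => by ring
  · ring

theorem WeylNear.lower_conn (W : WeylNear h om a) (j m i : Fin 3) :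
    ∑ k, h a j k * weylConn h om k m i a
      = (1 / 2) * (pd m (fun z => h z j i) a + pd i (fun z => h z j m) a - pd j (fun z => h z m i) a)
        - (1 / 2) * (om a m * h a j i + om a i * h a j m - om a j * h a m i) := by
  have e1 := W.lower_inv (fun q => pd m (fun z => h z q i) a + pd i (fun z => h z q m) a
    - pd q (fun z => h z m i) a) j
  have e2 := W.lower_inv (fun q => om a q) j
  have e3 : ∑ k, h a j k * (if k = i then om a m else 0) = om a m * h a j i := by simp [mul_comm]
  have e4 : ∑ k, h a j k * (if k = m then om a i else 0) = om a i * h a j m := by simp [mul_comm]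
  have : ∑ k, h a j k * weylConn h om k m i a
      = (1 / 2) * ∑ k, h a j k * ∑ q, (h a)⁻¹ k q * (pd m (fun z => h z q i) a
          + pd i (fun z => h z q m) a - pd q (fun z => h z m i) a)
        - (1 / 2) * (∑ k, h a j k * (if k = i then om a m else 0)
          + ∑ k, h a j k * (if k = m then om a i else 0)
          - h a m i * ∑ k, h a j k * ∑ q, (h a)⁻¹ k q * om a q) := by
    rw [← Finset.sum_add_distrib, Finset.mul_sum, Finset.mul_sum, ← Finset.sum_sub_distrib,
      Finset.mul_sum, ← Finset.sum_sub_distrib]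
    refine Finset.sum_congr rfl fun k _ => ?_
    unfold weylConn leviCivita
    ring
  rw [this, e1, e2, e3, e4]
  ring

/-- Compatibility of the Weyl connection with the conformal structure: `D h = ω ⊗ h`. -/
theorem WeylNear.compat (W : WeylNear h om a) (m i j : Fin 3) :
    pd m (fun z => h z i j) a = ∑ k, (weylConn h om k m i a * h a k j
      + weylConn h om k m j a * h a i k) + om a m * h a i j := by
  have e1 := W.lower_conn j m i
  have e2 := W.lower_conn i m j
  have e3 : ∑ k, (weylConn h om k m i a * h a k j + weylConn h om k m j a * h a i k)
      = ∑ k, h a j k * weylConn h om k m i a + ∑ k, h a i k * weylConn h om k m j a := by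
    rw [← Finset.sum_add_distrib]
    exact Finset.sum_congr rfl fun k _ => by rw [W.sym k j]; ring
  rw [e3, e1, e2, W.pd_sym m j i, W.pd_sym i j m, W.pd_sym j i m, W.sym j i, W.sym j m, W.sym i m]
  ring

theorem SmoothNear.diff {f : E3 → ℝ} (hf : SmoothNear f a) : DifferentiableAt ℝ f a :=
  hf.contDiffAt.differentiableAt (by simp)

theorem SmoothNear.pd_comm {f : E3 → ℝ} (hf : SmoothNear f a) (i j : Fin 3) :
    EinsteinWeyl.pd i (EinsteinWeyl.pd j f) a = EinsteinWeyl.pd j (EinsteinWeyl.pd i f) a :=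
  EinsteinWeyl.pd_comm (hf.contDiffAt.of_le (WithTop.coe_le_coe.2 le_top)) i j

theorem curv_antisymm (h : E3 → Matrix (Fin 3) (Fin 3) ℝ) (om : E3 → Fin 3 → ℝ) (l k i j : Fin 3)
    (x : E3) : weylCurv h om l k i j x = - weylCurv h om l k j i x := by
  unfold weylCurv
  rw [neg_add, neg_sub, ← Finset.sum_neg_distrib]
  congr 1
  exact Finset.sum_congr rfl fun m _ => by ring

theorem faraday_antisymm (om : E3 → Fin 3 → ℝ) (i j : Fin 3) (x : E3) :
    faraday om i j x = - faraday om j i x := by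
  unfold faraday; ring

/-- The curvature preserves the conformal structure. -/
theorem WeylNear.curv_skew (W : WeylNear h om a) (n k i j : Fin 3) :
    ∑ l, (h a n l * weylCurv h om l k i j a + h a k l * weylCurv h om l n i j a)
      = -2 * faraday om i j a * h a n k := by
  have key : ∀ i j, pd i (pd j (fun z => h z n k)) a =
      ∑ l, (pd i (weylConn h om l j n) a * h a l k + weylConn h om l j n a * pd i (fun z => h z l k) a
        + (pd i (weylConn h om l j k) a * h a n l + weylConn h om l j k a * pd i (fun z => h z n l) a))
      + (pd i (fun z => om z j) a * h a n k + om a j * pd i (fun z => h z n k) a) := by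
    intro i j
    rw [pd_congr (W.eventually.mono fun x hx => hx.compat j n k) i]
    have d1 : ∀ l i j, DifferentiableAt ℝ (weylConn h om l i j) a := fun l i j =>
      (W.smooth_conn l i j).diff
    have d2 : ∀ i j, DifferentiableAt ℝ (fun z => h z i j) a := fun i j => (W.smooth_h i j).diff
    have d3 : ∀ i, DifferentiableAt ℝ (fun z => om z i) a := fun i => (W.smooth_form i).diff
    have d4 : ∀ l ∈ Finset.univ, DifferentiableAt ℝ (fun x => weylConn h om l j n x * h x l k
        + weylConn h om l j k x * h x n l) a := fun l _ =>
      ((d1 l j n).fun_mul (d2 l k)).fun_add ((d1 l j k).fun_mul (d2 n l))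
    rw [pd_add (DifferentiableAt.fun_sum d4) ((d3 j).fun_mul (d2 n k)), pd_sum d4,
      pd_mul (d3 j) (d2 n k)]
    congr 1
    refine Finset.sum_congr rfl fun l _ => ?_
    rw [pd_add ((d1 l j n).fun_mul (d2 l k)) ((d1 l j k).fun_mul (d2 n l)), pd_mul (d1 l j n) (d2 l k),
      pd_mul (d1 l j k) (d2 n l)]
  -- The claim is the symmetry of the second partial derivatives of h_{nk}, once each first
  -- derivative is expressed by `WeylNear.compat`. The curl of the ω terms accounts for the Faraday
  -- form on the right.
  have e := (W.smooth_h n k).pd_comm i j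
  rw [key i j, key j i] at e
  simp only [W.compat] at e
  simp only [weylCurv, faraday, Fin.sum_univ_three] at e ⊢
  simp only [W.sym k 0, W.sym k 1, W.sym k 2, W.sym n 0, W.sym n 1, W.sym n 2, W.sym 1 0,
    W.sym 2 0, W.sym 2 1] at e ⊢
  linear_combination e

/-- The algebraic Bianchi identity. -/
theorem WeylNear.bianchi_one (W : WeylNear h om a) (l i j k : Fin 3) :
    weylCurv h om l k i j a + weylCurv h om l i j k a + weylCurv h om l j k i a = 0 := by
  have e : ∀ m i j k, pd m (weylConn h om i j k) a = pd m (weylConn h om i k j) a :=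
    fun m i j k => pd_congr (W.eventually.mono fun x hx => hx.conn_sym i j k) m
  have e2 := W.conn_sym
  unfold weylCurv
  rw [e i l j k, e j l k i, e k l i j]
  have : ∀ m, weylConn h om m j k a = weylConn h om m k j a := fun m => e2 m j k
  simp only [e2 _ j k, e2 _ k i, e2 _ i j]
  simp only [Fin.sum_univ_three]
  ring

end

/-! ### The Ricci tensor, the differential Bianchi identity and the divergence of F -/

section
variable {h : E3 → Matrix (Fin 3) (Fin 3) ℝ} {om : E3 → Fin 3 → ℝ} {a x : E3}

/-- The symmetric part of the Ricci tensor of the Weyl connection vanishes near `a`. -/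
def RicciSkewNear (h : E3 → Matrix (Fin 3) (Fin 3) ℝ) (om : E3 → Fin 3 → ℝ) (a : E3) : Prop :=
  ∀ᶠ x in 𝓝 a, ∀ i j, weylRicci h om i j x + weylRicci h om j i x = 0

/-- Contracting `WeylNear.curv_skew` with the inverse metric doubles the trace on the left and
produces the dimension 3 on the right. -/
theorem WeylNear.trace_curv (W : WeylNear h om a) (i j : Fin 3) :
    ∑ l, weylCurv h om l l i j a = -3 * faraday om i j a := by
  have e1 : ∑ k, ∑ n, (h a)⁻¹ k n * ∑ l, (h a n l * weylCurv h om l k i j a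
      + h a k l * weylCurv h om l n i j a) = ∑ k, ∑ n, (h a)⁻¹ k n * (-2 * faraday om i j a * h a n k) := by
    simp only [W.curv_skew]
  have e2 : ∑ k, ∑ n, (h a)⁻¹ k n * ∑ l, (h a n l * weylCurv h om l k i j a
      + h a k l * weylCurv h om l n i j a)
      = ∑ k, ∑ l, (∑ n, (h a)⁻¹ k n * h a n l) * weylCurv h om l k i j a
        + ∑ n, ∑ l, (∑ k, (h a)⁻¹ n k * h a k l) * weylCurv h om l n i j a := by
    simp only [Fin.sum_univ_three, W.inv_sym 1 0, W.inv_sym 2 0, W.inv_sym 2 1]; ring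
  have e3 : ∑ k, ∑ n, (h a)⁻¹ k n * (-2 * faraday om i j a * h a n k)
      = -2 * faraday om i j a * ∑ k, ∑ n, (h a)⁻¹ k n * h a n k := by
    simp only [Fin.sum_univ_three]; ring
  rw [e2, e3] at e1
  simp only [W.inv_mul, ite_mul, one_mul, zero_mul, Finset.sum_ite_eq, Finset.mem_univ, if_true,
    Finset.sum_const, Finset.card_univ, Fintype.card_fin] at e1
  norm_num at e1
  linarith

/-- The trace of the algebraic Bianchi identity expresses the skew part of the Ricci tensor through
the trace of the curvature, which is -3F. With no symmetric part, nothing else remains. -/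
theorem WeylNear.ricci_eq (W : WeylNear h om a)
    (hR : ∀ i j, weylRicci h om i j a + weylRicci h om j i a = 0) (i j : Fin 3) :
    weylRicci h om i j a = -(3 / 2) * faraday om i j a := by
  have e : ∑ l, (weylCurv h om l l i j a + weylCurv h om l i j l a + weylCurv h om l j l i a) = 0 :=
    Finset.sum_eq_zero fun l _ => W.bianchi_one l i j l
  rw [Finset.sum_add_distrib, Finset.sum_add_distrib, W.trace_curv] at e
  have e2 : ∑ l, weylCurv h om l i j l a = - weylRicci h om i j a := by
    rw [weylRicci, ← Finset.sum_neg_distrib]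
    exact Finset.sum_congr rfl fun l _ => curv_antisymm h om l i j l a
  rw [e2, show ∑ l, weylCurv h om l j l i a = weylRicci h om j i a from rfl] at e
  linarith [hR i j]

/-- The covariant derivative of the curvature. -/
def weylDCurv (h : E3 → Matrix (Fin 3) (Fin 3) ℝ) (om : E3 → Fin 3 → ℝ)
    (m l k i j : Fin 3) (x : E3) : ℝ :=
  covCurv (fun l k => weylConn h om l m k x) (fun l k i j => weylCurv h om l k i j x)
    (fun l k i j => pd m (weylCurv h om l k i j) x) l k i j

theorem WeylNear.pd_curv (W : WeylNear h om a) (m l k i j : Fin 3) :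
    pd m (weylCurv h om l k i j) a = pd m (pd i (weylConn h om l j k)) a
      - pd m (pd j (weylConn h om l i k)) a
      + ∑ p, (pd m (weylConn h om l i p) a * weylConn h om p j k a
          + weylConn h om l i p a * pd m (weylConn h om p j k) a
        - (pd m (weylConn h om l j p) a * weylConn h om p i k a
          + weylConn h om l j p a * pd m (weylConn h om p i k) a)) := by
  have d1 : ∀ l i j, DifferentiableAt ℝ (weylConn h om l i j) a := fun l i j =>
    (W.smooth_conn l i j).diff
  have d2 : ∀ l i j m, DifferentiableAt ℝ (pd m (weylConn h om l i j)) a := fun l i j m =>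
    ((W.smooth_conn l i j).pd m).diff
  have d3 : ∀ p ∈ Finset.univ, DifferentiableAt ℝ (fun x =>
      weylConn h om l i p x * weylConn h om p j k x
        - weylConn h om l j p x * weylConn h om p i k x) a := fun p _ =>
    ((d1 l i p).fun_mul (d1 p j k)).fun_sub ((d1 l j p).fun_mul (d1 p i k))
  show pd m (fun x => pd i (weylConn h om l j k) x - pd j (weylConn h om l i k) x
    + ∑ p, (weylConn h om l i p x * weylConn h om p j k x
        - weylConn h om l j p x * weylConn h om p i k x)) a = _
  rw [pd_add ((d2 _ _ _ _).fun_sub (d2 _ _ _ _)) (DifferentiableAt.fun_sum d3),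
    pd_sub (d2 _ _ _ _) (d2 _ _ _ _), pd_sum d3]
  congr 1
  refine Finset.sum_congr rfl fun p _ => ?_
  rw [pd_sub ((d1 l i p).fun_mul (d1 p j k)) ((d1 l j p).fun_mul (d1 p i k)),
    pd_mul (d1 l i p) (d1 p j k), pd_mul (d1 l j p) (d1 p i k)]

/-- The differential Bianchi identity. -/
theorem WeylNear.bianchi_two (W : WeylNear h om a) (l k m i j : Fin 3) :
    weylDCurv h om m l k i j a + weylDCurv h om i l k j m a + weylDCurv h om j l k m i a = 0 := by
  have e := bianchi_matrix (R := Matrix (Fin 3) (Fin 3) ℝ)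
    (fun m => Matrix.of fun l k => weylConn h om l m k a)
    (fun i j => Matrix.of fun l k => pd i (weylConn h om l j k) a)
    (fun m i j => Matrix.of fun l k => pd m (pd i (weylConn h om l j k)) a)
    (fun m i j => by
      ext l k
      exact (W.smooth_conn l j k).pd_comm m i) m i j
  have e2 := congrFun (congrFun e l) k
  -- The matrix identity covers the terms at the indices l and k. The terms at the form indices
  -- cancel in the cyclic sum.
  have t := torsion_free_cyclic (fun p i j => weylConn h om p i j a) W.conn_sym
    (fun i j => weylCurv h om l k i j a) (fun i j => curv_antisymm h om l k i j a) m i j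
  simp only [Matrix.add_apply, Matrix.sub_apply, Matrix.mul_apply, Matrix.of_apply,
    Matrix.zero_apply] at e2
  simp only [weylDCurv, covCurv, W.pd_curv]
  simp only [weylCurv, Fin.sum_univ_three] at e2 t ⊢
  linear_combination e2 - t

/-- For a scalar-flat Einstein–Weyl structure, the Faraday two-form is divergence-free. -/
theorem WeylNear.divergence_faraday (W : WeylNear h om a) (hR : RicciSkewNear h om a) (j : Fin 3) :
    ∑ i, ∑ k, (h a)⁻¹ i k * weylDFaraday h om i k j a = 0 := by
  refine divergence_eq_zero (fun i j => h a i j) (fun i j => (h a)⁻¹ i j)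
    (fun m l k i j => weylDCurv h om m l k i j a) (fun m i j => weylDFaraday h om m i j a)
    W.inv_sym W.inv_mul ?_ ?_ W.bianchi_two ?_ ?_ j
  · intro m i j
    have e : pd m (faraday om i j) a = - pd m (faraday om j i) a := by
      rw [← pd_neg]
      exact pd_congr (Filter.Eventually.of_forall fun x => faraday_antisymm om i j x) m
    simp only [weylDFaraday, e, Fin.sum_univ_three]
    have e2 := fun i j => faraday_antisymm om i j a
    rw [e2 0 j, e2 1 j, e2 2 j, e2 i 0, e2 i 1, e2 i 2]
    ring
  · intro m l k i j
    have e : pd m (weylCurv h om l k i j) a = - pd m (weylCurv h om l k j i) a := by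
      rw [← pd_neg]
      exact pd_congr (Filter.Eventually.of_forall fun x => curv_antisymm h om l k i j x) m
    have e2 := fun i j l k => curv_antisymm h om l k i j a
    simp only [weylDCurv, covCurv, e, Fin.sum_univ_three]
    rw [e2 i j 0 k, e2 i j 1 k, e2 i j 2 k, e2 i j l 0, e2 i j l 1, e2 i j l 2,
      e2 0 j l k, e2 1 j l k, e2 2 j l k, e2 i 0 l k, e2 i 1 l k, e2 i 2 l k]
    ring
  · intro m n k i j
    refine covCurv_skew (fun i j => h a i j) (fun i j => pd m (fun z => h z i j) a) _ _ _
      (fun i j => faraday om i j a) (fun i j => pd m (faraday om i j) a) (om a m) W.sym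
      W.curv_skew ?_ (W.compat m) n k i j
    intro n k i j
    have d1 : ∀ i j, DifferentiableAt ℝ (fun z => h z i j) a := fun i j => (W.smooth_h i j).diff
    have d2 : ∀ l k, DifferentiableAt ℝ (weylCurv h om l k i j) a := fun l k =>
      (W.smooth_curv l k i j).diff
    have d3 := (W.smooth_faraday i j).diff
    have e := pd_congr (W.eventually.mono fun x hx => hx.curv_skew n k i j) m
    have d4 : ∀ l ∈ Finset.univ, DifferentiableAt ℝ (fun x => h x n l * weylCurv h om l k i j x
        + h x k l * weylCurv h om l n i j x) a := fun l _ =>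
      ((d1 n l).fun_mul (d2 l k)).fun_add ((d1 k l).fun_mul (d2 l n))
    rw [pd_sum d4, pd_mul (d3.const_mul _) (d1 n k), pd_const_mul _ d3] at e
    have e3 : ∀ l, pd m (fun x => h x n l * weylCurv h om l k i j x
        + h x k l * weylCurv h om l n i j x) a
        = pd m (fun z => h z n l) a * weylCurv h om l k i j a
          + h a n l * pd m (weylCurv h om l k i j) a
          + pd m (fun z => h z k l) a * weylCurv h om l n i j a
          + h a k l * pd m (weylCurv h om l n i j) a := by
      intro l
      rw [pd_add ((d1 n l).fun_mul (d2 l k)) ((d1 k l).fun_mul (d2 l n)), pd_mul (d1 n l) (d2 l k),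
        pd_mul (d1 k l) (d2 l n)]
      ring
    simp only [e3] at e
    rw [e]
    ring
  · intro m k j
    refine covCurv_trace (fun l k => weylConn h om l m k a) (fun l k i j => weylCurv h om l k i j a)
      (fun l k i j => pd m (weylCurv h om l k i j) a) (fun i j => faraday om i j a)
      (fun i j => pd m (faraday om i j) a) (fun k j => W.ricci_eq hR.self_of_nhds k j) ?_ k j
    intro k j
    have e : weylRicci h om k j =ᶠ[𝓝 a] fun x => -(3 / 2) * faraday om k j x := by
      filter_upwards [W.eventually, hR] with x hx hRx using hx.ricci_eq hRx k j
    have e2 := pd_congr e m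
    rw [pd_const_mul _ (W.smooth_faraday k j).diff] at e2
    rw [← e2]
    exact (pd_sum fun i _ => (W.smooth_curv i k i j).diff).symm

end

/-! ### The dual one-form, nullity of F and its control of the curvature -/

section
variable {h : E3 → Matrix (Fin 3) (Fin 3) ℝ} {om : E3 → Fin 3 → ℝ} {a x : E3}

/-- The curl of a one-form, which spans the kernel of its exterior derivative. -/
def curl (om : E3 → Fin 3 → ℝ) (k : Fin 3) (x : E3) : ℝ :=
  pd (k + 1) (fun z => om z (k + 2)) x - pd (k + 2) (fun z => om z (k + 1)) x

/-- The density `|det h|^{-1/2}` of a metric with negative determinant. -/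
def invSqrtDet (h : E3 → Matrix (Fin 3) (Fin 3) ℝ) (x : E3) : ℝ := (Real.sqrt (-(h x).det))⁻¹

/-- The one-form dual to the exterior derivative of `om`. -/
def dualForm (h : E3 → Matrix (Fin 3) (Fin 3) ℝ) (om : E3 → Fin 3 → ℝ) (i : Fin 3) (x : E3) : ℝ :=
  invSqrtDet h x * ∑ j, h x i j * curl om j x

theorem WeylNear.smooth_curl (W : WeylNear h om a) (k : Fin 3) : SmoothNear (curl om k) a :=
  ((W.smooth_form _).pd _).sub ((W.smooth_form _).pd _)

theorem SmoothNear.sqrt {f : E3 → ℝ} (hf : SmoothNear f a) (h0 : 0 < f a) :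
    SmoothNear (fun x => Real.sqrt (f x)) a := by
  filter_upwards [hf, hf.continuousAt.eventually_ne h0.ne'] with x hx hx' using hx.sqrt hx'

theorem WeylNear.smooth_invSqrtDet (W : WeylNear h om a) (hd : (h a).det < 0) :
    SmoothNear (invSqrtDet h) a :=
  ((smoothNear_det W.smooth_h).neg.sqrt (by simpa using hd)).inv
    (Real.sqrt_ne_zero'.2 (by simpa using hd))

theorem WeylNear.smooth_dualForm (W : WeylNear h om a) (hd : (h a).det < 0) (i : Fin 3) :
    SmoothNear (dualForm h om i) a :=
  (W.smooth_invSqrtDet hd).mul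
    (SmoothNear.sum fun j _ => (W.smooth_h i j).mul (W.smooth_curl j))

/-- Jacobi's formula for the determinant combined with `WeylNear.compat`: each of the two connection
terms contributes the trace of the connection, and ω contributes three times itself. -/
theorem WeylNear.pd_det (W : WeylNear h om a) (m : Fin 3) :
    pd m (fun x => (h x).det) a
      = (h a).det * (2 * ∑ k, weylConn h om k m k a + 3 * om a m) := by
  have d : ∀ i j, DifferentiableAt ℝ (fun z => h z i j) a := fun i j => (W.smooth_h i j).diff
  have key : ∀ i j k l p q, pd m (fun z => h z i j * h z k l * h z p q) a =
      (pd m (fun z => h z i j) a * h a k l + h a i j * pd m (fun z => h z k l) a) * h a p q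
        + h a i j * h a k l * pd m (fun z => h z p q) a := by
    intro i j k l p q
    rw [pd_mul ((d i j).fun_mul (d k l)) (d p q), pd_mul (d i j) (d k l)]
  have d3 : ∀ i j k l p q, DifferentiableAt ℝ (fun z => h z i j * h z k l * h z p q) a :=
    fun i j k l p q => ((d i j).fun_mul (d k l)).fun_mul (d p q)
  simp only [Matrix.det_fin_three]
  rw [pd_sub (((((d3 _ _ _ _ _ _).fun_sub (d3 _ _ _ _ _ _)).fun_sub (d3 _ _ _ _ _ _)).fun_add
    (d3 _ _ _ _ _ _)).fun_add (d3 _ _ _ _ _ _)) (d3 _ _ _ _ _ _),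
    pd_add ((((d3 _ _ _ _ _ _).fun_sub (d3 _ _ _ _ _ _)).fun_sub (d3 _ _ _ _ _ _)).fun_add
    (d3 _ _ _ _ _ _)) (d3 _ _ _ _ _ _),
    pd_add (((d3 _ _ _ _ _ _).fun_sub (d3 _ _ _ _ _ _)).fun_sub (d3 _ _ _ _ _ _))
      (d3 _ _ _ _ _ _),
    pd_sub ((d3 _ _ _ _ _ _).fun_sub (d3 _ _ _ _ _ _)) (d3 _ _ _ _ _ _),
    pd_sub (d3 _ _ _ _ _ _) (d3 _ _ _ _ _ _)]
  simp only [key, W.compat, Fin.sum_univ_three, W.sym 1 0, W.sym 2 0, W.sym 2 1]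
  ring

theorem WeylNear.pd_invSqrtDet (W : WeylNear h om a) (hd : (h a).det < 0) (m : Fin 3) :
    pd m (invSqrtDet h) a
      = - invSqrtDet h a * (∑ k, weylConn h om k m k a + 3 / 2 * om a m) := by
  have hdet := smoothNear_det W.smooth_h
  have h0 : Real.sqrt (-(h a).det) ≠ 0 := Real.sqrt_ne_zero'.2 (by simpa using hd)
  have e1 : pd m (fun x => Real.sqrt (-(h x).det)) a
      = 1 / (2 * Real.sqrt (-(h a).det)) * pd m (fun x => -(h x).det) a :=
    pd_comp_real (f := fun x => -(h x).det) (Real.hasDerivAt_sqrt (by simpa using hd.ne))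
      hdet.neg.diff
  have e2 : Real.sqrt (-(h a).det) ^ 2 = -(h a).det := Real.sq_sqrt (by simpa using hd.le)
  have e3 : (h a).det = - Real.sqrt (-(h a).det) ^ 2 := by rw [e2]; ring
  unfold invSqrtDet
  rw [pd_inv (hdet.neg.sqrt (by simpa using hd)).diff h0, e1, pd_neg, W.pd_det]
  generalize Real.sqrt (-(h a).det) = s at *
  rw [e3]
  field_simp

/-- The exterior derivative of the dual of the Faraday two-form of a scalar-flat Einstein–Weyl
structure. -/
theorem WeylNear.d_dualForm (W : WeylNear h om a) (hR : RicciSkewNear h om a)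
    (hd : (h a).det < 0) (m i : Fin 3) :
    pd m (dualForm h om i) a - pd i (dualForm h om m) a
      = -(1 / 2) * (om a m * dualForm h om i a - om a i * dualForm h om m a) := by
  set v : Fin 3 → ℝ := fun k => curl om k a with hv
  -- The covariant derivative of the curl as a vector density, the trace term being due to the
  -- weight. Up to the factor 1/2 its entries are the components of D F.
  set E : Fin 3 → Fin 3 → ℝ := fun m j => pd m (curl om j) a + ∑ k, weylConn h om j m k a * v k
    - (∑ k, weylConn h om k m k a) * v j with hE
  have hF : ∀ k, faraday om (k + 1) (k + 2) a = (1 / 2) * v k := fun k => by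
    simp only [hv, faraday, curl]; ring
  have hdF : ∀ m k, pd m (faraday om (k + 1) (k + 2)) a = (1 / 2) * pd m (curl om k) a := by
    intro m k
    rw [← pd_const_mul _ (W.smooth_curl k).diff]
    exact pd_congr (Filter.Eventually.of_forall fun x => by simp only [faraday, curl]; ring) m
  have fa := fun i j => faraday_antisymm om i j a
  have f00 : ∀ i, faraday om i i a = 0 := fun i => by linarith [fa i i]
  have dfa : ∀ m i j, pd m (faraday om i j) a = - pd m (faraday om j i) a := by
    intro m i j
    rw [← pd_neg]
    exact pd_congr (Filter.Eventually.of_forall fun x => faraday_antisymm om i j x) m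
  have F12 := hF 0
  have F20 := hF 1
  have F01 := hF 2
  have dF12 := fun m => hdF m 0
  have dF20 := fun m => hdF m 1
  have dF01 := fun m => hdF m 2
  have n1 : (1 : Fin 3) + 1 = 2 := rfl
  have n2 : (1 : Fin 3) + 2 = 0 := rfl
  have n3 : (2 : Fin 3) + 1 = 0 := rfl
  have n4 : (2 : Fin 3) + 2 = 1 := rfl
  simp only [zero_add, n1, n2, n3, n4] at F12 F20 F01 dF12 dF20 dF01
  have D12 : ∀ m, weylDFaraday h om m 1 2 a = (1 / 2) * E m 0 := by
    intro m
    simp only [weylDFaraday, hE, Fin.sum_univ_three, dF12, fa 1 0, fa 0 2, F12, F20, F01, f00]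
    ring
  have D20 : ∀ m, weylDFaraday h om m 2 0 a = (1 / 2) * E m 1 := by
    intro m
    simp only [weylDFaraday, hE, Fin.sum_univ_three, dF20, fa 1 0, fa 2 1, F12, F20, F01, f00]
    ring
  have D01 : ∀ m, weylDFaraday h om m 0 1 a = (1 / 2) * E m 2 := by
    intro m
    simp only [weylDFaraday, hE, Fin.sum_univ_three, dF01, fa 0 2, fa 2 1, F12, F20, F01, f00]
    ring
  have Da : ∀ m i j, weylDFaraday h om m i j a = - weylDFaraday h om m j i a := by
    intro m i j
    simp only [weylDFaraday, Fin.sum_univ_three]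
    rw [dfa m i j, fa 0 j, fa 1 j, fa 2 j, fa i 0, fa i 1, fa i 2]
    ring
  have D0 : ∀ m i, weylDFaraday h om m i i a = 0 := fun m i => by linarith [Da m i i]
  have D10 := fun m => Da m 1 0
  have D02 := fun m => Da m 0 2
  have D21 := fun m => Da m 2 1
  -- The three components of the divergence of F are, up to factors, the three skew components of
  -- this matrix. Its symmetry is thus the divergence equation, and after lowering an index it
  -- becomes the formula for df.
  set S : Fin 3 → Fin 3 → ℝ := fun k j => ∑ i, (h a)⁻¹ i k * E i j with hS
  have div0 := W.divergence_faraday hR 0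
  have div1 := W.divergence_faraday hR 1
  have div2 := W.divergence_faraday hR 2
  simp only [Fin.sum_univ_three, D10, D02, D21, D0, D12, D20, D01] at div0 div1 div2
  have hSs : ∀ i j, S i j = S j i := by
    have s01 : S 0 1 = S 1 0 := by simp only [hS, Fin.sum_univ_three]; linarith
    have s02 : S 0 2 = S 2 0 := by simp only [hS, Fin.sum_univ_three]; linarith
    have s12 : S 1 2 = S 2 1 := by simp only [hS, Fin.sum_univ_three]; linarith
    intro i j
    fin_cases i <;> fin_cases j <;>
      first | rfl | exact s01 | exact s01.symm | exact s02 | exact s02.symm | exact s12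
            | exact s12.symm
  have hES : ∀ m j, E m j = ∑ k, h a m k * S k j := by
    intro m j
    have := W.lower_inv (fun i => E i j) m
    rw [← this]
    refine Finset.sum_congr rfl fun k _ => ?_
    congr 1
    exact Finset.sum_congr rfl fun i _ => by rw [W.inv_sym k i]
  have hsymE : ∑ j, h a i j * E m j = ∑ j, h a m j * E i j := by
    simp only [hES, Fin.sum_univ_three, hSs 1 0, hSs 2 0, hSs 2 1]
    ring
  have hpd : ∀ m i, pd m (dualForm h om i) a = invSqrtDet h a *
      (-(∑ k, weylConn h om k m k a + 3 / 2 * om a m) * (∑ j, h a i j * v j)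
        + ∑ j, (pd m (fun z => h z i j) a * v j + h a i j * pd m (curl om j) a)) := by
    intro m i
    have d1 : ∀ i j, DifferentiableAt ℝ (fun z => h z i j) a := fun i j => (W.smooth_h i j).diff
    have d2 : ∀ j, DifferentiableAt ℝ (curl om j) a := fun j => (W.smooth_curl j).diff
    have d3 : ∀ j ∈ Finset.univ, DifferentiableAt ℝ (fun z => h z i j * curl om j z) a :=
      fun j _ => (d1 i j).fun_mul (d2 j)
    show pd m (fun x => invSqrtDet h x * ∑ j, h x i j * curl om j x) a = _
    rw [pd_mul (W.smooth_invSqrtDet hd).diff (DifferentiableAt.fun_sum d3), pd_sum d3,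
      W.pd_invSqrtDet hd]
    simp only [pd_mul (d1 i _) (d2 _)]
    ring
  rw [hpd, hpd]
  simp only [dualForm, W.compat]
  have c := W.conn_sym
  simp only [Fin.sum_univ_three, hE] at hsymE ⊢
  have c2 : ∀ k, weylConn h om k i m a = weylConn h om k m i a := fun k => c k i m
  simp only [c2]
  have hs := W.sym
  simp only [hs i 0, hs i 1, hs i 2, hs m 0, hs m 1, hs m 2, hs 1 0, hs 2 0, hs 2 1] at hsymE ⊢
  simp only [show ∀ k, curl om k a = v k from fun _ => rfl]
  linear_combination invSqrtDet h a * hsymE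

/-- The Faraday two-form of a scalar-flat Einstein–Weyl structure is null. -/
theorem WeylNear.curl_null (W : WeylNear h om a) (hR : RicciSkewNear h om a)
    (hd : (h a).det < 0) : ∑ i, curl om i a * dualForm h om i a = 0 := by
  have hdn : ∀ᶠ x in 𝓝 a, (h x).det < 0 :=
    (smoothNear_det W.smooth_h).continuousAt.eventually_lt_const hd
  have e : ∀ m i, pd m (dualForm h om i) - pd i (dualForm h om m) =ᶠ[𝓝 a] fun x =>
      -(1 / 2) * (om x m * dualForm h om i x - om x i * dualForm h om m x) := by
    intro m i
    filter_upwards [W.eventually, eventually_eventually_nhds.2 hR, hdn] with x h1 h2 h3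
      using h1.d_dualForm h2 h3 m i
  have hf := W.smooth_dualForm hd
  have key : ∀ n m i, pd n (pd m (dualForm h om i)) a - pd n (pd i (dualForm h om m)) a
      = -(1 / 2) * (pd n (fun z => om z m) a * dualForm h om i a
          + om a m * pd n (dualForm h om i) a
          - (pd n (fun z => om z i) a * dualForm h om m a
          + om a i * pd n (dualForm h om m) a)) := by
    intro n m i
    have d1 := fun i => (W.smooth_form i).diff
    have d2 := fun i => (hf i).diff
    have e1 := pd_congr (e m i) n
    rw [pd_const_mul _ (((d1 m).fun_mul (d2 i)).fun_sub ((d1 i).fun_mul (d2 m))),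
      pd_sub ((d1 m).fun_mul (d2 i)) ((d1 i).fun_mul (d2 m)), pd_mul (d1 m) (d2 i),
      pd_mul (d1 i) (d2 m)] at e1
    rw [← e1]
    exact (pd_sub ((hf i).pd m).diff ((hf m).pd i).diff).symm
  have k1 := key 0 1 2
  have k2 := key 1 2 0
  have k3 := key 2 0 1
  have c1 := (hf 2).pd_comm 0 1
  have c2 := (hf 1).pd_comm 0 2
  have c3 := (hf 0).pd_comm 1 2
  have d1 := W.d_dualForm hR hd 1 2
  have d2 := W.d_dualForm hR hd 2 0
  have d3 := W.d_dualForm hR hd 0 1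
  have n1 : (1 : Fin 3) + 1 = 2 := rfl
  have n2 : (1 : Fin 3) + 2 = 0 := rfl
  have n3 : (2 : Fin 3) + 1 = 0 := rfl
  have n4 : (2 : Fin 3) + 2 = 1 := rfl
  simp only [Fin.sum_univ_three, curl, zero_add, n1, n2, n3, n4]
  -- This is d applied to df = -(1/2) ω ∧ f. Second derivatives cancel by symmetry, ω ∧ df vanishes
  -- by the same equation, and dω ∧ f is left.
  linear_combination 2 * (k1 + k2 + k3) - 2 * (c1 - c2 + c3) + om a 0 * d1 + om a 1 * d2
    + om a 2 * d3

/-- Let cof be the cofactor matrix of H. Combining the relations with the columns of H gives cofᵀ b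
= t·1, where t is the trace of cofᵀ b. Taking the trace, t = 3t, so cofᵀ b = 0, and multiplication
by H yields (det H) b = 0. -/
theorem eq_zero_of_polarized_adjugate (H b : Fin 3 → Fin 3 → ℝ)
    (hH : (Matrix.of H).det ≠ 0)
    (r : ∀ k j, H (k + 1) (j + 1) * b (k + 2) (j + 2) + H (k + 2) (j + 2) * b (k + 1) (j + 1)
      - H (k + 1) (j + 2) * b (k + 2) (j + 1) - H (k + 2) (j + 1) * b (k + 1) (j + 2) = 0) :
    ∀ l m, b l m = 0 := by
  have n1 : (1 : Fin 3) + 1 = 2 := rfl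
  have n2 : (1 : Fin 3) + 2 = 0 := rfl
  have n3 : (2 : Fin 3) + 1 = 0 := rfl
  have n4 : (2 : Fin 3) + 2 = 1 := rfl
  set cof : Fin 3 → Fin 3 → ℝ := fun k j =>
    H (k + 1) (j + 1) * H (k + 2) (j + 2) - H (k + 1) (j + 2) * H (k + 2) (j + 1) with hcof
  set t := ∑ k, ∑ j, cof k j * b k j with ht
  have key : ∀ j m, ∑ k, cof k j * b k m = if j = m then t else 0 := by
    intro j m
    have r0 := r 0 j
    have r1 := r 1 j
    have r2 := r 2 j
    fin_cases j <;> fin_cases m <;>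
      simp only [ht, hcof, Fin.sum_univ_three, zero_add, n1, n2, n3, n4, Fin.zero_eta, Fin.mk_one,
        Fin.reduceFinMk, Fin.isValue, if_true, reduceIte, Fin.reduceEq] at r0 r1 r2 ⊢
    · linear_combination (-H 0 0) * r0 - H 1 0 * r1 - H 2 0 * r2
    · linear_combination (-H 0 1) * r0 - H 1 1 * r1 - H 2 1 * r2
    · linear_combination (-H 0 2) * r0 - H 1 2 * r1 - H 2 2 * r2
    · linear_combination (-H 0 0) * r0 - H 1 0 * r1 - H 2 0 * r2
    · linear_combination (-H 0 1) * r0 - H 1 1 * r1 - H 2 1 * r2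
    · linear_combination (-H 0 2) * r0 - H 1 2 * r1 - H 2 2 * r2
    · linear_combination (-H 0 0) * r0 - H 1 0 * r1 - H 2 0 * r2
    · linear_combination (-H 0 1) * r0 - H 1 1 * r1 - H 2 1 * r2
    · linear_combination (-H 0 2) * r0 - H 1 2 * r1 - H 2 2 * r2
  have ht0 : t = 0 := by
    have e : ∑ j, ∑ k, cof k j * b k j = 3 * t := by
      simp only [key, if_true, Finset.sum_const, Finset.card_univ, Fintype.card_fin]
      norm_num
    rw [Finset.sum_comm, ← ht] at e
    linarith
  intro l m
  have e : (Matrix.of H).det * b l m = ∑ j, H l j * ∑ k, cof k j * b k m := by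
    rw [Matrix.det_fin_three]
    fin_cases l <;> simp only [hcof, Fin.sum_univ_three, zero_add, n1, n2, n3, n4, Fin.zero_eta,
      Fin.mk_one, Fin.reduceFinMk, Fin.isValue, Matrix.of_apply] <;> ring
  simp only [key, ht0, ite_self, mul_zero, Finset.sum_const_zero] at e
  exact (mul_eq_zero.1 e).resolve_left hH

/-- In a scalar-flat Einstein–Weyl structure the Faraday two-form determines the curvature. -/
theorem WeylNear.curvZeroAt (W : WeylNear h om a) (hR : RicciSkewNear h om a)
    (hv : ∀ k, curl om k a = 0) : CurvZeroAt h om a := by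
  have n1 : (1 : Fin 3) + 1 = 2 := rfl
  have n2 : (1 : Fin 3) + 2 = 0 := rfl
  have n3 : (2 : Fin 3) + 1 = 0 := rfl
  have n4 : (2 : Fin 3) + 2 = 1 := rfl
  have hF : ∀ i j, faraday om i j a = 0 := by
    have v0 := hv 0
    have v1 := hv 1
    have v2 := hv 2
    simp only [curl, zero_add, n1, n2, n3, n4] at v0 v1 v2
    intro i j
    unfold faraday
    fin_cases i <;> fin_cases j <;> simp only [Fin.zero_eta, Fin.mk_one, Fin.reduceFinMk] <;>
      linarith
  set B : Fin 3 → Fin 3 → Fin 3 → Fin 3 → ℝ := fun n k i j =>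
    ∑ l, h a n l * weylCurv h om l k i j a with hB
  have a1 : ∀ n k i j, B n k i j = - B k n i j := by
    intro n k i j
    have := W.curv_skew n k i j
    rw [hF, Finset.sum_add_distrib] at this
    simp only [hB]
    linarith
  have a2 : ∀ n k i j, B n k i j = - B n k j i := by
    intro n k i j
    simp only [hB, ← Finset.sum_neg_distrib]
    exact Finset.sum_congr rfl fun l _ => by rw [curv_antisymm h om l k i j]; ring
  have hK : ∀ l k i j, weylCurv h om l k i j a = ∑ n, (h a)⁻¹ l n * B n k i j := by
    intro l k i j
    have e : ∑ n, (h a)⁻¹ l n * B n k i j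
        = ∑ q, (∑ n, (h a)⁻¹ l n * h a n q) * weylCurv h om q k i j a := by
      simp only [hB, Fin.sum_univ_three]; ring
    rw [e]
    simp [W.inv_mul]
  have hr : ∀ k j, ∑ i, ∑ n, (h a)⁻¹ i n * B n k i j = 0 := by
    intro k j
    have e := W.ricci_eq hR.self_of_nhds k j
    rw [hF, mul_zero, weylRicci] at e
    simpa only [hK] using e
  have b1 : ∀ k i j, B k k i j = 0 := fun k i j => by linarith [a1 k k i j]
  have b2 : ∀ n k i, B n k i i = 0 := fun n k i => by linarith [a2 n k i i]
  -- A skew pair (p+1, p+2) is labelled by p, so the lowered curvature becomes a 3 by 3 matrix. The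
  -- Ricci contraction is then the polarized adjugate with the inverse metric, which is injective.
  have key := eq_zero_of_polarized_adjugate (fun i n => (h a)⁻¹ n i)
    (fun p q => B (p + 1) (p + 2) (q + 1) (q + 2)) (by
      have : Matrix.of (fun i n => (h a)⁻¹ n i) = ((h a)⁻¹).transpose := rfl
      rw [this, Matrix.det_transpose, Matrix.det_nonsing_inv, Ring.inverse_eq_inv']
      exact inv_ne_zero W.nondeg.self_of_nhds) (by
      intro k j
      have e := hr k j
      fin_cases k <;> fin_cases j <;>
        simp only [Fin.sum_univ_three, zero_add, n1, n2, n3, n4, Fin.zero_eta, Fin.mk_one,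
          Fin.reduceFinMk, b1, b2, a1 1 0, a1 2 1, a1 0 2, a2 _ _ 1 0, a2 _ _ 2 1, a2 _ _ 0 2]
          at e ⊢ <;> linear_combination e)
  have k00 := key 0 0
  have k01 := key 0 1
  have k02 := key 0 2
  have k10 := key 1 0
  have k11 := key 1 1
  have k12 := key 1 2
  have k20 := key 2 0
  have k21 := key 2 1
  have k22 := key 2 2
  simp only [zero_add, n1, n2, n3, n4] at k00 k01 k02 k10 k11 k12 k20 k21 k22
  have hB0 : ∀ n k i j, B n k i j = 0 := by
    have hh : ∀ n k, (B n k 1 2 = 0 ∧ B n k 2 0 = 0 ∧ B n k 0 1 = 0) := by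
      intro n k
      fin_cases n <;> fin_cases k <;>
        simp only [Fin.zero_eta, Fin.mk_one, Fin.reduceFinMk, b1, a1 1 0, a1 2 1, a1 0 2, k00, k01, k02, k10, k11, k12, k20, k21, k22,
          neg_zero, and_self]
    intro n k i j
    obtain ⟨h1, h2, h3⟩ := hh n k
    fin_cases i <;> fin_cases j <;>
      simp only [Fin.zero_eta, Fin.mk_one, Fin.reduceFinMk, b2, a2 _ _ 1 0, a2 _ _ 2 1, a2 _ _ 0 2,
        h1, h2, h3, neg_zero]
  intro l k i j
  rw [hK]
  simp [hB0]

end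

/-! ### Change of the representative -/

section
variable {h h' : E3 → Matrix (Fin 3) (Fin 3) ℝ} {om om' : E3 → Fin 3 → ℝ} {a x : E3}

/-- The Levi-Civita connection changes by terms in du/u of exactly the shape in which ω enters the
Weyl connection, and the change of ω cancels them. The factor u may be negative, which covers the
passage from h to -h. -/
theorem weylConn_scale {u : E3 → ℝ} (hu : DifferentiableAt ℝ u x) (hu0 : u x ≠ 0)
    (hd : (h x).det ≠ 0) (hdiff : ∀ i j, DifferentiableAt ℝ (fun z => h z i j) x)
    (hh : ∀ᶠ z in 𝓝 x, h' z = u z • h z) (ho : ∀ i, om' x i = om x i + pd i u x / u x)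
    (k i j : Fin 3) : weylConn h' om' k i j x = weylConn h om k i j x := by
  have e1 : ∀ m i j, pd m (fun z => h' z i j) x
      = pd m u x * h x i j + u x * pd m (fun z => h z i j) x := by
    intro m i j
    rw [← pd_mul hu (hdiff i j)]
    exact pd_congr (hh.mono fun z hz => by rw [hz]; simp) m
  have e2 : h' x = u x • h x := hh.self_of_nhds
  have e3 : (h' x)⁻¹ = (u x)⁻¹ • (h x)⁻¹ := by
    rw [e2]
    refine Matrix.inv_eq_right_inv ?_
    rw [Matrix.smul_mul, Matrix.mul_smul, smul_smul, mul_inv_cancel₀ hu0, one_smul,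
      Matrix.mul_nonsing_inv _ hd.isUnit]
  have e4 : ∀ j, ∑ m, (h x)⁻¹ k m * h x m j = if k = j then 1 else 0 := by
    intro j
    rw [← Matrix.mul_apply, Matrix.nonsing_inv_mul _ hd.isUnit, Matrix.one_apply]
  have e5 : leviCivita h' k i j x = leviCivita h k i j x + (1 / 2) * (u x)⁻¹ *
      (pd i u x * (if k = j then 1 else 0) + pd j u x * (if k = i then 1 else 0)
        - h x i j * ∑ m, (h x)⁻¹ k m * pd m u x) := by
    rw [← e4, ← e4]
    simp only [leviCivita, e1, e3, Matrix.smul_apply, smul_eq_mul, Fin.sum_univ_three]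
    field_simp
    ring
  simp only [weylConn, e5, e3, ho]
  rw [e2]
  simp only [Matrix.smul_apply, smul_eq_mul, Fin.sum_univ_three]
  split_ifs <;> field_simp <;> ring

theorem weylCurv_congr (hc : ∀ᶠ z in 𝓝 x, ∀ k i j, weylConn h' om' k i j z = weylConn h om k i j z)
    (l k i j : Fin 3) : weylCurv h' om' l k i j x = weylCurv h om l k i j x := by
  have e : ∀ m k i j, pd m (weylConn h' om' k i j) x = pd m (weylConn h om k i j) x :=
    fun m k i j => pd_congr (hc.mono fun z hz => hz k i j) m
  simp only [weylCurv, e, hc.self_of_nhds]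

theorem weylRicci_congr
    (hc : ∀ᶠ z in 𝓝 x, ∀ k i j, weylConn h' om' k i j z = weylConn h om k i j z)
    (i j : Fin 3) : weylRicci h' om' i j x = weylRicci h om i j x := by
  simp only [weylRicci, weylCurv_congr hc]

theorem recurrentAt_congr
    (hc : ∀ᶠ z in 𝓝 x, ∀ k i j, weylConn h' om' k i j z = weylConn h om k i j z)
    (hF : ∀ᶠ z in 𝓝 x, ∀ i j, faraday om' i j z = faraday om i j z) :
    RecurrentAt h' om' x ↔ RecurrentAt h om x := by
  have e : ∀ m i j, pd m (faraday om' i j) x = pd m (faraday om i j) x :=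
    fun m i j => pd_congr (hF.mono fun z hz => hz i j) m
  simp only [RecurrentAt, weylDFaraday, e, hc.self_of_nhds, hF.self_of_nhds]

end

/-! ### Representatives of a Weyl structure in charts -/

section Manifold
variable {M : Type*} [TopologicalSpace M] [ChartedSpace E3 M]

/-- In some chart `e` around `p`, with `e p = a`, the germ `(h, om)` at `a` represents the Weyl
structure with the metric multiplied by `ε`. -/
def Rep (W : WeylStructure M) (ε : ℝ) (p : M) (h : E3 → Matrix (Fin 3) (Fin 3) ℝ)
    (om : E3 → Fin 3 → ℝ) (a : E3) : Prop :=
  ∃ e ∈ IsManifold.maximalAtlas (𝓡 3) ∞ M, p ∈ e.source ∧ e p = a ∧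
    ∃ φ : E3 → ℝ, SmoothNear φ a ∧ 0 < φ a ∧
      (∀ᶠ x in 𝓝 a, h x = (φ x ^ 2 * ε) • W.hc e x) ∧
      ∀ᶠ x in 𝓝 a, ∀ i, om x i = W.omc e x i + 2 * pd i (fun z => Real.log (φ z)) x

theorem SmoothNear.log {f : E3 → ℝ} {a : E3} (hf : SmoothNear f a) (h0 : f a ≠ 0) :
    SmoothNear (fun x => Real.log (f x)) a := by
  filter_upwards [hf, hf.continuousAt.eventually_ne h0] with x hx hx' using hx.log hx'

theorem pd_log {f : E3 → ℝ} {x : E3} (hf : DifferentiableAt ℝ f x) (h0 : f x ≠ 0) (i : Fin 3) :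
    pd i (fun z => Real.log (f z)) x = pd i f x / f x := by
  rw [pd_comp_real (Real.hasDerivAt_log h0) hf]
  ring

variable {W : WeylStructure M} {ε : ℝ} {p : M} {h : E3 → Matrix (Fin 3) (Fin 3) ℝ}
  {om : E3 → Fin 3 → ℝ} {a : E3}

theorem WeylStructure.weylNear (W : WeylStructure M) {e : OpenPartialHomeomorph M E3}
    (he : e ∈ IsManifold.maximalAtlas (𝓡 3) ∞ M) (ha : a ∈ e.target) :
    WeylNear (W.hc e) (W.omc e) a := by
  have hw := W.isWeylOn e he
  have hn := e.open_target.mem_nhds ha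
  refine ⟨?_, ?_, fun i j => ?_, fun i => ?_⟩
  · filter_upwards [hn] with x hx using hw.symm x hx
  · filter_upwards [hn] with x hx using hw.nondeg x hx
  · filter_upwards [hn] with x hx using (hw.contDiffOn_h i j).contDiffAt (e.open_target.mem_nhds hx)
  · filter_upwards [hn] with x hx using (hw.contDiffOn_form i).contDiffAt (e.open_target.mem_nhds hx)

theorem Rep.weylNear (r : Rep W ε p h om a) (hε : ε ≠ 0) : WeylNear h om a := by
  obtain ⟨e, he, hp, rfl, φ, hφ, hφ0, hh, ho⟩ := r
  have w := W.weylNear he (e.map_source hp)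
  have hpos : ∀ᶠ x in 𝓝 (e p), φ x ≠ 0 := hφ.continuousAt.eventually_ne hφ0.ne'
  refine ⟨?_, ?_, fun i j => ?_, fun i => ?_⟩
  · filter_upwards [w.symm, hh] with x hx hx'
    rw [hx', Matrix.IsSymm, Matrix.transpose_smul, hx.eq]
  · filter_upwards [w.nondeg, hh, hpos] with x hx hx' h0
    rw [hx', Matrix.det_smul]
    exact mul_ne_zero (pow_ne_zero _ (mul_ne_zero (pow_ne_zero _ h0) hε)) hx
  · refine (((hφ.pow 2).mul (SmoothNear.const ε)).mul (w.smooth_h i j)).congr ?_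
    filter_upwards [hh] with x hx
    rw [hx]; simp
  · refine ((w.smooth_form i).add ((SmoothNear.const 2).mul ((hφ.log hφ0.ne').pd i))).congr ?_
    filter_upwards [ho] with x hx
    rw [hx]

theorem weylConn_rep {φ : E3 → ℝ} {h₀ : E3 → Matrix (Fin 3) (Fin 3) ℝ} {om₀ : E3 → Fin 3 → ℝ}
    (hε : ε ≠ 0) (w : WeylNear h₀ om₀ a) (hφ : SmoothNear φ a) (hφ0 : 0 < φ a)
    (hh : ∀ᶠ x in 𝓝 a, h x = (φ x ^ 2 * ε) • h₀ x)
    (ho : ∀ᶠ x in 𝓝 a, ∀ i, om x i = om₀ x i + 2 * pd i (fun z => Real.log (φ z)) x) :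
    ∀ᶠ x in 𝓝 a, ∀ k i j, weylConn h om k i j x = weylConn h₀ om₀ k i j x := by
  filter_upwards [w.eventually, hφ.eventually, hφ.continuousAt.eventually_ne hφ0.ne',
    eventually_eventually_nhds.2 hh, ho] with x w' hφ' h0 hh' ho' k i j
  have hd := hφ'.diff
  refine weylConn_scale (u := fun x => φ x ^ 2 * ε) ((hφ'.pow 2).mul (SmoothNear.const ε)).diff
    (mul_ne_zero (pow_ne_zero _ h0) hε) w'.nondeg.self_of_nhds (fun i j => (w'.smooth_h i j).diff)
    hh' (fun i => ?_) k i j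
  have e : pd i (fun x => φ x ^ 2 * ε) x = 2 * φ x * pd i φ x * ε := by
    rw [show (fun x => φ x ^ 2 * ε) = fun x => (φ x * φ x) * ε by ext; ring,
      pd_mul (hd.fun_mul hd) (differentiableAt_const ε), pd_mul hd hd, pd_const]
    ring
  rw [ho', e, pd_log hd h0]
  field_simp

theorem faraday_rep {φ : E3 → ℝ} {om₀ : E3 → Fin 3 → ℝ}
    (hs : ∀ i, SmoothNear (fun x => om₀ x i) a) (hφ : SmoothNear φ a) (hφ0 : 0 < φ a)
    (ho : ∀ᶠ x in 𝓝 a, ∀ i, om x i = om₀ x i + 2 * pd i (fun z => Real.log (φ z)) x) :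
    ∀ᶠ x in 𝓝 a, ∀ i j, faraday om i j x = faraday om₀ i j x := by
  filter_upwards [Filter.eventually_all.2 fun i => (hs i).eventually, (hφ.log hφ0.ne').eventually,
    eventually_eventually_nhds.2 ho] with x hs' hl ho' i j
  have e : ∀ m i, pd m (fun z => om z i) x = pd m (fun z => om₀ z i) x
      + 2 * pd m (pd i (fun z => Real.log (φ z))) x := by
    intro m i
    rw [← pd_const_mul _ (hl.pd i).diff, ← pd_add (hs' i).diff ((hl.pd i).diff.const_mul _)]
    exact pd_congr (ho'.mono fun z hz => hz i) m
  simp only [faraday, e, hl.pd_comm i j]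
  ring

/-- A representative serves also at the nearby points of its chart. The density argument uses this
to move the base point to where ∂b/∂x ≠ 0. -/
theorem Rep.eventually (r : Rep W ε p h om a) :
    ∃ e ∈ IsManifold.maximalAtlas (𝓡 3) ∞ M, p ∈ e.source ∧ e p = a ∧
      ∀ᶠ x in 𝓝 a, Rep W ε (e.symm x) h om x := by
  obtain ⟨e, he, hp, rfl, φ, hφ, hφ0, hh, ho⟩ := r
  refine ⟨e, he, hp, rfl, ?_⟩
  filter_upwards [e.open_target.mem_nhds (e.map_source hp), hφ.eventually,
    hφ.continuousAt.eventually_const_lt hφ0, eventually_eventually_nhds.2 hh,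
    eventually_eventually_nhds.2 ho] with x hx h1 h2 h3 h4
  exact ⟨e, he, e.map_target hx, e.right_inv hx, φ, h1, h2, h3, h4⟩

theorem Rep.ricciSkew (r : Rep W ε p h om a) (hε : ε ≠ 0) (hEW : W.IsEinsteinWeyl)
    (hS : W.IsScalarFlat) : RicciSkewNear h om a := by
  obtain ⟨e, he, hp, rfl, φ, hφ, hφ0, hh, ho⟩ := r
  have ht := e.open_target.mem_nhds (e.map_source hp)
  have hc := weylConn_rep hε (W.weylNear he (e.map_source hp)) hφ hφ0 hh ho
  filter_upwards [ht, eventually_eventually_nhds.2 hc] with x hx hcx i j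
  rw [weylRicci_congr hcx, weylRicci_congr hcx]
  have h1 := hEW e he x hx i j
  rw [hS e he x hx] at h1
  linarith

theorem Rep.eventually_recurrentAt (r : Rep W ε p h om a) (hε : ε ≠ 0)
    (hr : ∀ᶠ q in 𝓝 p, W.IsRecurrentAt q) : ∀ᶠ x in 𝓝 a, RecurrentAt h om x := by
  obtain ⟨e, he, hp, rfl, φ, hφ, hφ0, hh, ho⟩ := r
  have ha := e.map_source hp
  have w := W.weylNear he ha
  have hc := weylConn_rep hε w hφ hφ0 hh ho
  have hF := faraday_rep w.smooth_form hφ hφ0 ho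
  have hsymm : Filter.Tendsto e.symm (𝓝 (e p)) (𝓝 p) := by
    have := (e.continuousAt_symm ha).tendsto
    rwa [e.left_inv hp] at this
  filter_upwards [e.open_target.mem_nhds ha, eventually_eventually_nhds.2 hc,
    eventually_eventually_nhds.2 hF, hsymm.eventually hr] with x hx hcx hFx hrx
  rw [recurrentAt_congr hcx hFx]
  have := hrx e he (e.map_target hx)
  rwa [e.right_inv hx] at this

theorem Rep.not_recurrentAt (r : Rep W ε p h om a) (hε : ε ≠ 0)
    (hr : W.IsNonrecurrentAt p) : ¬ RecurrentAt h om a := by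
  obtain ⟨e, he, hp, rfl, φ, hφ, hφ0, hh, ho⟩ := r
  have w := W.weylNear he (e.map_source hp)
  rw [recurrentAt_congr (weylConn_rep hε w hφ hφ0 hh ho) (faraday_rep w.smooth_form hφ hφ0 ho)]
  exact hr e he hp

theorem Rep.congr (r : Rep W ε p h om a) {h' : E3 → Matrix (Fin 3) (Fin 3) ℝ}
    {om' : E3 → Fin 3 → ℝ} (hh : ∀ᶠ x in 𝓝 a, h' x = h x) (ho : ∀ᶠ x in 𝓝 a, om' x = om x) :
    Rep W ε p h' om' a := by
  obtain ⟨e, he, hp, hpa, φ, hφ, hφ0, hh', ho'⟩ := r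
  refine ⟨e, he, hp, hpa, φ, hφ, hφ0, ?_, ?_⟩
  · filter_upwards [hh, hh'] with x h1 h2 using h1.trans h2
  · filter_upwards [ho, ho'] with x h1 h2 i using by rw [h1, h2]

/-- Change of the representative metric. -/
theorem Rep.gauge (r : Rep W ε p h om a) {χ : E3 → ℝ} (hχ : SmoothNear χ a) (hχ0 : 0 < χ a) :
    Rep W ε p (fun x => (χ x ^ 2) • h x)
      (fun x i => om x i + 2 * pd i (fun z => Real.log (χ z)) x) a := by
  obtain ⟨e, he, hp, hpa, φ, hφ, hφ0, hh, ho⟩ := r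
  refine ⟨e, he, hp, hpa, fun x => χ x * φ x, hχ.mul hφ, mul_pos hχ0 hφ0, ?_, ?_⟩
  · filter_upwards [hh] with x hx
    rw [hx, smul_smul]
    congr 1
    ring
  · filter_upwards [ho, (hχ.log hχ0.ne').eventually, (hφ.log hφ0.ne').eventually,
      eventually_eventually_nhds.2 (hχ.continuousAt.eventually_ne hχ0.ne'),
      eventually_eventually_nhds.2 (hφ.continuousAt.eventually_ne hφ0.ne')] with x hx l1 l2 n1 n2 i
    have e1 : pd i (fun z => Real.log (χ z * φ z)) x
        = pd i (fun z => Real.log (χ z)) x + pd i (fun z => Real.log (φ z)) x := by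
      rw [← pd_add l1.diff l2.diff]
      refine pd_congr ?_ i
      filter_upwards [n1, n2] with z h1 h2 using Real.log_mul h1 h2
    rw [hx, e1]
    ring

end Manifold

/-! ### Behaviour of the components under a change of chart -/

section Manifold
variable {M : Type*} [TopologicalSpace M] [ChartedSpace E3 M]

/-- Composition of a chart with a smooth change of coordinates. -/
theorem trans_mem_maximalAtlas [IsManifold (𝓡 3) ∞ M] {e : OpenPartialHomeomorph M E3}
    (he : e ∈ IsManifold.maximalAtlas (𝓡 3) ∞ M) {Ψ : OpenPartialHomeomorph E3 E3}
    (h1 : ∀ x ∈ Ψ.source, ContDiffAt ℝ ∞ Ψ x) (h2 : ∀ y ∈ Ψ.target, ContDiffAt ℝ ∞ Ψ.symm y) :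
    e.trans Ψ ∈ IsManifold.maximalAtlas (𝓡 3) ∞ M := by
  have c1 : ContMDiffOn (𝓡 3) (𝓡 3) ∞ Ψ Ψ.source :=
    contMDiffOn_iff_contDiffOn.2 fun x hx => (h1 x hx).contDiffWithinAt
  have c2 : ContMDiffOn (𝓡 3) (𝓡 3) ∞ Ψ.symm Ψ.target :=
    contMDiffOn_iff_contDiffOn.2 fun x hx => (h2 x hx).contDiffWithinAt
  refine OpenPartialHomeomorph.mem_maximalAtlas_of_contMDiffOn _ ?_ ?_
  · refine c1.comp ((contMDiffOn_of_mem_maximalAtlas he).mono ?_) ?_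
    · exact fun x hx => hx.1
    · exact fun x hx => hx.2
  · refine (contMDiffOn_symm_of_mem_maximalAtlas he).comp (c2.mono ?_) ?_
    · exact fun x hx => hx.1
    · exact fun x hx => hx.2

/-- The derivative of the inverse of a chart. -/
def chartDeriv (e : OpenPartialHomeomorph M E3) (x : E3) : E3 →L[ℝ] E3 :=
  mfderiv (𝓡 3) (𝓡 3) e.symm x

/-- Near `x` the inverse of `e` is the inverse of the composed chart after `Ψ`, so this is the chain
rule. -/
theorem chartDeriv_trans [IsManifold (𝓡 3) ∞ M] {e : OpenPartialHomeomorph M E3}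
    (he : e ∈ IsManifold.maximalAtlas (𝓡 3) ∞ M) {Ψ : OpenPartialHomeomorph E3 E3}
    (h1 : ∀ x ∈ Ψ.source, ContDiffAt ℝ ∞ Ψ x) (h2 : ∀ y ∈ Ψ.target, ContDiffAt ℝ ∞ Ψ.symm y)
    {x : E3} (hx : x ∈ e.target) (hx' : x ∈ Ψ.source) :
    chartDeriv e x = (chartDeriv (e.trans Ψ) (Ψ x)).comp (fderiv ℝ Ψ x) := by
  have he' := trans_mem_maximalAtlas he h1 h2
  have ht : Ψ x ∈ (e.trans Ψ).target := by
    refine ⟨Ψ.map_source hx', ?_⟩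
    show Ψ.symm (Ψ x) ∈ e.target
    rwa [Ψ.left_inv hx']
  have m1 : MDifferentiableAt (𝓡 3) (𝓡 3) (e.trans Ψ).symm (Ψ x) :=
    (contMDiffAt_symm_of_mem_maximalAtlas he' ht).mdifferentiableAt (by simp)
  have m2 : MDifferentiableAt (𝓡 3) (𝓡 3) Ψ x :=
    ((h1 x hx').differentiableAt (by simp)).mdifferentiableAt
  have hc := mfderiv_comp x m1 m2
  rw [mfderiv_eq_fderiv] at hc
  have hev : e.symm =ᶠ[𝓝 x] (e.trans Ψ).symm ∘ Ψ := by
    filter_upwards [Ψ.open_source.mem_nhds hx'] with z hz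
    show e.symm z = e.symm (Ψ.symm (Ψ z))
    rw [Ψ.left_inv hz]
  rw [chartDeriv, hev.mfderiv_eq]
  exact hc

theorem coordForm_trans [IsManifold (𝓡 3) ∞ M] {e : OpenPartialHomeomorph M E3}
    (he : e ∈ IsManifold.maximalAtlas (𝓡 3) ∞ M) {Ψ : OpenPartialHomeomorph E3 E3}
    (h1 : ∀ x ∈ Ψ.source, ContDiffAt ℝ ∞ Ψ x) (h2 : ∀ y ∈ Ψ.target, ContDiffAt ℝ ∞ Ψ.symm y)
    {x : E3} (hx : x ∈ e.target) (hx' : x ∈ Ψ.source)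
    (om : ∀ p : M, TangentSpace (𝓡 3) p →L[ℝ] ℝ) (i : Fin 3) :
    coordForm om e x i = ∑ b, coordForm om (e.trans Ψ) (Ψ x) b * jac Ψ x b i := by
  let om' : M → E3 →L[ℝ] ℝ := om
  have hp : (e.trans Ψ).symm (Ψ x) = e.symm x := by
    show e.symm (Ψ.symm (Ψ x)) = e.symm x
    rw [Ψ.left_inv hx']
  have hv : ∀ v : E3, om' (e.symm x) (chartDeriv e x v)
      = om' ((e.trans Ψ).symm (Ψ x)) (chartDeriv (e.trans Ψ) (Ψ x) (fderiv ℝ Ψ x v)) := by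
    intro v
    rw [hp, chartDeriv_trans he h1 h2 hx hx']
    rfl
  have hj : ∀ b, fderiv ℝ Ψ x (EuclideanSpace.single i 1) b = jac Ψ x b i := by
    intro b
    rw [fderiv_apply_eq_jac ((h1 x hx').differentiableAt (by simp))]
    simp
  have e1 := hv (EuclideanSpace.single i 1)
  rw [← sum_coord_smul (fderiv ℝ Ψ x (EuclideanSpace.single i 1))] at e1
  simp only [map_sum, map_smul, smul_eq_mul] at e1
  refine e1.trans (Finset.sum_congr rfl fun b _ => ?_)
  rw [hj, mul_comm]
  rfl

theorem coordMetric_trans [IsManifold (𝓡 3) ∞ M] {e : OpenPartialHomeomorph M E3}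
    (he : e ∈ IsManifold.maximalAtlas (𝓡 3) ∞ M) {Ψ : OpenPartialHomeomorph E3 E3}
    (h1 : ∀ x ∈ Ψ.source, ContDiffAt ℝ ∞ Ψ x) (h2 : ∀ y ∈ Ψ.target, ContDiffAt ℝ ∞ Ψ.symm y)
    {x : E3} (hx : x ∈ e.target) (hx' : x ∈ Ψ.source)
    (h : ∀ p : M, TangentSpace (𝓡 3) p →L[ℝ] TangentSpace (𝓡 3) p →L[ℝ] ℝ) :
    coordMetric h e x = (jac Ψ x).transpose * coordMetric h (e.trans Ψ) (Ψ x) * jac Ψ x := by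
  let h' : M → E3 →L[ℝ] E3 →L[ℝ] ℝ := h
  have hp : (e.trans Ψ).symm (Ψ x) = e.symm x := by
    show e.symm (Ψ.symm (Ψ x)) = e.symm x
    rw [Ψ.left_inv hx']
  have hv : ∀ v w : E3, h' (e.symm x) (chartDeriv e x v) (chartDeriv e x w)
      = h' ((e.trans Ψ).symm (Ψ x)) (chartDeriv (e.trans Ψ) (Ψ x) (fderiv ℝ Ψ x v))
        (chartDeriv (e.trans Ψ) (Ψ x) (fderiv ℝ Ψ x w)) := by
    intro v w
    rw [hp, chartDeriv_trans he h1 h2 hx hx']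
    rfl
  have hj : ∀ i b, fderiv ℝ Ψ x (EuclideanSpace.single i 1) b = jac Ψ x b i := by
    intro i b
    rw [fderiv_apply_eq_jac ((h1 x hx').differentiableAt (by simp))]
    simp
  ext i j
  have e1 := hv (EuclideanSpace.single i 1) (EuclideanSpace.single j 1)
  rw [← sum_coord_smul (fderiv ℝ Ψ x (EuclideanSpace.single i 1)),
    ← sum_coord_smul (fderiv ℝ Ψ x (EuclideanSpace.single j 1))] at e1
  simp only [map_sum, map_smul, smul_eq_mul, hj, sum_apply, smul_apply] at e1
  refine e1.trans ?_
  simp only [Matrix.mul_apply, Matrix.transpose_apply]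
  simp only [Finset.sum_mul, Finset.mul_sum]
  refine Finset.sum_congr rfl fun b _ => Finset.sum_congr rfl fun c _ => ?_
  have : h' ((e.trans Ψ).symm (Ψ x)) (chartDeriv (e.trans Ψ) (Ψ x) (EuclideanSpace.single c 1))
      (chartDeriv (e.trans Ψ) (Ψ x) (EuclideanSpace.single b 1))
      = coordMetric h (e.trans Ψ) (Ψ x) c b := rfl
  rw [this]
  ring

theorem eq_of_congruence {J A B : Matrix (Fin 3) (Fin 3) ℝ} (hJ : J.det ≠ 0)
    (h : J.transpose * A * J = J.transpose * B * J) : A = B := by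
  have u : IsUnit J.det := hJ.isUnit
  have u' : IsUnit J.transpose.det := by rwa [Matrix.det_transpose]
  have h1 : J.transpose * A = J.transpose * B := by
    have := congrArg (· * J⁻¹) h
    simpa [Matrix.mul_assoc, Matrix.mul_nonsing_inv _ u] using this
  have := congrArg (J.transpose⁻¹ * ·) h1
  simpa [← Matrix.mul_assoc, Matrix.nonsing_inv_mul _ u'] using this

theorem eq_of_sum_mul_eq {J : Matrix (Fin 3) (Fin 3) ℝ} (hJ : J.det ≠ 0) {v w : Fin 3 → ℝ}
    (h : ∀ i, ∑ b, v b * J b i = ∑ b, w b * J b i) : v = w := by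
  have h1 : Matrix.vecMul v J = Matrix.vecMul w J := funext h
  have := congrArg (fun u => Matrix.vecMul u J⁻¹) h1
  simpa [Matrix.vecMul_vecMul, Matrix.mul_nonsing_inv _ hJ.isUnit] using this

/-- Change of coordinates. -/
theorem Rep.chart [IsManifold (𝓡 3) ∞ M] {W : WeylStructure M} {ε : ℝ} {p : M}
    {h h' : E3 → Matrix (Fin 3) (Fin 3) ℝ} {om om' : E3 → Fin 3 → ℝ} {a : E3}
    (r : Rep W ε p h om a) {ψ : E3 → E3} (hψ : SmoothNear ψ a) (hdet : (jac ψ a).det ≠ 0)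
    (hh : ∀ᶠ x in 𝓝 a, h x = (jac ψ x).transpose * h' (ψ x) * jac ψ x)
    (ho : ∀ᶠ x in 𝓝 a, ∀ i, om x i = ∑ b, om' (ψ x) b * jac ψ x b i) :
    Rep W ε p h' om' (ψ a) := by
  obtain ⟨e, he, hp, rfl, φ, hφ, hφ0, hh', ho'⟩ := r
  obtain ⟨Ψ, ha, hΨ, h1, h2⟩ := exists_local_inverse hψ hdet
  have hΨe : (Ψ : E3 → E3) = ψ := funext hΨ
  rw [← hΨe] at h1 hh ho hdet hψ ⊢
  have hat : e p ∈ e.target := e.map_source hp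
  have hpt : Ψ (e p) ∈ Ψ.target := Ψ.map_source ha
  have hleft : Ψ.symm (Ψ (e p)) = e p := Ψ.left_inv ha
  have hsm : SmoothNear Ψ.symm (Ψ (e p)) := by
    filter_upwards [Ψ.open_target.mem_nhds hpt] with y hy using h2 y hy
  have htend : Filter.Tendsto Ψ.symm (𝓝 (Ψ (e p))) (𝓝 (e p)) := by
    have := hsm.continuousAt.tendsto
    rwa [hleft] at this
  have hdetn : ∀ᶠ x in 𝓝 (e p), (jac Ψ x).det ≠ 0 :=
    (smoothNear_det fun i j => (hψ.coord i).pd j).continuousAt.eventually_ne hdet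
  have hgood : ∀ᶠ x in 𝓝 (e p), h' (Ψ x) = (φ x ^ 2 * ε) • W.hc (e.trans Ψ) (Ψ x) ∧
      ∀ i, om' (Ψ x) i = W.omc (e.trans Ψ) (Ψ x) i
        + 2 * pd i (fun z => Real.log (φ (Ψ.symm z))) (Ψ x) := by
    filter_upwards [hh, ho, hh', ho', hdetn, e.open_target.mem_nhds hat,
      Ψ.open_source.mem_nhds ha, (hφ.log hφ0.ne').eventually] with x c1 c2 c3 c4 c5 c6 c7 c8
    constructor
    · refine eq_of_congruence c5 ?_
      rw [← c1, c3, Matrix.mul_smul, Matrix.smul_mul]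
      congr 1
      exact coordMetric_trans he h1 h2 c6 c7 W.h
    · have key : om' (Ψ x) = fun i => W.omc (e.trans Ψ) (Ψ x) i
          + 2 * pd i (fun z => Real.log (φ (Ψ.symm z))) (Ψ x) := ?_
      · exact congrFun key
      refine eq_of_sum_mul_eq c5 fun i => ?_
      rw [← c2, c4]
      have e1 : W.omc e x i = ∑ b, W.omc (e.trans Ψ) (Ψ x) b * jac Ψ x b i :=
        coordForm_trans he h1 h2 c6 c7 W.om i
      have e2 : pd i (fun z => Real.log (φ z)) x
          = ∑ b, pd b (fun z => Real.log (φ (Ψ.symm z))) (Ψ x) * jac Ψ x b i := by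
        have hx' : SmoothNear (fun z => Real.log (φ z)) (Ψ.symm (Ψ x)) := by
          rwa [Ψ.left_inv c7]
        rw [← pd_comp (f := fun z => Real.log (φ (Ψ.symm z)))]
        · refine pd_congr ?_ i
          filter_upwards [Ψ.open_source.mem_nhds c7] with z hz
          rw [Ψ.left_inv hz]
        · exact hx'.diff.comp (Ψ x) ((h2 _ (Ψ.map_source c7)).differentiableAt (by simp))
        · exact (h1 x c7).differentiableAt (by simp)
      rw [e1, e2, Finset.mul_sum, ← Finset.sum_add_distrib]
      exact Finset.sum_congr rfl fun b _ => by ring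
  have hgood' := htend.eventually hgood
  refine ⟨e.trans Ψ, trans_mem_maximalAtlas he h1 h2, ⟨hp, ha⟩, rfl, fun y => φ (Ψ.symm y), ?_, ?_,
    ?_, ?_⟩
  · exact SmoothNear.comp (by rwa [hleft]) hsm
  · simpa only [hleft] using hφ0
  · filter_upwards [hgood', Ψ.open_target.mem_nhds hpt] with y hy hyt
    have := hy.1
    rwa [Ψ.right_inv hyt] at this
  · filter_upwards [hgood', Ψ.open_target.mem_nhds hpt] with y hy hyt
    have := hy.2
    rwa [Ψ.right_inv hyt] at this

end Manifold

/-! ### Choice of a chart and a representative adapted to the Faraday form -/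

/-- This turns statements about germs at ψ(a) into statements at a, so that identities in new
coordinates can be checked in the old ones. -/
theorem map_nhds_of_jac_det_ne_zero {ψ : E3 → E3} {a : E3} (hψ : SmoothNear ψ a)
    (hdet : (jac ψ a).det ≠ 0) : Filter.map ψ (𝓝 a) = 𝓝 (ψ a) := by
  obtain ⟨Ψ, ha, hΨ, -, -⟩ := exists_local_inverse hψ hdet
  rw [← funext hΨ]
  exact Ψ.map_nhds_eq ha

theorem eventually_jac_det_ne_zero {ψ : E3 → E3} {a : E3} (hψ : SmoothNear ψ a)
    (hdet : (jac ψ a).det ≠ 0) : ∀ᶠ x in 𝓝 a, (jac ψ x).det ≠ 0 :=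
  (smoothNear_det fun i j => (hψ.coord i).pd j).continuousAt.eventually_ne hdet

section Manifold
variable {M : Type*} [TopologicalSpace M] [ChartedSpace E3 M] [IsManifold (𝓡 3) ∞ M]
  {W : WeylStructure M} {ε : ℝ} {p : M} {h : E3 → Matrix (Fin 3) (Fin 3) ℝ}
  {om : E3 → Fin 3 → ℝ} {a : E3}

/-- The new components are the old ones transported by the inverse Jacobian along a local inverse of
ψ. Their smoothness need not be checked here, since it follows from `Rep.weylNear`. -/
theorem Rep.exists_chart (r : Rep W ε p h om a) {ψ : E3 → E3} (hψ : SmoothNear ψ a)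
    (hdet : (jac ψ a).det ≠ 0) :
    ∃ (h' : E3 → Matrix (Fin 3) (Fin 3) ℝ) (om' : E3 → Fin 3 → ℝ), Rep W ε p h' om' (ψ a) ∧
      (∀ᶠ x in 𝓝 a, h x = (jac ψ x).transpose * h' (ψ x) * jac ψ x) ∧
      ∀ᶠ x in 𝓝 a, ∀ i, om x i = ∑ b, om' (ψ x) b * jac ψ x b i := by
  obtain ⟨Ψ, ha, hΨ, -, -⟩ := exists_local_inverse hψ hdet
  have hl : ∀ᶠ x in 𝓝 a, Ψ.symm (ψ x) = x := by
    filter_upwards [Ψ.open_source.mem_nhds ha] with x hx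
    rw [← hΨ]
    exact Ψ.left_inv hx
  have hJ := eventually_jac_det_ne_zero hψ hdet
  let h' : E3 → Matrix (Fin 3) (Fin 3) ℝ := fun y =>
    (jac ψ (Ψ.symm y))⁻¹.transpose * h (Ψ.symm y) * (jac ψ (Ψ.symm y))⁻¹
  let om' : E3 → Fin 3 → ℝ := fun y => Matrix.vecMul (om (Ψ.symm y)) (jac ψ (Ψ.symm y))⁻¹
  have e1 : ∀ᶠ x in 𝓝 a, h x = (jac ψ x).transpose * h' (ψ x) * jac ψ x := by
    filter_upwards [hl, hJ] with x h1 h2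
    simp only [h', h1]
    rw [Matrix.transpose_nonsing_inv]
    have u : IsUnit (jac ψ x).transpose.det := by
      rw [Matrix.det_transpose]; exact h2.isUnit
    rw [← Matrix.mul_assoc, ← Matrix.mul_assoc, Matrix.mul_nonsing_inv _ u, Matrix.one_mul,
      Matrix.mul_assoc, Matrix.nonsing_inv_mul _ h2.isUnit, Matrix.mul_one]
  have e2 : ∀ᶠ x in 𝓝 a, ∀ i, om x i = ∑ b, om' (ψ x) b * jac ψ x b i := by
    filter_upwards [hl, hJ] with x h1 h2 i
    simp only [om', h1]
    have : om x = Matrix.vecMul (Matrix.vecMul (om x) (jac ψ x)⁻¹) (jac ψ x) := by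
      rw [Matrix.vecMul_vecMul, Matrix.nonsing_inv_mul _ h2.isUnit, Matrix.vecMul_one]
    exact congrFun this i
  exact ⟨h', om', r.chart hψ hdet e1 e2, e1, e2⟩

end Manifold

/-- The exterior derivative commutes with pull-back. -/
theorem d_pullback {ψ : E3 → E3} {om om' : E3 → Fin 3 → ℝ} {x : E3} (hψ : SmoothNear ψ x)
    (hs : ∀ b, DifferentiableAt ℝ (fun z => om' z b) (ψ x))
    (ho : ∀ᶠ z in 𝓝 x, ∀ i, om z i = ∑ b, om' (ψ z) b * jac ψ z b i) (i j : Fin 3) :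
    pd i (fun z => om z j) x - pd j (fun z => om z i) x
      = ∑ b, ∑ c, (pd b (fun z => om' z c) (ψ x) - pd c (fun z => om' z b) (ψ x))
          * jac ψ x b i * jac ψ x c j := by
  have e : ∀ i j, pd i (fun z => om z j) x = ∑ c, ((∑ b, pd b (fun z => om' z c) (ψ x)
      * jac ψ x b i) * jac ψ x c j + om' (ψ x) c * pd i (pd j (fun z => ψ z c)) x) := by
    intro i j
    have hd : ∀ c, DifferentiableAt ℝ (fun z => om' (ψ z) c) x := fun c =>
      DifferentiableAt.comp (g := fun z => om' z c) x (hs c) (hψ.contDiffAt.differentiableAt (by simp))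
    have hj : ∀ c, DifferentiableAt ℝ (fun z => jac ψ z c j) x := fun c => ((hψ.coord c).pd j).diff
    rw [pd_congr (ho.mono fun z hz => hz j), pd_sum fun c _ => (hd c).fun_mul (hj c)]
    refine Finset.sum_congr rfl fun c _ => ?_
    rw [pd_mul (hd c) (hj c), pd_comp (f := fun z => om' z c) (hs c) (hψ.contDiffAt.differentiableAt (by simp))]
    rfl
  have hc := fun c => (hψ.coord c).pd_comm i j
  rw [e i j, e j i]
  simp only [hc, Fin.sum_univ_three]
  ring

theorem curl_gauge {om : E3 → Fin 3 → ℝ} {x : E3} {χ : E3 → ℝ}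
    (hs : ∀ i, DifferentiableAt ℝ (fun z => om z i) x) (hχ : SmoothNear χ x) (h0 : χ x ≠ 0)
    (k : Fin 3) :
    curl (fun z i => om z i + 2 * pd i (fun z => Real.log (χ z)) z) k x = curl om k x := by
  have l := hχ.log h0
  have e : ∀ i j, pd i (fun z => om z j + 2 * pd j (fun z => Real.log (χ z)) z) x
      = pd i (fun z => om z j) x + 2 * pd i (pd j (fun z => Real.log (χ z))) x := by
    intro i j
    rw [pd_add (hs j) ((l.pd j).diff.const_mul 2), pd_const_mul _ (l.pd j).diff]
  simp only [curl, e, l.pd_comm (k + 1) (k + 2)]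
  ring

section Manifold
variable {M : Type*} [TopologicalSpace M] [ChartedSpace E3 M] [IsManifold (𝓡 3) ∞ M]
  {W : WeylStructure M} {ε : ℝ} {p : M} {h : E3 → Matrix (Fin 3) (Fin 3) ℝ}
  {om : E3 → Fin 3 → ℝ} {a : E3}

/-- The curl spans the kernel of dω. Straightening it to the direction of index 1 makes the
contraction of dω with this direction vanish, leaving only the component `curl om 1`. A rescaling
then removes the corresponding component of ω without affecting dω. -/
theorem Rep.exists_straight_curl (r : Rep W ε p h om a) (hε : ε ≠ 0)
    (hd : (h a).det < 0) (hv : ∃ k, curl om k a ≠ 0) :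
    ∃ h om a, Rep W ε p h om a ∧ (h a).det < 0 ∧ curl om 1 a ≠ 0 ∧
      ∀ᶠ x in 𝓝 a, om x 1 = 0 ∧ curl om 0 x = 0 ∧ curl om 2 x = 0 := by
  have w := r.weylNear hε
  let V : E3 → E3 := fun x => WithLp.toLp 2 fun i => curl om i x
  have hV : SmoothNear V a := smoothNear_of_coord fun i => w.smooth_curl i
  have hVa : V a ≠ 0 := by
    obtain ⟨k, hk⟩ := hv
    intro h0
    exact hk (by simpa [V] using congrFun (congrArg WithLp.ofLp h0) k)
  obtain ⟨ψ, hψ, hdet, hst⟩ := exists_straighten hV hVa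
  obtain ⟨h', om', r', hh', ho'⟩ := r.exists_chart hψ hdet
  have w' := r'.weylNear hε
  have hmap := map_nhds_of_jac_det_ne_zero hψ hdet
  have hw' : ∀ᶠ x in 𝓝 a, WeylNear h' om' (ψ x) := by
    have := w'.eventually
    rw [← hmap] at this
    exact this
  have hpull : ∀ᶠ x in 𝓝 a, ∀ i j,
      pd i (fun z => om z j) x - pd j (fun z => om z i) x
        = ∑ b, ∑ c, (pd b (fun z => om' z c) (ψ x) - pd c (fun z => om' z b) (ψ x))
          * jac ψ x b i * jac ψ x c j := by
    filter_upwards [hψ.eventually, hw', eventually_eventually_nhds.2 ho'] with x h1 h2 h3 i j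
    exact d_pullback h1 (fun b => (h2.smooth_form b).diff) h3 i j
  have hcontr : ∀ᶠ x in 𝓝 a, ∀ c,
      pd 1 (fun z => om' z c) (ψ x) - pd c (fun z => om' z 1) (ψ x) = 0 := by
    filter_upwards [hst, hpull, eventually_jac_det_ne_zero hψ hdet] with x h1 h2 h3
    have key : (fun c => pd 1 (fun z => om' z c) (ψ x) - pd c (fun z => om' z 1) (ψ x))
        = fun _ => 0 := by
      refine eq_of_sum_mul_eq h3 fun j => ?_
      -- A two-form in dimension three is annihilated by its own curl. Through `d_pullback` this
      -- carries over to the straightened field in the new chart.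
      have z : ∑ i, (pd i (fun z => om z j) x - pd j (fun z => om z i) x) * V x i = 0 := by
        have n1 : (1 : Fin 3) + 1 = 2 := rfl
        have n2 : (1 : Fin 3) + 2 = 0 := rfl
        have n3 : (2 : Fin 3) + 1 = 0 := rfl
        have n4 : (2 : Fin 3) + 2 = 1 := rfl
        have n5 : (0 : Fin 3) + 1 = 1 := rfl
        have n6 : (0 : Fin 3) + 2 = 2 := rfl
        fin_cases j <;> simp [V, curl, Fin.sum_univ_three, n1, n2, n3, n4, n5, n6] <;> ring
      have z' : ∑ i, (pd i (fun z => om z j) x - pd j (fun z => om z i) x) * V x i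
          = ∑ b, ∑ c, (pd b (fun z => om' z c) (ψ x) - pd c (fun z => om' z b) (ψ x))
            * (∑ i, jac ψ x b i * V x i) * jac ψ x c j := by
        simp only [h2, Fin.sum_univ_three]
        ring
      rw [z'] at z
      simp only [h1] at z
      simp only [Fin.sum_univ_three] at z ⊢
      simpa using z
    exact fun c => congrFun key c
  have hcontr' : ∀ᶠ y in 𝓝 (ψ a), curl om' 0 y = 0 ∧ curl om' 2 y = 0 := by
    rw [← hmap, Filter.eventually_map]
    filter_upwards [hcontr] with x hx
    refine ⟨hx 2, ?_⟩
    have := hx 0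
    show pd 0 (fun z => om' z 1) (ψ x) - pd 1 (fun z => om' z 0) (ψ x) = 0
    linarith
  have hne : curl om' 1 (ψ a) ≠ 0 := by
    intro h1
    obtain ⟨k, hk⟩ := hv
    obtain ⟨c0, c2⟩ := hcontr'.self_of_nhds
    apply hk
    have hp := hpull.self_of_nhds (k + 1) (k + 2)
    change curl om k a = _ at hp
    rw [hp]
    change pd 1 (fun z => om' z 2) (ψ a) - pd 2 (fun z => om' z 1) (ψ a) = 0 at c0
    change pd 0 (fun z => om' z 1) (ψ a) - pd 1 (fun z => om' z 0) (ψ a) = 0 at c2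
    change pd 2 (fun z => om' z 0) (ψ a) - pd 0 (fun z => om' z 2) (ψ a) = 0 at h1
    simp only [Fin.sum_univ_three]
    linear_combination (jac ψ a 1 (k+1) * jac ψ a 2 (k+2) - jac ψ a 2 (k+1) * jac ψ a 1 (k+2)) * c0
      + (jac ψ a 0 (k+1) * jac ψ a 1 (k+2) - jac ψ a 1 (k+1) * jac ψ a 0 (k+2)) * c2
      + (jac ψ a 2 (k+1) * jac ψ a 0 (k+2) - jac ψ a 0 (k+1) * jac ψ a 2 (k+2)) * h1
  have hd' : (h' (ψ a)).det < 0 := by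
    have e := hh'.self_of_nhds
    rw [e, Matrix.det_mul, Matrix.det_mul, Matrix.det_transpose] at hd
    by_contra! hc
    have := mul_nonneg (sq_nonneg (jac ψ a).det) hc
    nlinarith
  obtain ⟨Ω, hΩ, hΩ1⟩ := exists_primitive (w'.smooth_form 1) 1
  -- With this factor 2 d ln χ = -dΩ, and ∂_1 Ω is the component of the one-form to be removed.
  let χ : E3 → ℝ := fun x => Real.exp (-(1 / 2) * Ω x)
  have hχ : SmoothNear χ (ψ a) := SmoothNear.comp (u := Real.exp)
    (smoothNear_of_contDiff Real.contDiff_exp _) ((SmoothNear.const _).mul hΩ)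
  have hχ0 : ∀ x, 0 < χ x := fun x => Real.exp_pos _
  have hlog : (fun z => Real.log (χ z)) = fun z => -(1 / 2) * Ω z := by
    ext z; simp [χ]
  have hcurl : ∀ᶠ y in 𝓝 (ψ a), ∀ k,
      curl (fun z i => om' z i + 2 * pd i (fun z => Real.log (χ z)) z) k y = curl om' k y := by
    filter_upwards [w'.eventually, hχ.eventually] with y h1 h2 k
    exact curl_gauge (fun i => (h1.smooth_form i).diff) h2 (hχ0 y).ne' k
  refine ⟨_, _, _, r'.gauge hχ (hχ0 _), ?_, ?_, ?_⟩
  · rw [Matrix.det_smul]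
    exact mul_neg_of_pos_of_neg (pow_pos (pow_pos (hχ0 _) _) _) hd'
  · rw [hcurl.self_of_nhds]; exact hne
  · filter_upwards [hcontr', hcurl, hΩ1, hΩ.eventually] with y h1 h2 h3 h4
    refine ⟨?_, by rw [h2]; exact h1.1, by rw [h2]; exact h1.2⟩
    rw [hlog, pd_const_mul _ h4.diff, h3]
    ring

end Manifold

theorem jac_freeze (c : ℝ) (i : Fin 3) (x : E3) (b j : Fin 3) :
    jac (freeze i c) x b j = if b = i then 0 else if b = j then 1 else 0 := by
  rw [jac_apply]
  simp only [freeze_apply]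
  split_ifs with h1 h2
  · exact pd_const _
  · rw [pd_coord, if_pos h2]
  · rw [pd_coord, if_neg h2]

/-- A one-form `f₀ dy + f₂ dt` with coefficients independent of `x` is proportional to the
differential of a function independent of `x`. -/
theorem exists_planar_integral {f₀ f₂ : E3 → ℝ} {a : E3} (hs₀ : SmoothNear f₀ a)
    (hs₂ : SmoothNear f₂ a) (h₀ : ∀ᶠ x in 𝓝 a, pd 1 f₀ x = 0) (h₂ : ∀ᶠ x in 𝓝 a, pd 1 f₂ x = 0)
    (hne : f₀ a ≠ 0 ∨ f₂ a ≠ 0) :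
    ∃ T : E3 → ℝ, SmoothNear T a ∧ (∀ᶠ x in 𝓝 a, pd 1 T x = 0) ∧
      (∀ᶠ x in 𝓝 a, f₂ x * pd 0 T x = f₀ x * pd 2 T x) ∧ (pd 0 T a ≠ 0 ∨ pd 2 T a ≠ 0) := by
  -- In the plane of y and t this vector spans the kernel of the one-form, so a planar function
  -- constant along V has differential proportional to the form.
  let V : E3 → E3 := fun x => !₂[f₂ x, 0, -f₀ x]
  have hV : SmoothNear V a := smoothNear_of_coord fun i => by
    fin_cases i
    · exact hs₂
    · exact SmoothNear.const 0
    · exact hs₀.neg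
  have hVa : V a ≠ 0 := by
    intro h
    have e0 : f₂ a = 0 := congrFun (congrArg WithLp.ofLp h) 0
    have e2 : -f₀ a = 0 := congrFun (congrArg WithLp.ofLp h) 2
    rcases hne with h' | h'
    · exact h' (by linarith)
    · exact h' e0
  obtain ⟨ψ, hψ, hdet, hst⟩ := exists_straighten hV hVa
  have hfa : freeze 1 (a 1) a = a := freeze_self 1 a
  have hcf := contDiff_freeze 1 (a 1)
  have htend : Filter.Tendsto (freeze 1 (a 1)) (𝓝 a) (𝓝 a) := by
    have := hcf.continuous.tendsto a
    rwa [hfa] at this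
  have hpd : ∀ c, ∀ᶠ x in 𝓝 a, ∀ j, pd j (fun z => ψ (freeze 1 (a 1) z) c) x
      = if j = 1 then 0 else jac ψ (freeze 1 (a 1) x) c j := by
    intro c
    filter_upwards [htend.eventually hψ.eventually] with x hx j
    rw [pd_comp (f := fun z => ψ z c) (hx.coord c).diff (hcf.differentiable (by simp) x)]
    simp only [jac_freeze, Fin.sum_univ_three, ← jac_apply]
    fin_cases j <;> simp
  -- The straightening coordinates with index other than 1 are first integrals of V. If both had
  -- zero planar differential, rows 0 and 2 of the Jacobian would be proportional. Freezing x
  -- afterwards makes the chosen integral independent of x.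
  have hc : ∃ c, c ≠ 1 ∧ (jac ψ a c 0 ≠ 0 ∨ jac ψ a c 2 ≠ 0) := by
    by_contra! hn
    apply hdet
    rw [Matrix.det_fin_three, (hn 0 (by decide)).1, (hn 0 (by decide)).2, (hn 2 (by decide)).1,
      (hn 2 (by decide)).2]
    ring
  obtain ⟨c, hc1, hc2⟩ := hc
  refine ⟨fun z => ψ (freeze 1 (a 1) z) c, ?_, ?_, ?_, ?_⟩
  · refine SmoothNear.comp (u := fun z => ψ z c) ?_ (smoothNear_of_contDiff hcf a)
    rw [hfa]; exact hψ.coord c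
  · filter_upwards [hpd c] with x hx
    rw [hx]; simp
  · filter_upwards [hpd c, htend.eventually hst, eventually_eq_freeze hs₀ h₀,
      eventually_eq_freeze hs₂ h₂] with x hx h1 h2 h3
    have := h1 c
    rw [if_neg hc1] at this
    simp only [Fin.sum_univ_three, V] at this
    rw [hx, hx, h2, h3]
    simp at this ⊢
    linarith
  · have := (hpd c).self_of_nhds
    rw [this, this, hfa]
    simpa using hc2

section Manifold
variable {M : Type*} [TopologicalSpace M] [ChartedSpace E3 M] [IsManifold (𝓡 3) ∞ M]
  {W : WeylStructure M} {ε : ℝ} {p : M} {h : E3 → Matrix (Fin 3) (Fin 3) ℝ}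
  {om : E3 → Fin 3 → ℝ} {a : E3}

/-- The metric contributes the weight χ² and the density the weight χ⁻³, while dω is unchanged. -/
theorem dualForm_gauge {χ : E3 → ℝ} {x : E3} (hχ : 0 < χ x) {om' : E3 → Fin 3 → ℝ}
    (hc : ∀ k, curl om' k x = curl om k x) (i : Fin 3) :
    dualForm (fun x => (χ x ^ 2) • h x) om' i x = dualForm h om i x / χ x := by
  have e : invSqrtDet (fun x => (χ x ^ 2) • h x) x = invSqrtDet h x / χ x ^ 3 := by
    simp only [invSqrtDet, Matrix.det_smul, Fintype.card_fin]
    rw [show -((χ x ^ 2) ^ 3 * (h x).det) = (χ x ^ 3) ^ 2 * (-(h x).det) by ring,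
      Real.sqrt_mul (sq_nonneg _), Real.sqrt_sq (pow_pos hχ 3).le, mul_inv]
    field_simp
  simp only [dualForm, e, hc, Matrix.smul_apply, smul_eq_mul, Fin.sum_univ_three]
  field_simp

-- With dω concentrated in one component, nullity says that the dual form f has no dx component.
-- Then df = -(1/2) ω ∧ f and ω(∂_x) = 0 make f independent of x, so f = σ dT for a planar function
-- T. Rescaling by σ turns f into dT.
omit [IsManifold (𝓡 3) ∞ M] in
theorem Rep.exists_dual_exact (r : Rep W ε p h om a) (hε : ε ≠ 0) (hR : RicciSkewNear h om a)
    (hd : (h a).det < 0) (hv : curl om 1 a ≠ 0)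
    (hn : ∀ᶠ x in 𝓝 a, om x 1 = 0 ∧ curl om 0 x = 0 ∧ curl om 2 x = 0) :
    ∃ (h : E3 → Matrix (Fin 3) (Fin 3) ℝ) (om : E3 → Fin 3 → ℝ) (T : E3 → ℝ),
      Rep W ε p h om a ∧ (h a).det < 0 ∧ curl om 1 a ≠ 0 ∧ SmoothNear T a ∧
      (pd 0 T a ≠ 0 ∨ pd 2 T a ≠ 0) ∧
      ∀ᶠ x in 𝓝 a, om x 1 = 0 ∧ curl om 0 x = 0 ∧ curl om 2 x = 0 ∧ pd 1 T x = 0 ∧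
        ∀ i, dualForm h om i x = pd i T x := by
  have w := r.weylNear hε
  have hdn : ∀ᶠ x in 𝓝 a, (h x).det < 0 :=
    (smoothNear_det w.smooth_h).continuousAt.eventually_lt_const hd
  have hf1 : ∀ᶠ x in 𝓝 a, dualForm h om 1 x = 0 := by
    filter_upwards [w.eventually, hdn, eventually_eventually_nhds.2 hR, hn,
      (w.smooth_curl 1).continuousAt.eventually_ne hv] with x h1 h2 h3 h4 h5
    have := h1.curl_null h3 h2
    simp only [Fin.sum_univ_three, h4.2.1, h4.2.2, zero_mul, zero_add, add_zero] at this
    exact (mul_eq_zero.1 this).resolve_left h5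
  have hfi : ∀ i, ∀ᶠ x in 𝓝 a, pd 1 (dualForm h om i) x = 0 := by
    intro i
    filter_upwards [w.eventually, hdn, eventually_eventually_nhds.2 hR, hn, hf1,
      eventually_eventually_nhds.2 hf1] with x h1 h2 h3 h4 h5 h6
    have := h1.d_dualForm h3 h2 1 i
    rw [h4.1, h5, pd_congr (g := fun _ => 0) h6, pd_const] at this
    linarith
  have hne : dualForm h om 0 a ≠ 0 ∨ dualForm h om 2 a ≠ 0 := by
    by_contra! hc
    have hz : ∀ i, dualForm h om i a = 0 := by
      intro i
      fin_cases i
      exacts [hc.1, hf1.self_of_nhds, hc.2]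
    have hρ : invSqrtDet h a ≠ 0 := inv_ne_zero (Real.sqrt_ne_zero'.2 (by linarith))
    have hz' : Matrix.mulVec (h a) (fun j => curl om j a) = 0 := by
      ext i
      exact (mul_eq_zero.1 (hz i)).resolve_left hρ
    exact hv (congrFun (Matrix.eq_zero_of_mulVec_eq_zero hd.ne hz') 1)
  obtain ⟨T₀, hT₀, hT1₀, hpar₀, hne₀⟩ := exists_planar_integral (w.smooth_dualForm hd 0)
    (w.smooth_dualForm hd 2) (hfi 0) (hfi 2) hne
  -- choose the sign of the function
  obtain ⟨T, hT, hT1, hpar, hneT, hpos⟩ : ∃ T : E3 → ℝ, SmoothNear T a ∧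
      (∀ᶠ x in 𝓝 a, pd 1 T x = 0) ∧
      (∀ᶠ x in 𝓝 a, dualForm h om 2 x * pd 0 T x = dualForm h om 0 x * pd 2 T x) ∧
      (pd 0 T a ≠ 0 ∨ pd 2 T a ≠ 0) ∧
      0 < dualForm h om 0 a * pd 0 T a + dualForm h om 2 a * pd 2 T a := by
    have hnz : dualForm h om 0 a * pd 0 T₀ a + dualForm h om 2 a * pd 2 T₀ a ≠ 0 := by
      intro hz
      have hp := hpar₀.self_of_nhds
      have hq : 0 < pd 0 T₀ a ^ 2 + pd 2 T₀ a ^ 2 := by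
        rcases hne₀ with h' | h'
        · have := sq_nonneg (pd 2 T₀ a); positivity
        · have := sq_nonneg (pd 0 T₀ a); positivity
      rcases hne with h' | h'
      · apply h'
        have : dualForm h om 0 a * (pd 0 T₀ a ^ 2 + pd 2 T₀ a ^ 2) = 0 := by
          linear_combination pd 0 T₀ a * hz - pd 2 T₀ a * hp
        exact (mul_eq_zero.1 this).resolve_right hq.ne'
      · apply h'
        have : dualForm h om 2 a * (pd 0 T₀ a ^ 2 + pd 2 T₀ a ^ 2) = 0 := by
          linear_combination pd 2 T₀ a * hz + pd 0 T₀ a * hp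
        exact (mul_eq_zero.1 this).resolve_right hq.ne'
    rcases lt_or_gt_of_ne hnz with h' | h'
    · refine ⟨fun x => - T₀ x, hT₀.neg, ?_, ?_, ?_, ?_⟩
      · filter_upwards [hT1₀] with x hx
        rw [pd_neg, hx, neg_zero]
      · filter_upwards [hpar₀] with x hx
        rw [pd_neg, pd_neg]
        linarith
      · simpa only [pd_neg, neg_ne_zero] using hne₀
      · rw [pd_neg, pd_neg]
        linarith
    · exact ⟨T₀, hT₀, hT1₀, hpar₀, hne₀, h'⟩
  have hqa : 0 < pd 0 T a ^ 2 + pd 2 T a ^ 2 := by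
    rcases hneT with h' | h'
    · have := sq_nonneg (pd 2 T a); positivity
    · have := sq_nonneg (pd 0 T a); positivity
  -- The ratio of two parallel covectors, written with a sum of squares as denominator so that it is
  -- smooth whichever component of dT is nonzero. It does not depend on x, so using it as conformal
  -- factor keeps the dx component of ω equal to zero.
  let σ : E3 → ℝ := fun x => (dualForm h om 0 x * pd 0 T x + dualForm h om 2 x * pd 2 T x)
    / (pd 0 T x ^ 2 + pd 2 T x ^ 2)
  have hqs : SmoothNear (fun x => pd 0 T x ^ 2 + pd 2 T x ^ 2) a :=
    ((hT.pd 0).pow 2).add ((hT.pd 2).pow 2)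
  have hσ : SmoothNear σ a := (((w.smooth_dualForm hd 0).mul (hT.pd 0)).add
    ((w.smooth_dualForm hd 2).mul (hT.pd 2))).div hqs hqa.ne'
  have hσ0 : 0 < σ a := div_pos hpos hqa
  have hqn := hqs.continuousAt.eventually_ne hqa.ne'
  have hσn := hσ.continuousAt.eventually_const_lt hσ0
  have hfσ : ∀ᶠ x in 𝓝 a, ∀ i, dualForm h om i x = σ x * pd i T x := by
    filter_upwards [hqn, hpar, hf1, hT1] with x h1 h2 h3 h4 i
    fin_cases i
    · simp only [σ, Fin.zero_eta]
      field_simp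
      linear_combination (- pd 2 T x) * h2
    · simp only [Fin.mk_one]
      rw [h3, h4, mul_zero]
    · simp only [σ, Fin.reduceFinMk]
      field_simp
      linear_combination (pd 0 T x) * h2
  have hσ1 : ∀ᶠ x in 𝓝 a, pd 1 σ x = 0 := by
    have hpT : ∀ i, ∀ᶠ x in 𝓝 a, pd 1 (pd i T) x = 0 := by
      intro i
      filter_upwards [hT.eventually, eventually_eventually_nhds.2 hT1] with x h1 h2
      rw [h1.pd_comm, pd_congr (g := fun _ => 0) h2, pd_const]
    filter_upwards [hσ.eventually, eventually_eventually_nhds.2 hfσ, hfi 0, hfi 2, hpT 0, hpT 2, hqn,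
      hT.eventually] with x h1 h2 h3 h4 h5 h6 h7 h8
    have e0 := pd_congr (h2.mono fun z hz => hz 0) 1
    have e2 := pd_congr (h2.mono fun z hz => hz 2) 1
    rw [h3, pd_mul h1.diff (h8.pd 0).diff, h5] at e0
    rw [h4, pd_mul h1.diff (h8.pd 2).diff, h6] at e2
    have : pd 1 σ x * (pd 0 T x ^ 2 + pd 2 T x ^ 2) = 0 := by
      linear_combination (- pd 0 T x) * e0 - pd 2 T x * e2
    exact (mul_eq_zero.1 this).resolve_right h7
  have hcurl : ∀ᶠ y in 𝓝 a, ∀ k,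
      curl (fun z i => om z i + 2 * pd i (fun z => Real.log (σ z)) z) k y = curl om k y := by
    filter_upwards [w.eventually, hσ.eventually, hσn] with y h1 h2 h3 k
    exact curl_gauge (fun i => (h1.smooth_form i).diff) h2 h3.ne' k
  refine ⟨_, _, T, r.gauge hσ hσ0, ?_, ?_, hT, hneT, ?_⟩
  · rw [Matrix.det_smul]
    exact mul_neg_of_pos_of_neg (pow_pos (pow_pos hσ0 _) _) hd
  · rw [hcurl.self_of_nhds]; exact hv
  · filter_upwards [hn, hcurl, hσ1, hσ.eventually, hσn, hT1, hfσ] with y h1 h2 h3 h4 h5 h6 h7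
    refine ⟨?_, by rw [h2]; exact h1.2.1, by rw [h2]; exact h1.2.2, h6, fun i => ?_⟩
    · rw [pd_log h4.diff h5.ne', h3, h1.1]
      simp
    · rw [dualForm_gauge h5 h2, h7]
      field_simp

end Manifold

/-! ### The adapted form of the metric -/

/-- The metric `dy² + 2 dx dt + 2 b dy dt + c dt²`. -/
def ansatz (b c : E3 → ℝ) (x : E3) : Matrix (Fin 3) (Fin 3) ℝ :=
  !![1, 0, b x;
     0, 0, 1;
     b x, 1, c x]

section Manifold
variable {M : Type*} [TopologicalSpace M] [ChartedSpace E3 M] [IsManifold (𝓡 3) ∞ M]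
  {W : WeylStructure M} {ε : ℝ} {p : M} {h : E3 → Matrix (Fin 3) (Fin 3) ℝ}
  {om : E3 → Fin 3 → ℝ} {a : E3}

/-- Since f = dT is closed, ω ∧ dT = 0 and ω = Y dT, where Y is independent of x. From dω = dY ∧ dT
≠ 0 it follows that Y and T are independent. In the coordinates (Y, X, T) the identity f = dT fixes
one column of the metric, and the determinant -1 fixes the coefficient of dy². -/
theorem Rep.ansatz_of_dual_exact (r : Rep W ε p h om a) (hε : ε ≠ 0) (hR : RicciSkewNear h om a)
    (hd : (h a).det < 0) (hv : curl om 1 a ≠ 0) {T : E3 → ℝ} (hT : SmoothNear T a)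
    (hT0 : pd 0 T a ≠ 0 ∨ pd 2 T a ≠ 0)
    (hn : ∀ᶠ x in 𝓝 a, om x 1 = 0 ∧ curl om 0 x = 0 ∧ curl om 2 x = 0 ∧ pd 1 T x = 0 ∧
        ∀ i, dualForm h om i x = pd i T x) :
    ∃ (b c : E3 → ℝ) (a : E3), SmoothNear b a ∧ SmoothNear c a ∧ Rep W ε p (ansatz b c) ydt a := by
  have w := r.weylNear hε
  have hdn : ∀ᶠ x in 𝓝 a, (h x).det < 0 :=
    (smoothNear_det w.smooth_h).continuousAt.eventually_lt_const hd
  have hqa : 0 < pd 0 T a ^ 2 + pd 2 T a ^ 2 := by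
    rcases hT0 with h' | h'
    · have := sq_nonneg (pd 2 T a); positivity
    · have := sq_nonneg (pd 0 T a); positivity
  have hqs : SmoothNear (fun x => pd 0 T x ^ 2 + pd 2 T x ^ 2) a :=
    ((hT.pd 0).pow 2).add ((hT.pd 2).pow 2)
  have hqn := hqs.continuousAt.eventually_ne hqa.ne'
  let Y : E3 → ℝ := fun x => (om x 0 * pd 0 T x + om x 2 * pd 2 T x)
    / (pd 0 T x ^ 2 + pd 2 T x ^ 2)
  have hY : SmoothNear Y a := (((w.smooth_form 0).mul (hT.pd 0)).add
    ((w.smooth_form 2).mul (hT.pd 2))).div hqs hqa.ne'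
  have hsymT : ∀ᶠ x in 𝓝 a, ∀ i j, pd i (pd j T) x = pd j (pd i T) x := by
    filter_upwards [hT.eventually] with x h1 i j using h1.pd_comm i j
  have hpT : ∀ᶠ x in 𝓝 a, ∀ i, pd 1 (pd i T) x = 0 := by
    filter_upwards [hsymT, eventually_eventually_nhds.2 hn] with x h1 h2 i
    rw [h1, pd_congr (g := fun _ => 0) (h2.mono fun z hz => hz.2.2.2.1), pd_const]
  have homY : ∀ᶠ x in 𝓝 a, ∀ i, om x i = Y x * pd i T x := by
    filter_upwards [w.eventually, hdn, eventually_eventually_nhds.2 hR,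
      eventually_eventually_nhds.2 hn, hsymT, hqn] with x h1 h2 h3 h4 h5 h6 i
    have hx := h4.self_of_nhds
    have e := h1.d_dualForm h3 h2 0 2
    rw [pd_congr (h4.mono fun z hz => hz.2.2.2.2 2), pd_congr (h4.mono fun z hz => hz.2.2.2.2 0),
      h5 0 2, hx.2.2.2.2, hx.2.2.2.2] at e
    fin_cases i
    · simp only [Y, Fin.zero_eta]
      field_simp
      linear_combination (2 * pd 2 T x) * e
    · simp only [Fin.mk_one]
      rw [hx.1, hx.2.2.2.1, mul_zero]
    · simp only [Y, Fin.reduceFinMk]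
      field_simp
      linear_combination (-2 * pd 0 T x) * e
  have hY1 : ∀ᶠ x in 𝓝 a, pd 1 Y x = 0 := by
    filter_upwards [eventually_eventually_nhds.2 hn, eventually_eventually_nhds.2 homY, hpT, hqn,
      hT.eventually, hY.eventually] with x h1 h2 h3 h4 h5 h6
    have hx := h1.self_of_nhds
    have z1 : ∀ i, pd i (fun z => om z 1) x = 0 := fun i => by
      rw [pd_congr (g := fun _ => 0) (h1.mono fun z hz => hz.1), pd_const]
    have e2 : pd 1 (fun z => om z 2) x - pd 2 (fun z => om z 1) x = 0 := hx.2.1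
    have e0 : pd 0 (fun z => om z 1) x - pd 1 (fun z => om z 0) x = 0 := hx.2.2.1
    rw [z1, pd_congr (h2.mono fun z hz => hz 2), pd_mul h6.diff (h5.pd 2).diff, h3] at e2
    rw [z1, pd_congr (h2.mono fun z hz => hz 0), pd_mul h6.diff (h5.pd 0).diff, h3] at e0
    have : pd 1 Y x * (pd 0 T x ^ 2 + pd 2 T x ^ 2) = 0 := by
      linear_combination (- pd 0 T x) * e0 + pd 2 T x * e2
    exact (mul_eq_zero.1 this).resolve_right h4
  have hcurl1 : ∀ᶠ x in 𝓝 a, curl om 1 x = pd 2 Y x * pd 0 T x - pd 0 Y x * pd 2 T x := by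
    filter_upwards [eventually_eventually_nhds.2 homY, hsymT, hT.eventually, hY.eventually]
      with x h2 h3 h5 h6
    show pd 2 (fun z => om z 0) x - pd 0 (fun z => om z 2) x = _
    rw [pd_congr (h2.mono fun z hz => hz 2), pd_congr (h2.mono fun z hz => hz 0),
      pd_mul h6.diff (h5.pd 2).diff, pd_mul h6.diff (h5.pd 0).diff, h3 0 2]
    ring
  -- the coordinate along the kernel of the Faraday form
  have hρs := w.smooth_invSqrtDet hd
  have hρ0 : ∀ᶠ x in 𝓝 a, invSqrtDet h x ≠ 0 := by
    filter_upwards [hdn] with x hx using inv_ne_zero (Real.sqrt_ne_zero'.2 (by linarith))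
  have hvn := (w.smooth_curl 1).continuousAt.eventually_ne hv
  -- This normalization of ∂_1 X gives the Jacobian determinant -1/ρ, where ρ is `invSqrtDet h`.
  -- Hence the new metric has determinant -1 and its column of index 1 is that of dt.
  obtain ⟨X, hX, hX1⟩ := exists_primitive ((hρs.mul (w.smooth_curl 1)).inv
    (mul_ne_zero hρ0.self_of_nhds hv)) 1
  let ψ : E3 → E3 := fun x => !₂[Y x, X x, T x]
  have hψ : SmoothNear ψ a := smoothNear_of_coord fun i => by
    fin_cases i
    exacts [hY, hX, hT]
  have hJ : ∀ x, jac ψ x = Matrix.of ![fun i => pd i Y x, fun i => pd i X x, fun i => pd i T x] := by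
    intro x
    ext b i
    fin_cases b <;> rfl
  have hdetJ : ∀ᶠ x in 𝓝 a, (jac ψ x).det = -(invSqrtDet h x)⁻¹ := by
    filter_upwards [hY1, hn, hX1, hcurl1, hρ0, hvn] with x h1 h2 h3 h4 h5 h6
    rw [hJ, Matrix.det_fin_three]
    simp only [Matrix.of_apply, Matrix.cons_val]
    rw [h1, h2.2.2.2.1, h3]
    field_simp
    rw [h4]
    ring
  have hdet : (jac ψ a).det ≠ 0 := by
    rw [hdetJ.self_of_nhds]
    exact neg_ne_zero.2 (inv_ne_zero hρ0.self_of_nhds)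
  obtain ⟨h', om', r', hh', ho'⟩ := r.exists_chart hψ hdet
  have w' := r'.weylNear hε
  have hmap := map_nhds_of_jac_det_ne_zero hψ hdet
  have hom' : ∀ᶠ y in 𝓝 (ψ a), ydt y = om' y := by
    rw [← hmap, Filter.eventually_map]
    filter_upwards [ho', homY, eventually_jac_det_ne_zero hψ hdet] with x h1 h2 h3
    refine eq_of_sum_mul_eq h3 fun i => ?_
    rw [← h1, h2, hJ]
    simp [Fin.sum_univ_three, ydt, ψ]
  have hcol : ∀ᶠ y in 𝓝 (ψ a), ∀ i, h' y i 1 = if i = 2 then 1 else 0 := by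
    rw [← hmap, Filter.eventually_map]
    filter_upwards [hh', hn, hY1, hX1, eventually_jac_det_ne_zero hψ hdet, hρ0, hvn]
      with x h1 h2 h3 h4 h5 h6 h7
    refine congrFun (eq_of_sum_mul_eq h5 fun i => ?_)
    have e := h2.2.2.2.2 i
    rw [dualForm] at e
    simp only [Fin.sum_univ_three, h2.2.1, h2.2.2.1, mul_zero, zero_add, add_zero] at e
    have e' : h x i 1 = pd i T x * pd 1 X x := by
      rw [h4, ← e]
      field_simp
    have e2 := congrFun (congrFun h1 i) 1
    have j1 : jac ψ x 0 1 = 0 := h3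
    have j2 : jac ψ x 2 1 = 0 := h2.2.2.2.1
    have j3 : jac ψ x 1 1 = pd 1 X x := rfl
    have j4 : jac ψ x 2 i = pd i T x := rfl
    have hX0 : pd 1 X x ≠ 0 := by
      rw [h4]; exact inv_ne_zero (mul_ne_zero h6 h7)
    simp only [Matrix.mul_apply, Matrix.transpose_apply, Fin.sum_univ_three, j1, j2, j3, mul_zero,
      zero_add, add_zero] at e2
    rw [e'] at e2
    have := mul_right_cancel₀ hX0 e2
    rw [j4] at this
    simp [Fin.sum_univ_three, j4]
    linarith
  have hdet' : ∀ᶠ y in 𝓝 (ψ a), (h' y).det = -1 := by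
    rw [← hmap, Filter.eventually_map]
    filter_upwards [hh', hdetJ, hdn, hρ0] with x h1 h2 h3 h4
    have e := congrArg Matrix.det h1
    rw [Matrix.det_mul, Matrix.det_mul, Matrix.det_transpose, h2, invSqrtDet, inv_inv] at e
    have hs : Real.sqrt (-(h x).det) * Real.sqrt (-(h x).det) = -(h x).det :=
      Real.mul_self_sqrt (by linarith)
    have : (h x).det * ((h' (ψ x)).det + 1) = 0 := by
      linear_combination e + (h' (ψ x)).det * hs
    have := (mul_eq_zero.1 this).resolve_left h3.ne
    linarith
  have hans : ∀ᶠ y in 𝓝 (ψ a), ansatz (fun y => h' y 0 2) (fun y => h' y 2 2) y = h' y := by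
    filter_upwards [hcol, hdet', w'.symm] with y h1 h2 h3
    have s : ∀ i j, h' y i j = h' y j i := fun i j => h3.apply j i
    have c0 := h1 0
    have c1 := h1 1
    have c2 := h1 2
    have c0' := s 1 0
    have c2' := s 1 2
    have c3 := s 2 0
    simp at c0 c1 c2
    rw [c0] at c0'
    rw [c2] at c2'
    rw [Matrix.det_fin_three, c0, c1, c2, c0', c2'] at h2
    ext i j
    fin_cases i <;> fin_cases j <;> simp [ansatz] <;> linarith
  exact ⟨_, _, _, w'.smooth_h 0 2, w'.smooth_h 2 2, r'.congr hans hom'⟩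

/-- Near a point where the curvature does not vanish, a scalar-flat Einstein–Weyl structure is
represented by `dy² + 2 dx dt + 2 b dy dt + c dt²` and the one-form `y dt`. -/
theorem Rep.exists_ansatz (r : Rep W ε p h om a) (hε : ε ≠ 0) (hEW : W.IsEinsteinWeyl)
    (hS : W.IsScalarFlat) (hd : (h a).det < 0) (hv : ¬ CurvZeroAt h om a) :
    ∃ (b c : E3 → ℝ) (a : E3), SmoothNear b a ∧ SmoothNear c a ∧ Rep W ε p (ansatz b c) ydt a := by
  have hv' : ∃ k, curl om k a ≠ 0 := by
    by_contra! hk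
    exact hv ((r.weylNear hε).curvZeroAt (r.ricciSkew hε hEW hS) hk)
  obtain ⟨h₁, om₁, a₁, r₁, hd₁, hv₁, hn₁⟩ := r.exists_straight_curl hε hd hv'
  obtain ⟨h₂, om₂, T, r₂, hd₂, hv₂, hT, hT0, hn₂⟩ :=
    r₁.exists_dual_exact hε (r₁.ricciSkew hε hEW hS) hd₁ hv₁ hn₁
  exact r₂.ansatz_of_dual_exact hε (r₂.ricciSkew hε hEW hS) hd₂ hv₂ hT hT0 hn₂

end Manifold

/-! ### The curvature of the adapted representative -/

theorem ansatz_inv (b c : E3 → ℝ) (x : E3) : (ansatz b c x)⁻¹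
    = !![1, -b x, 0; -b x, b x ^ 2 - c x, 1; 0, 1, 0] := by
  refine Matrix.inv_eq_right_inv ?_
  ext i j
  fin_cases i <;> fin_cases j <;> simp [ansatz, Matrix.mul_apply, Fin.sum_univ_three] <;> ring

theorem pd_ansatz (b c : E3 → ℝ) (x : E3) (m i j : Fin 3) : pd m (fun z => ansatz b c z i j) x
    = !![0, 0, pd m b x; 0, 0, 0; pd m b x, 0, pd m c x] i j := by
  fin_cases i <;> fin_cases j <;> first | exact pd_const _ | rfl

/-- The coefficients of the Weyl connection of `(ansatz b c, y dt)`. -/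
def ansatzConn (b c : E3 → ℝ) (k i j : Fin 3) (x : E3) : ℝ :=
  (![!![0, 0, (1 / 2) * (b x * pd 1 b x) - (1 / 2) * x 0;
        0, 0, (1 / 2) * pd 1 b x;
        (1 / 2) * (b x * pd 1 b x) - (1 / 2) * x 0, (1 / 2) * pd 1 b x,
          (1 / 2) * (b x * pd 1 c x) + pd 2 b x - (1 / 2) * pd 0 c x],
     !![pd 0 b x + (1 / 2) * x 0, (1 / 2) * pd 1 b x,
          (1 / 2) * (b x * x 0) - (1 / 2) * (b x * b x * pd 1 b x) + (1 / 2) * (pd 1 b x * c x)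
            + (1 / 2) * pd 0 c x;
        (1 / 2) * pd 1 b x, 0, (1 / 2) * pd 1 c x - (1 / 2) * (b x * pd 1 b x);
        (1 / 2) * (b x * x 0) - (1 / 2) * (b x * b x * pd 1 b x) + (1 / 2) * (pd 1 b x * c x)
            + (1 / 2) * pd 0 c x,
          (1 / 2) * pd 1 c x - (1 / 2) * (b x * pd 1 b x),
          (1 / 2) * (b x * pd 0 c x) - b x * pd 2 b x - (1 / 2) * (b x * b x * pd 1 c x)
            + (1 / 2) * (c x * pd 1 c x) + (1 / 2) * (c x * x 0) + (1 / 2) * pd 2 c x],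
     !![0, 0, -(1 / 2) * pd 1 b x;
        0, 0, 0;
        -(1 / 2) * pd 1 b x, 0, -(1 / 2) * pd 1 c x - x 0]] : Fin 3 → Matrix (Fin 3) (Fin 3) ℝ) k i j

theorem weylConn_ansatz (b c : E3 → ℝ) (k i j : Fin 3) :
    weylConn (ansatz b c) ydt k i j = ansatzConn b c k i j := by
  ext x
  simp only [weylConn, leviCivita, ansatz_inv, pd_ansatz, Fin.sum_univ_three]
  fin_cases k <;> fin_cases i <;> fin_cases j <;>
    simp [ansatz, ydt, ansatzConn] <;> ring

/-- `f` is differentiable at `x` with partial derivatives `d`. -/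
def HasPd (f : E3 → ℝ) (d : Fin 3 → ℝ) (x : E3) : Prop :=
  DifferentiableAt ℝ f x ∧ ∀ i, pd i f x = d i

section
variable {f g : E3 → ℝ} {d d' : Fin 3 → ℝ} {x : E3}

theorem HasPd.add (hf : HasPd f d x) (hg : HasPd g d' x) :
    HasPd (fun z => f z + g z) (fun i => d i + d' i) x :=
  ⟨hf.1.fun_add hg.1, fun i => by rw [pd_add hf.1 hg.1, hf.2, hg.2]⟩

theorem HasPd.sub (hf : HasPd f d x) (hg : HasPd g d' x) :
    HasPd (fun z => f z - g z) (fun i => d i - d' i) x :=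
  ⟨hf.1.fun_sub hg.1, fun i => by rw [pd_sub hf.1 hg.1, hf.2, hg.2]⟩

theorem HasPd.mul (hf : HasPd f d x) (hg : HasPd g d' x) :
    HasPd (fun z => f z * g z) (fun i => d i * g x + f x * d' i) x :=
  ⟨hf.1.fun_mul hg.1, fun i => by rw [pd_mul hf.1 hg.1, hf.2, hg.2]⟩

theorem HasPd.cmul (c : ℝ) (hf : HasPd f d x) : HasPd (fun z => c * f z) (fun i => c * d i) x :=
  ⟨hf.1.const_mul c, fun i => by rw [pd_const_mul c hf.1, hf.2]⟩

theorem hasPd_const (c : ℝ) : HasPd (fun _ => c) (fun _ => 0) x :=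
  ⟨differentiableAt_const c, fun _ => pd_const c⟩

theorem hasPd_coord (j : Fin 3) : HasPd (fun z => z j) (fun i => if j = i then 1 else 0) x :=
  ⟨(smoothNear_coord j).diff, fun i => pd_coord i j x⟩

theorem hasPd_pd (hf : ContDiffAt ℝ 2 f x) (j : Fin 3) :
    HasPd (pd j f) (fun i => pd i (pd j f) x) x :=
  ⟨(contDiffAt_pd (m := 1) hf (by norm_num) j).differentiableAt (by simp), fun _ => rfl⟩

theorem hasPd_self (hf : ContDiffAt ℝ 2 f x) : HasPd f (fun i => pd i f x) x :=
  ⟨hf.differentiableAt (by simp), fun _ => rfl⟩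

end

/-- The partial derivatives of the connection coefficients. -/
def ansatzConnDeriv (b c : E3 → ℝ) (x : E3) (m k i j : Fin 3) : ℝ :=
  let B := pd m b x
  let C := pd m c x
  let Bd := fun l => pd m (pd l b) x
  let Cd := fun l => pd m (pd l c) x
  let δ : ℝ := if (0 : Fin 3) = m then 1 else 0
  (![!![0, 0, (1 / 2) * (B * pd 1 b x + b x * Bd 1) - (1 / 2) * δ;
        0, 0, (1 / 2) * Bd 1;
        (1 / 2) * (B * pd 1 b x + b x * Bd 1) - (1 / 2) * δ, (1 / 2) * Bd 1,
          (1 / 2) * (B * pd 1 c x + b x * Cd 1) + Bd 2 - (1 / 2) * Cd 0],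
     !![Bd 0 + (1 / 2) * δ, (1 / 2) * Bd 1,
          (1 / 2) * (B * x 0 + b x * δ) - (1 / 2) * ((B * b x + b x * B) * pd 1 b x + b x * b x * Bd 1)
            + (1 / 2) * (Bd 1 * c x + pd 1 b x * C) + (1 / 2) * Cd 0;
        (1 / 2) * Bd 1, 0, (1 / 2) * Cd 1 - (1 / 2) * (B * pd 1 b x + b x * Bd 1);
        (1 / 2) * (B * x 0 + b x * δ) - (1 / 2) * ((B * b x + b x * B) * pd 1 b x + b x * b x * Bd 1)
            + (1 / 2) * (Bd 1 * c x + pd 1 b x * C) + (1 / 2) * Cd 0,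
          (1 / 2) * Cd 1 - (1 / 2) * (B * pd 1 b x + b x * Bd 1),
          (1 / 2) * (B * pd 0 c x + b x * Cd 0) - (B * pd 2 b x + b x * Bd 2)
            - (1 / 2) * ((B * b x + b x * B) * pd 1 c x + b x * b x * Cd 1)
            + (1 / 2) * (C * pd 1 c x + c x * Cd 1) + (1 / 2) * (C * x 0 + c x * δ) + (1 / 2) * Cd 2],
     !![0, 0, -(1 / 2) * Bd 1;
        0, 0, 0;
        -(1 / 2) * Bd 1, 0, -(1 / 2) * Cd 1 - δ]] : Fin 3 → Matrix (Fin 3) (Fin 3) ℝ) k i j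

theorem pd_ansatzConn {b c : E3 → ℝ} {x : E3} (hb : ContDiffAt ℝ 2 b x) (hc : ContDiffAt ℝ 2 c x)
    (m k i j : Fin 3) : pd m (ansatzConn b c k i j) x = ansatzConnDeriv b c x m k i j := by
  have b0 := hasPd_self hb
  have c0 := hasPd_self hc
  have bd := hasPd_pd hb
  have cd := hasPd_pd hc
  have y0 := hasPd_coord (x := x) 0
  have z0 := hasPd_const (x := x) 0
  have e002 := ((b0.mul (bd 1)).cmul (1 / 2)).sub (y0.cmul (1 / 2))
  have e012 := (bd 1).cmul (1 / 2)
  have e022 := (((b0.mul (cd 1)).cmul (1 / 2)).add (bd 2)).sub ((cd 0).cmul (1 / 2))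
  have e100 := (bd 0).add (y0.cmul (1 / 2))
  have e102 := ((((b0.mul y0).cmul (1 / 2)).sub (((b0.mul b0).mul (bd 1)).cmul (1 / 2))).add
    (((bd 1).mul c0).cmul (1 / 2))).add ((cd 0).cmul (1 / 2))
  have e112 := ((cd 1).cmul (1 / 2)).sub ((b0.mul (bd 1)).cmul (1 / 2))
  have e122 := ((((((b0.mul (cd 0)).cmul (1 / 2)).sub (b0.mul (bd 2))).sub
    (((b0.mul b0).mul (cd 1)).cmul (1 / 2))).add ((c0.mul (cd 1)).cmul (1 / 2))).add
    ((c0.mul y0).cmul (1 / 2))).add ((cd 2).cmul (1 / 2))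
  have e202 := (bd 1).cmul (-(1 / 2))
  have e222 := ((cd 1).cmul (-(1 / 2))).sub y0
  fin_cases k <;> fin_cases i <;> fin_cases j <;>
    first
    | exact z0.2 m | exact e002.2 m | exact e012.2 m | exact e022.2 m | exact e100.2 m
    | exact e102.2 m | exact e112.2 m | exact e122.2 m | exact e202.2 m | exact e222.2 m

theorem weylRicci_ansatz {b c : E3 → ℝ} {x : E3} (hb : ContDiffAt ℝ 2 b x)
    (hc : ContDiffAt ℝ 2 c x) (k j : Fin 3) : weylRicci (ansatz b c) ydt k j x
    = !![pd 0 (pd 1 b) x - (1 / 2) * pd 1 b x ^ 2, (1 / 2) * pd 1 (pd 1 b) x,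
          -(1 / 2) - (1 / 2) * b x * pd 1 b x ^ 2 + (1 / 2) * b x * pd 0 (pd 1 b) x
            - (1 / 2) * b x ^ 2 * pd 1 (pd 1 b) x + (1 / 4) * pd 1 b x * x 0
            - (1 / 2) * pd 1 (pd 2 b) x + (1 / 2) * c x * pd 1 (pd 1 b) x
            + (1 / 2) * pd 0 (pd 1 c) x;
        (1 / 2) * pd 1 (pd 1 b) x, 0,
          -(1 / 2) * b x * pd 1 (pd 1 b) x - (1 / 2) * pd 1 b x ^ 2 + (1 / 2) * pd 0 (pd 1 b) x
            + (1 / 2) * pd 1 (pd 1 c) x;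
        1 - (1 / 2) * b x * pd 1 b x ^ 2 + (1 / 2) * b x * pd 0 (pd 1 b) x
            - (1 / 2) * b x ^ 2 * pd 1 (pd 1 b) x + (1 / 4) * pd 1 b x * x 0
            - (1 / 2) * pd 1 (pd 2 b) x + (1 / 2) * c x * pd 1 (pd 1 b) x
            + (1 / 2) * pd 0 (pd 1 c) x,
          -(1 / 2) * b x * pd 1 (pd 1 b) x - (1 / 2) * pd 1 b x ^ 2 + (1 / 2) * pd 0 (pd 1 b) x
            + (1 / 2) * pd 1 (pd 1 c) x,
          -b x * pd 1 (pd 2 b) x + b x * pd 0 (pd 1 c) x - (1 / 2) * b x ^ 2 * pd 1 (pd 1 c) x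
            - (1 / 2) * pd 1 b x * pd 0 c x - (1 / 2) * pd 1 b x ^ 2 * c x
            + (1 / 2) * pd 0 b x * pd 1 c x + pd 0 (pd 2 b) x + (1 / 2) * c x * pd 1 (pd 1 c) x
            + (1 / 4) * pd 1 c x * x 0 - (1 / 2) * pd 0 (pd 0 c) x + (1 / 4) * x 0 ^ 2] k j := by
  have b1 := pd_comm hb 1 0
  have b2 := pd_comm hb 2 0
  have b3 := pd_comm hb 2 1
  have c1 := pd_comm hc 1 0
  have c2 := pd_comm hc 2 0
  have c3 := pd_comm hc 2 1
  simp only [weylRicci, weylCurv, weylConn_ansatz, pd_ansatzConn hb hc, Fin.sum_univ_three]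
  fin_cases k <;> fin_cases j <;>
    simp [ansatzConn, ansatzConnDeriv, b1, b2, b3, c1, c2, c3] <;> ring

/-- The field ℓ = ∂_t - b ∂_y - (1/2)(c - b²) ∂_x is null, orthogonal to ∂_y and pairs to 1 with the
null field ∂_x. The basis used is ∂_y, ℓ + ∂_x/2, ℓ - ∂_x/2. -/
theorem hasSignaturePPM_ansatz (b c : E3 → ℝ) (x : E3) : HasSignaturePPM (ansatz b c x) := by
  refine ⟨!![1, -b x, -b x; 0, 1 / 2 - (1 / 2) * (c x - b x ^ 2), -(1 / 2) - (1 / 2) * (c x - b x ^ 2);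
    0, 1, 1], ?_, ?_⟩
  · rw [Matrix.det_fin_three]
    simp
  · ext i j
    fin_cases i <;> fin_cases j <;>
      simp [ansatz, Matrix.mul_apply, Fin.sum_univ_three, Matrix.diagonal] <;> ring

theorem det_ansatz (b c : E3 → ℝ) (x : E3) : (ansatz b c x).det = -1 := by
  rw [Matrix.det_fin_three]
  simp [ansatz]

/-- The (y,t) and (t,y) entries of the Ricci tensor differ by the constant 3/2, whatever b and c
are, so they cannot both vanish. -/
theorem not_curvZeroAt_ansatz {b c : E3 → ℝ} {x : E3} (hb : ContDiffAt ℝ 2 b x)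
    (hc : ContDiffAt ℝ 2 c x) : ¬ CurvZeroAt (ansatz b c) ydt x := by
  intro h
  have h0 : ∀ k j, weylRicci (ansatz b c) ydt k j x = 0 := fun k j =>
    Finset.sum_eq_zero fun i _ => h i k i j
  have e1 := h0 0 2
  have e2 := h0 2 0
  rw [weylRicci_ansatz hb hc] at e1 e2
  simp at e1 e2
  linarith

/-- The components of F are constant and only F_{yt} is nonzero. The component D_t F_{xt} is a
multiple of b_x, whereas F_{xt} = 0, so recurrence forces b_x = 0. When b_x = 0 every D_i F is a
multiple of F. -/
theorem recurrentAt_ansatz_iff (b c : E3 → ℝ) (x : E3) :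
    RecurrentAt (ansatz b c) ydt x ↔ pd 1 b x = 0 := by
  have hF : ∀ j k z, faraday ydt j k z
      = (if j = 0 ∧ k = 2 then 1 / 2 else 0) - (if j = 2 ∧ k = 0 then 1 / 2 else 0) := by
    intro j k z
    have e : ∀ m i, pd m (fun z => ydt z i) z = if m = 0 ∧ i = 2 then 1 else 0 := by
      intro m i
      have e0 : pd m (fun _ : E3 => (0 : ℝ)) z = 0 := pd_const 0
      have e2 : pd m (fun z : E3 => z 0) z = if 0 = m then 1 else 0 := pd_coord m 0 z
      fin_cases i
      · simpa [ydt] using e0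
      · simpa [ydt] using e0
      · simpa [ydt, eq_comm] using e2
    rw [faraday, e, e]
    fin_cases j <;> fin_cases k <;> simp
    norm_num
  have hF' : ∀ i j k, pd i (faraday ydt j k) x = 0 := by
    intro i j k
    rw [show faraday ydt j k = fun _ => _ from funext (hF j k)]
    exact pd_const _
  constructor
  · rintro ⟨α, hα⟩
    have h := hα 2 1 2
    simp only [weylDFaraday, weylConn_ansatz, hF, hF', Fin.sum_univ_three] at h
    simp [ansatzConn] at h
    exact h
  · intro h
    refine ⟨fun i => - ansatzConn b c 0 i 0 x - ansatzConn b c 2 i 2 x, fun i j k => ?_⟩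
    simp only [weylDFaraday, weylConn_ansatz, hF, hF', Fin.sum_univ_three]
    fin_cases i <;> fin_cases j <;> fin_cases k <;> simp [ansatzConn, h] <;> ring

/-- The scalar-flat Einstein–Weyl equations for the adapted representative. -/
structure AnsatzEquations (b c : E3 → ℝ) (x : E3) : Prop where
  b_xx : pd 1 (pd 1 b) x = 0
  b_xy : pd 0 (pd 1 b) x = (1 / 2) * pd 1 b x ^ 2
  c_xx : pd 1 (pd 1 c) x = (1 / 2) * pd 1 b x ^ 2
  c_xy : pd 0 (pd 1 c) x = -(1 / 2) + (1 / 2) * b x * pd 1 b x ^ 2 - (1 / 2) * x 0 * pd 1 b x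
    + pd 1 (pd 2 b) x
  c_yy : (1 / 2) * pd 0 (pd 0 c) x = -b x * pd 1 (pd 2 b) x + b x * pd 0 (pd 1 c) x
    - (1 / 2) * b x ^ 2 * pd 1 (pd 1 c) x
    - (1 / 2) * pd 1 b x * pd 0 c x - (1 / 2) * pd 1 b x ^ 2 * c x
    + (1 / 2) * pd 0 b x * pd 1 c x + pd 0 (pd 2 b) x + (1 / 2) * c x * pd 1 (pd 1 c) x
    + (1 / 4) * pd 1 c x * x 0 + (1 / 4) * x 0 ^ 2

theorem ansatzEquations_iff {b c : E3 → ℝ} {x : E3} (hb : ContDiffAt ℝ 2 b x)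
    (hc : ContDiffAt ℝ 2 c x) : AnsatzEquations b c x ↔
      ∀ i j, weylRicci (ansatz b c) ydt i j x + weylRicci (ansatz b c) ydt j i x = 0 := by
  simp only [weylRicci_ansatz hb hc]
  constructor
  · rintro ⟨h1, h2, h3, h4, h5⟩ i j
    rw [h3, h4] at h5
    fin_cases i <;> fin_cases j <;> simp [h1, h2, h3, h4] <;> linarith
  · intro h
    have e1 := h 0 1
    have e2 := h 0 0
    have e3 := h 1 2
    have e4 := h 0 2
    have e5 := h 2 2
    simp at e1 e2 e3 e4 e5
    have h1 : pd 1 (pd 1 b) x = 0 := by linarith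
    have h2 : pd 0 (pd 1 b) x = (1 / 2) * pd 1 b x ^ 2 := by linarith
    rw [h1, h2] at e3 e4
    exact ⟨h1, h2, by linarith, by linarith, by linarith⟩

theorem einsteinWeyl_of_ansatzEquations {b c : E3 → ℝ} {x : E3} (hb : ContDiffAt ℝ 2 b x)
    (hc : ContDiffAt ℝ 2 c x) (h : AnsatzEquations b c x) :
    EWAt (ansatz b c) ydt x ∧ weylScalar (ansatz b c) ydt x = 0 := by
  have hs := (ansatzEquations_iff hb hc).1 h
  have h0 : weylScalar (ansatz b c) ydt x = 0 := by
    simp only [weylScalar, ansatz_inv, Fin.sum_univ_three]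
    simp
    linear_combination (1 / 2) * hs 0 0 - b x * hs 0 1 + hs 1 2 + (1 / 2) * (b x ^ 2 - c x) * hs 1 1
  refine ⟨fun i j => ?_, h0⟩
  rw [h0, hs]
  simp

theorem RicciSkewNear.ansatzEquations {b c : E3 → ℝ} {a : E3} (hb : SmoothNear b a)
    (hc : SmoothNear c a) (hR : RicciSkewNear (ansatz b c) ydt a) :
    ∀ᶠ x in 𝓝 a, AnsatzEquations b c x := by
  filter_upwards [hb, hc, hR] with x h1 h2 h3
  refine (ansatzEquations_iff (h1.of_le (by norm_cast)) (h2.of_le (by norm_cast))).2 fun i j => ?_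
  rw [h3 i j]

/-! ### The two families are solutions -/

theorem HasPd.inv {f : E3 → ℝ} {d : Fin 3 → ℝ} {x : E3} (hf : HasPd f d x) (h0 : f x ≠ 0) :
    HasPd (fun z => (f z)⁻¹) (fun i => -d i / f x ^ 2) x :=
  ⟨hf.1.fun_inv h0, fun i => by rw [pd_inv hf.1 h0, hf.2]⟩

theorem hasPd_comp_coord {R : ℝ → ℝ} {x : E3} {j : Fin 3} (hR : DifferentiableAt ℝ R (x j)) :
    HasPd (fun z => R (z j)) (fun i => deriv R (x j) * if j = i then 1 else 0) x :=
  ⟨DifferentiableAt.comp (g := R) x hR (smoothNear_coord j).diff, fun i => by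
    rw [pd_comp_real (f := fun z : E3 => z j) hR.hasDerivAt (smoothNear_coord j).diff, pd_coord]⟩

theorem HasPd.congr {f g : E3 → ℝ} {d : Fin 3 → ℝ} {x : E3} (hf : HasPd f d x)
    (h : g =ᶠ[𝓝 x] f) : HasPd g d x :=
  ⟨hf.1.congr_of_eventuallyEq h, fun i => by rw [pd_congr h, hf.2]⟩

/-- The coefficient of `dt²` in the first family. -/
def coeff₁ (R S : ℝ → ℝ) (p : E3) : ℝ :=
  p 1 * (R (p 2) - p 0 / 2) + (1 / 48) * p 0 ^ 4 + (1 / 12) * R (p 2) * p 0 ^ 3 + S (p 2) * p 0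

/-- The coefficient of `dt²` in the second family. -/
def coeff₂ (R S : ℝ → ℝ) (p : E3) : ℝ :=
  p 1 ^ 2 / p 0 ^ 2 + p 1 * p 0 / 2 + (1 / 8) * p 0 ^ 4 + R (p 2) * p 0 ^ 2 + S (p 2) * p 0

theorem h₁_eq (R S : ℝ → ℝ) : h₁ R S = ansatz (fun _ => 0) (coeff₁ R S) := rfl

theorem h₂_eq (R S : ℝ → ℝ) : h₂ R S = ansatz (fun p => -2 * p 1 / p 0) (coeff₂ R S) := rfl

theorem contDiffAt_coord {n : WithTop ℕ∞} (j : Fin 3) (x : E3) :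
    ContDiffAt ℝ n (fun z : E3 => z j) x := (EuclideanSpace.proj j : E3 →L[ℝ] ℝ).contDiff.contDiffAt

theorem contDiffAt_comp_coord {n : WithTop ℕ∞} {R : ℝ → ℝ} {j : Fin 3} {x : E3}
    (hR : ContDiffAt ℝ n R (x j)) : ContDiffAt ℝ n (fun z : E3 => R (z j)) x :=
  ContDiffAt.comp (g := R) x hR (contDiffAt_coord j x)

theorem contDiffAt_coeff₁ {n : WithTop ℕ∞} {R S : ℝ → ℝ} {x : E3} (hR : ContDiffAt ℝ n R (x 2))
    (hS : ContDiffAt ℝ n S (x 2)) : ContDiffAt ℝ n (coeff₁ R S) x := by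
  have r := contDiffAt_comp_coord hR
  have s := contDiffAt_comp_coord hS
  have y : ContDiffAt ℝ n (fun z : E3 => z 0) x := contDiffAt_coord 0 x
  have u : ContDiffAt ℝ n (fun z : E3 => z 1) x := contDiffAt_coord 1 x
  exact (((u.mul (r.sub (y.div_const 2))).add (contDiffAt_const.mul (y.pow 4))).add
    ((contDiffAt_const.mul r).mul (y.pow 3))).add (s.mul y)

theorem contDiffAt_shift₂ {n : WithTop ℕ∞} {x : E3} (h0 : x 0 ≠ 0) :
    ContDiffAt ℝ n (fun p : E3 => -2 * p 1 / p 0) x :=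
  (contDiffAt_const.mul (contDiffAt_coord 1 x)).div (contDiffAt_coord 0 x) h0

theorem contDiffAt_coeff₂ {n : WithTop ℕ∞} {R S : ℝ → ℝ} {x : E3} (hR : ContDiffAt ℝ n R (x 2))
    (hS : ContDiffAt ℝ n S (x 2)) (h0 : x 0 ≠ 0) : ContDiffAt ℝ n (coeff₂ R S) x := by
  have r := contDiffAt_comp_coord hR
  have s := contDiffAt_comp_coord hS
  have y : ContDiffAt ℝ n (fun z : E3 => z 0) x := contDiffAt_coord 0 x
  have u : ContDiffAt ℝ n (fun z : E3 => z 1) x := contDiffAt_coord 1 x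
  exact (((((u.pow 2).div (y.pow 2) (pow_ne_zero 2 h0)).add ((u.mul y).div_const 2)).add
    (contDiffAt_const.mul (y.pow 4))).add (r.mul (y.pow 2))).add (s.mul y)

theorem ansatzEquations_h₁ {R S : ℝ → ℝ} {x : E3} (hR : ∀ᶠ t in 𝓝 (x 2), DifferentiableAt ℝ R t)
    (hS : ∀ᶠ t in 𝓝 (x 2), DifferentiableAt ℝ S t) :
    AnsatzEquations (fun _ => 0) (coeff₁ R S) x := by
  have ht : Filter.Tendsto (fun z : E3 => z 2) (𝓝 x) (𝓝 (x 2)) :=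
    (smoothNear_coord 2).continuousAt.tendsto
  have y (z : E3) := hasPd_coord (x := z) 0
  have u (z : E3) := hasPd_coord (x := z) 1
  -- The first derivatives are needed on a neighbourhood because they are differentiated again. No
  -- second derivative of R or S in t occurs.
  have e1 : ∀ᶠ z in 𝓝 x, pd 1 (coeff₁ R S) z = R (z 2) - (1 / 2) * z 0 ∧
      pd 0 (coeff₁ R S) z = -(1 / 2) * z 1 + (1 / 12) * (z 0 * (z 0 * z 0))
        + (1 / 4) * (R (z 2) * (z 0 * z 0)) + S (z 2) := by
    filter_upwards [ht.eventually hR, ht.eventually hS] with z h1 h2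
    have r := hasPd_comp_coord h1
    have s := hasPd_comp_coord h2
    have e := (((((u z).mul (r.sub ((y z).cmul (1 / 2)))).add
      ((((y z).mul (y z)).mul ((y z).mul (y z))).cmul (1 / 48))).add
      ((r.mul (((y z).mul (y z)).mul (y z))).cmul (1 / 12))).add (s.mul (y z))).congr
      (g := coeff₁ R S) (Filter.Eventually.of_forall fun p => by simp only [coeff₁]; ring)
    constructor
    · rw [e.2]; simp
    · rw [e.2]; simp; ring
  have hr := hasPd_comp_coord hR.self_of_nhds
  have hs := hasPd_comp_coord hS.self_of_nhds
  have d1 := hr.sub ((y x).cmul (1 / 2))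
  have d0 := ((((u x).cmul (-(1 / 2))).add (((y x).mul ((y x).mul (y x))).cmul (1 / 12))).add
    ((hr.mul ((y x).mul (y x))).cmul (1 / 4))).add hs
  have p1 := fun i => (pd_congr (e1.mono fun z hz => hz.1) i).trans (d1.2 i)
  have p0 := fun i => (pd_congr (e1.mono fun z hz => hz.2) i).trans (d0.2 i)
  have z1 : ∀ i, pd i (fun _ : E3 => (0 : ℝ)) = fun _ => 0 := fun i => funext fun z => pd_const 0
  constructor
  · simp [z1]
  · simp [z1]
  · simp [z1, p1]
  · simp [z1, p1]
  · rw [p0, p1, p1, e1.self_of_nhds.1]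
    simp [z1]
    ring

theorem ansatzEquations_h₂ {R S : ℝ → ℝ} {x : E3} (hR : ∀ᶠ t in 𝓝 (x 2), DifferentiableAt ℝ R t)
    (hS : ∀ᶠ t in 𝓝 (x 2), DifferentiableAt ℝ S t) (h0 : x 0 ≠ 0) :
    AnsatzEquations (fun p => -2 * p 1 / p 0) (coeff₂ R S) x := by
  have ht : Filter.Tendsto (fun z : E3 => z 2) (𝓝 x) (𝓝 (x 2)) :=
    (smoothNear_coord 2).continuousAt.tendsto
  have h0n : ∀ᶠ z : E3 in 𝓝 x, z 0 ≠ 0 := (smoothNear_coord 0).continuousAt.eventually_ne h0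
  have y (z : E3) := hasPd_coord (x := z) 0
  have u (z : E3) := hasPd_coord (x := z) 1
  have b1 : ∀ᶠ z in 𝓝 x, ∀ i, pd i (fun p : E3 => -2 * p 1 / p 0) z
      = -2 * ((if 1 = i then 1 else 0) * (z 0)⁻¹)
        + 2 * (z 1 * ((z 0)⁻¹ * (z 0)⁻¹)) * (if 0 = i then 1 else 0) := by
    filter_upwards [h0n] with z hz i
    have e := (((u z).mul ((y z).inv hz)).cmul (-2)).congr (g := fun p : E3 => -2 * p 1 / p 0)
      (Filter.Eventually.of_forall fun p => by ring)
    rw [e.2]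
    field_simp
    ring
  have e1 : ∀ᶠ z in 𝓝 x,
      pd 1 (coeff₂ R S) z = 2 * (z 1 * ((z 0)⁻¹ * (z 0)⁻¹)) + (1 / 2) * z 0 ∧
      pd 0 (coeff₂ R S) z = -2 * ((z 1 * z 1) * ((z 0)⁻¹ * ((z 0)⁻¹ * (z 0)⁻¹))) + (1 / 2) * z 1
        + (1 / 2) * (z 0 * (z 0 * z 0)) + 2 * (R (z 2) * z 0) + S (z 2) := by
    filter_upwards [ht.eventually hR, ht.eventually hS, h0n] with z h1 h2 hz
    have r := hasPd_comp_coord h1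
    have s := hasPd_comp_coord h2
    have v := (y z).inv hz
    have e := (((((((u z).mul (u z)).mul (v.mul v)).add (((u z).mul (y z)).cmul (1 / 2))).add
      ((((y z).mul (y z)).mul ((y z).mul (y z))).cmul (1 / 8))).add
      (r.mul ((y z).mul (y z)))).add (s.mul (y z))).congr
      (g := coeff₂ R S) (Filter.Eventually.of_forall fun p => by
        simp only [coeff₂]; ring)
    constructor
    · rw [e.2]; simp; ring
    · rw [e.2]; simp; field_simp; ring
  have hr := hasPd_comp_coord hR.self_of_nhds
  have hs := hasPd_comp_coord hS.self_of_nhds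
  have v := (y x).inv h0
  have d1 := (((u x).mul (v.mul v)).cmul 2).add ((y x).cmul (1 / 2))
  have d0 := ((((((((u x).mul (u x)).mul (v.mul (v.mul v))).cmul (-2)).add
    ((u x).cmul (1 / 2))).add (((y x).mul ((y x).mul (y x))).cmul (1 / 2))).add
    ((hr.mul (y x)).cmul 2)).add hs)
  have p1 := fun i => (pd_congr (e1.mono fun z hz => hz.1) i).trans (d1.2 i)
  have p0 := fun i => (pd_congr (e1.mono fun z hz => hz.2) i).trans (d0.2 i)
  have pb1 := fun i => (pd_congr (b1.mono fun z hz => hz 1) i).trans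
    (((((hasPd_const (if (1 : Fin 3) = 1 then 1 else 0)).mul v).cmul (-2)).add
      ((((u x).mul (v.mul v)).cmul 2).mul (hasPd_const (if (0 : Fin 3) = 1 then 1 else 0)))).2 i)
  have pb2 := fun i => (pd_congr (b1.mono fun z hz => hz 2) i).trans
    (((((hasPd_const (if (1 : Fin 3) = 2 then 1 else 0)).mul v).cmul (-2)).add
      ((((u x).mul (v.mul v)).cmul 2).mul (hasPd_const (if (0 : Fin 3) = 2 then 1 else 0)))).2 i)
  have bx := b1.self_of_nhds
  have cx := e1.self_of_nhds
  constructor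
  · rw [pb1]; simp
  · rw [pb1, bx]; simp; field_simp
  · rw [p1, bx]; simp; field_simp
  · rw [p1, pb2, bx]; simp; field_simp; ring
  · rw [p0, p1, p1, pb2, pb2, bx, bx, cx.1, cx.2]
    simp only [coeff₂]
    simp
    field_simp
    ring

theorem isWeylOn_ansatz {n : WithTop ℕ∞} {U : Set E3} {b c : E3 → ℝ}
    (hb : ∀ x ∈ U, ContDiffAt ℝ n b x) (hc : ∀ x ∈ U, ContDiffAt ℝ n c x) :
    IsWeylOn n U (ansatz b c) ydt := by
  refine ⟨fun x _ => ?_, fun x _ => by rw [det_ansatz]; norm_num, fun i j x hx => ?_,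
    fun i x hx => ?_⟩
  · ext i j
    fin_cases i <;> fin_cases j <;> rfl
  · have h0 := (contDiffAt_const (c := (0 : ℝ)) : ContDiffAt ℝ n (fun _ : E3 => (0 : ℝ)) x)
    have h1 := (contDiffAt_const (c := (1 : ℝ)) : ContDiffAt ℝ n (fun _ : E3 => (1 : ℝ)) x)
    refine ContDiffAt.contDiffWithinAt ?_
    fin_cases i <;> fin_cases j <;> first | exact h0 | exact h1 | exact hb x hx | exact hc x hx
  · have h0 := (contDiffAt_const (c := (0 : ℝ)) : ContDiffAt ℝ n (fun _ : E3 => (0 : ℝ)) x)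
    refine ContDiffAt.contDiffWithinAt ?_
    fin_cases i <;> first | exact h0 | exact contDiffAt_coord 0 x

theorem eventually_differentiableAt {R : ℝ → ℝ} {t : ℝ} (hR : ContDiffAt ℝ 2 R t) :
    ∀ᶠ s in 𝓝 t, DifferentiableAt ℝ R s := by
  filter_upwards [hR.eventually (by simp)] with s hs using hs.differentiableAt (by simp)

/-- Both families are nonflat scalar-flat Einstein–Weyl structures. -/
theorem families_are_solutions (J : Set ℝ) (R S : ℝ → ℝ) (hJ : IsOpen J) (hR : ContDiffOn ℝ 2 R J)
    (hS : ContDiffOn ℝ 2 S J) :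
    (IsWeylOn 2 {p : E3 | p 2 ∈ J} (h₁ R S) ydt ∧
      ∀ p : E3, p 2 ∈ J → HasSignaturePPM (h₁ R S p) ∧ EWAt (h₁ R S) ydt p ∧
        weylScalar (h₁ R S) ydt p = 0 ∧ ¬ CurvZeroAt (h₁ R S) ydt p) ∧
    (IsWeylOn 2 {p : E3 | p 2 ∈ J ∧ p 0 ≠ 0} (h₂ R S) ydt ∧
      ∀ p : E3, p 2 ∈ J → p 0 ≠ 0 → HasSignaturePPM (h₂ R S p) ∧ EWAt (h₂ R S) ydt p ∧
        weylScalar (h₂ R S) ydt p = 0 ∧ ¬ CurvZeroAt (h₂ R S) ydt p) := by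
  have r : ∀ t ∈ J, ContDiffAt ℝ 2 R t := fun t ht => hR.contDiffAt (hJ.mem_nhds ht)
  have s : ∀ t ∈ J, ContDiffAt ℝ 2 S t := fun t ht => hS.contDiffAt (hJ.mem_nhds ht)
  simp only [h₁_eq, h₂_eq]
  refine ⟨⟨isWeylOn_ansatz (fun x _ => contDiffAt_const)
    fun x hx => contDiffAt_coeff₁ (r _ hx) (s _ hx), fun p hp => ?_⟩,
    isWeylOn_ansatz (fun x hx => contDiffAt_shift₂ hx.2)
      fun x hx => contDiffAt_coeff₂ (r _ hx.1) (s _ hx.1) hx.2, fun p hp h0 => ?_⟩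
  · have hc := contDiffAt_coeff₁ (r _ hp) (s _ hp)
    have e := einsteinWeyl_of_ansatzEquations contDiffAt_const hc (ansatzEquations_h₁
      (eventually_differentiableAt (r _ hp)) (eventually_differentiableAt (s _ hp)))
    exact ⟨hasSignaturePPM_ansatz _ _ _, e.1, e.2, not_curvZeroAt_ansatz contDiffAt_const hc⟩
  · have hc := contDiffAt_coeff₂ (r _ hp) (s _ hp) h0
    have e := einsteinWeyl_of_ansatzEquations (contDiffAt_shift₂ h0) hc (ansatzEquations_h₂
      (eventually_differentiableAt (r _ hp)) (eventually_differentiableAt (s _ hp)) h0)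
    exact ⟨hasSignaturePPM_ansatz _ _ _, e.1, e.2, not_curvZeroAt_ansatz (contDiffAt_shift₂ h0) hc⟩

/-! ### Changes of coordinates preserving the adapted form -/

theorem exists_primitive_real {k : ℝ → ℝ} (hk : ContDiff ℝ ∞ k) :
    ∃ K : ℝ → ℝ, ContDiff ℝ ∞ K ∧ ∀ t, HasDerivAt K (k t) t := by
  have hd : ∀ t, HasDerivAt (fun t => ∫ s in (0 : ℝ)..t, k s) (k t) t := fun t =>
    intervalIntegral.integral_hasDerivAt_right (hk.continuous.intervalIntegrable _ _)
      hk.continuous.stronglyMeasurable.stronglyMeasurableAtFilter hk.continuous.continuousAt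
  refine ⟨_, contDiff_infty_iff_deriv.2 ⟨fun t => (hd t).differentiableAt, ?_⟩, hd⟩
  rwa [show deriv (fun t => ∫ s in (0 : ℝ)..t, k s) = k from funext fun t => (hd t).deriv]

/-- A primitive in the direction of `y` that does not depend on `x`. -/
theorem exists_planar_primitive {g : E3 → ℝ} {a : E3} (hg : SmoothNear g a)
    (h1 : ∀ᶠ x in 𝓝 a, pd 1 g x = 0) :
    ∃ G : E3 → ℝ, SmoothNear G a ∧ (∀ᶠ x in 𝓝 a, pd 1 G x = 0) ∧ ∀ᶠ x in 𝓝 a, pd 0 G x = g x := by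
  obtain ⟨G, hG, hGg⟩ := exists_primitive hg 0
  have hfa : freeze 1 (a 1) a = a := freeze_self 1 a
  have hcf := contDiff_freeze 1 (a 1)
  have htend : Filter.Tendsto (freeze 1 (a 1)) (𝓝 a) (𝓝 a) := by
    have := hcf.continuous.tendsto a
    rwa [hfa] at this
  have hpd : ∀ᶠ x in 𝓝 a, ∀ j, pd j (fun z => G (freeze 1 (a 1) z)) x
      = if j = 1 then 0 else pd j G (freeze 1 (a 1) x) := by
    filter_upwards [htend.eventually hG.eventually] with x hx j
    rw [pd_comp hx.diff (hcf.differentiable (by simp) x)]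
    simp only [jac_freeze, Fin.sum_univ_three]
    fin_cases j <;> simp
  refine ⟨fun z => G (freeze 1 (a 1) z), ?_, ?_, ?_⟩
  · refine SmoothNear.comp (u := G) ?_ (smoothNear_of_contDiff hcf a)
    rwa [hfa]
  · filter_upwards [hpd] with x hx
    rw [hx]; simp
  · filter_upwards [hpd, htend.eventually hGg, eventually_eq_freeze hg h1] with x hx h2 h3
    rw [hx, h3, ← h2]; simp

theorem SmoothNear.hasPd {f : E3 → ℝ} {a : E3} (hf : SmoothNear f a) :
    ∀ᶠ x in 𝓝 a, HasPd f (fun i => EinsteinWeyl.pd i f x) x := by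
  filter_upwards [hf.eventually] with x hx using ⟨hx.diff, fun _ => rfl⟩

theorem smoothNear_comp_coord {R : ℝ → ℝ} (hR : ContDiff ℝ ∞ R) (j : Fin 3) (a : E3) :
    SmoothNear (fun z : E3 => R (z j)) a :=
  SmoothNear.comp (u := R) (smoothNear_of_contDiff hR _) (smoothNear_coord j)

theorem hasPd_comp_coord_of_contDiff {R : ℝ → ℝ} (hR : ContDiff ℝ ∞ R) (j : Fin 3) (x : E3) :
    HasPd (fun z => R (z j)) (fun i => deriv R (x j) * if j = i then 1 else 0) x :=
  hasPd_comp_coord (hR.differentiable (by simp) _)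

section Manifold
variable {M : Type*} [TopologicalSpace M] [ChartedSpace E3 M] [IsManifold (𝓡 3) ∞ M]
  {W : WeylStructure M} {ε : ℝ} {p : M} {h : E3 → Matrix (Fin 3) (Fin 3) ℝ}
  {om : E3 → Fin 3 → ℝ} {a : E3} {b c : E3 → ℝ}

/-- For a coordinate change within the adapted class it is enough to know the new coefficients as
functions `B`, `C` of the old coordinates. The Jacobian is invertible, so the congruence determines
the new metric. -/
theorem Rep.ansatz_chart (r : Rep W ε p h om a) (hε : ε ≠ 0) {ψ : E3 → E3} (hψ : SmoothNear ψ a)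
    (hdet : (jac ψ a).det ≠ 0) {B C : E3 → ℝ}
    (hh : ∀ᶠ x in 𝓝 a, h x = (jac ψ x).transpose * ansatz B C x * jac ψ x)
    (ho : ∀ᶠ x in 𝓝 a, ∀ i, om x i = ψ x 0 * jac ψ x 2 i) :
    ∃ b' c' : E3 → ℝ, SmoothNear b' (ψ a) ∧ SmoothNear c' (ψ a) ∧
      Rep W ε p (ansatz b' c') ydt (ψ a) ∧ (∀ᶠ x in 𝓝 a, b' (ψ x) = B x) ∧
      ∀ᶠ x in 𝓝 a, c' (ψ x) = C x := by
  obtain ⟨h', om', r', hh', ho'⟩ := r.exists_chart hψ hdet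
  have w' := r'.weylNear hε
  have hmap := map_nhds_of_jac_det_ne_zero hψ hdet
  have hJ := eventually_jac_det_ne_zero hψ hdet
  have e : ∀ᶠ x in 𝓝 a, h' (ψ x) = ansatz B C x := by
    filter_upwards [hh, hh', hJ] with x h1 h2 h3 using eq_of_congruence h3 (h2.symm.trans h1)
  have hans : ∀ᶠ y in 𝓝 (ψ a), ansatz (fun y => h' y 0 2) (fun y => h' y 2 2) y = h' y := by
    rw [← hmap, Filter.eventually_map]
    filter_upwards [e] with x hx
    simp only [ansatz, hx]
    rfl
  have hom : ∀ᶠ y in 𝓝 (ψ a), ydt y = om' y := by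
    rw [← hmap, Filter.eventually_map]
    filter_upwards [ho, ho', hJ] with x h1 h2 h3
    refine eq_of_sum_mul_eq h3 fun i => ?_
    rw [← h2, h1]
    simp [Fin.sum_univ_three, ydt]
  refine ⟨_, _, w'.smooth_h 0 2, w'.smooth_h 2 2, r'.congr hans hom, ?_, ?_⟩ <;>
  · filter_upwards [e] with x hx
    rw [hx]
    rfl

/-- The shift `x ↦ x - g` with a function `g` of the other coordinates. -/
def shift (g : E3 → ℝ) (x : E3) : E3 := !₂[x 0, x 1 - g x, x 2]

omit [IsManifold (𝓡 3) ∞ M] in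
theorem Rep.ansatzEquations (r : Rep W ε p (ansatz b c) ydt a) (hε : ε ≠ 0)
    (hEW : W.IsEinsteinWeyl) (hS : W.IsScalarFlat) (hb : SmoothNear b a) (hc : SmoothNear c a) :
    ∀ᶠ x in 𝓝 a, AnsatzEquations b c x :=
  (r.ricciSkew hε hEW hS).ansatzEquations hb hc

theorem jac_shift {g : E3 → ℝ} {x : E3} (hg : DifferentiableAt ℝ g x) (h1 : pd 1 g x = 0) :
    jac (shift g) x = !![1, 0, 0; -pd 0 g x, 1, -pd 2 g x; 0, 0, 1] := by
  ext i j
  rw [jac_apply]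
  have e1 : ∀ k, pd k (fun z : E3 => z 1 - g z) x = (if 1 = k then 1 else 0) - pd k g x := fun k => by
    rw [pd_sub (smoothNear_coord 1).diff hg, pd_coord]
  fin_cases i
  · show pd j (fun z : E3 => z 0) x = _
    rw [pd_coord]
    fin_cases j <;> simp
  · show pd j (fun z : E3 => z 1 - g z) x = _
    rw [e1]
    fin_cases j <;> simp [h1]
  · show pd j (fun z : E3 => z 2) x = _
    rw [pd_coord]
    fin_cases j <;> simp

theorem smoothNear_shift {g : E3 → ℝ} (hg : SmoothNear g a) : SmoothNear (shift g) a :=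
  smoothNear_of_coord fun i => by
    fin_cases i
    exacts [smoothNear_coord 0, (smoothNear_coord 1).sub hg, smoothNear_coord 2]

theorem map_nhds_shift {g : E3 → ℝ} (hg : SmoothNear g a) (h1 : pd 1 g a = 0) :
    Filter.map (shift g) (𝓝 a) = 𝓝 (shift g a) :=
  map_nhds_of_jac_det_ne_zero (smoothNear_shift hg) (by
    rw [jac_shift hg.diff h1, Matrix.det_fin_three]
    simp)

/-- If x = x' + g(y,t), then 2 dx dt = 2 dx' dt + 2 g_y dy dt + 2 g_t dt², while y dt is unchanged.
-/
theorem Rep.exists_shift (r : Rep W ε p (ansatz b c) ydt a) (hε : ε ≠ 0) {g : E3 → ℝ}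
    (hg : SmoothNear g a) (h1 : ∀ᶠ x in 𝓝 a, pd 1 g x = 0) :
    ∃ b' c' : E3 → ℝ, SmoothNear b' (shift g a) ∧ SmoothNear c' (shift g a) ∧
      Rep W ε p (ansatz b' c') ydt (shift g a) ∧
      (∀ᶠ x in 𝓝 a, b' (shift g x) = b x + pd 0 g x) ∧
      ∀ᶠ x in 𝓝 a, c' (shift g x) = c x + 2 * pd 2 g x := by
  refine r.ansatz_chart hε (smoothNear_shift hg) ?_ (B := fun x => b x + pd 0 g x)
    (C := fun x => c x + 2 * pd 2 g x) ?_ ?_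
  · rw [jac_shift hg.diff h1.self_of_nhds, Matrix.det_fin_three]
    simp
  · filter_upwards [hg.eventually, h1] with x h2 h3
    rw [jac_shift h2.diff h3]
    ext i j
    fin_cases i <;> fin_cases j <;>
      simp [ansatz, Matrix.mul_apply, Fin.sum_univ_three] <;> ring
  · filter_upwards [hg.eventually, h1] with x h2 h3 i
    rw [jac_shift h2.diff h3]
    fin_cases i <;> simp [ydt, shift]

end Manifold

/-! ### The normal form when ∂b/∂x = 0 -/

theorem eventually_hasPd_pd {f : E3 → ℝ} {a : E3} (hf : SmoothNear f a) :
    ∀ᶠ x in 𝓝 a, ∀ j, HasPd (pd j f) (fun i => pd i (pd j f) x) x := by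
  filter_upwards [hf.eventually] with x hx j using ⟨(hx.pd j).diff, fun _ => rfl⟩

/-- Integration of the equations for the coefficient of `dt²` in the first family. -/
theorem exists_coeff₁ {c : E3 → ℝ} {a : E3} (hc : SmoothNear c a)
    (h11 : ∀ᶠ x in 𝓝 a, pd 1 (pd 1 c) x = 0) (h01 : ∀ᶠ x in 𝓝 a, pd 0 (pd 1 c) x = -(1 / 2))
    (h00 : ∀ᶠ x in 𝓝 a, pd 0 (pd 0 c) x = (1 / 2) * (pd 1 c x * x 0) + (1 / 2) * x 0 ^ 2) :
    ∃ R S K : ℝ → ℝ, ContDiff ℝ ∞ R ∧ ContDiff ℝ ∞ S ∧ ContDiff ℝ ∞ K ∧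
      ∀ᶠ x in 𝓝 a, c x = coeff₁ R S x + K (x 2) := by
  have sy : SmoothNear (fun z : E3 => z 0) a := smoothNear_coord 0
  have sx : SmoothNear (fun z : E3 => z 1) a := smoothNear_coord 1
  have cst : ∀ k : ℝ, SmoothNear (fun _ : E3 => k) a := fun k => SmoothNear.const k
  have y (z : E3) := hasPd_coord (x := z) 0
  have u (z : E3) := hasPd_coord (x := z) 1
  -- The first two equations say that c_x + y/2 depends on t only. This function is R.
  have sR : SmoothNear (fun z => pd 1 c z + (1 / 2) * z 0) a := (hc.pd 1).add ((cst _).mul sy)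
  have eR : ∀ᶠ x in 𝓝 a, ∀ i, pd i (fun z => pd 1 c z + (1 / 2) * z 0) x
      = pd i (pd 1 c) x + (1 / 2) * if 0 = i then 1 else 0 := by
    filter_upwards [eventually_hasPd_pd hc] with x hx i
    exact ((hx 1).add ((y x).cmul (1 / 2))).2 i
  obtain ⟨R, hR, hRc⟩ := exists_eq_comp_coord_two sR
    (by filter_upwards [eR, h01] with x h1 h2; rw [h1, h2]; simp)
    (by filter_upwards [eR, h11] with x h1 h2; rw [h1, h2]; simp)
  have sRt := smoothNear_comp_coord hR 2 a
  have rR := hasPd_comp_coord_of_contDiff hR 2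
  -- the terms of degree one in `x` and the particular solution are subtracted
  let c₁ : E3 → ℝ := fun z => pd 0 c z + (1 / 2) * z 1 - (1 / 4) * (R (z 2) * (z 0 * z 0))
    - (1 / 12) * (z 0 * (z 0 * z 0))
  have s₁ : SmoothNear c₁ a := (((hc.pd 0).add ((cst _).mul sx)).sub
    ((cst _).mul (sRt.mul (sy.mul sy)))).sub ((cst _).mul (sy.mul (sy.mul sy)))
  have e₁ : ∀ᶠ x in 𝓝 a, pd 0 c₁ x = 0 ∧ pd 1 c₁ x = 0 := by
    filter_upwards [eventually_hasPd_pd hc, h01, h00, hRc, hc.eventually] with x hx h1 h2 h3 h4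
    have e := ((((hx 0).add ((u x).cmul (1 / 2))).sub
      (((rR x).mul ((y x).mul (y x))).cmul (1 / 4))).sub
      (((y x).mul ((y x).mul (y x))).cmul (1 / 12)))
    have h5 : pd 1 c x = R (x 2) - (1 / 2) * x 0 := by linarith
    have h6 : pd 1 (pd 0 c) x = -(1 / 2) := by rw [h4.pd_comm]; exact h1
    constructor
    · rw [e.2]; beta_reduce; rw [h2, h5]; simp; ring
    · rw [e.2]; beta_reduce; rw [h6]; simp
  obtain ⟨S, hS, hSc⟩ := exists_eq_comp_coord_two s₁ (e₁.mono fun _ h => h.1)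
    (e₁.mono fun _ h => h.2)
  have rS := hasPd_comp_coord_of_contDiff hS 2
  let c₂ : E3 → ℝ := fun z => c z - coeff₁ R S z
  have s₂ : SmoothNear c₂ a := hc.sub (Filter.Eventually.of_forall fun z =>
    contDiffAt_coeff₁ hR.contDiffAt hS.contDiffAt)
  have e₂ : ∀ᶠ x in 𝓝 a, pd 0 c₂ x = 0 ∧ pd 1 c₂ x = 0 := by
    filter_upwards [hc.hasPd, hRc, hSc] with x hx h1 h2
    have e := (hx.sub ((((((u x).mul ((rR x).sub ((y x).cmul (1 / 2)))).add
      ((((y x).mul (y x)).mul ((y x).mul (y x))).cmul (1 / 48))).add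
      (((rR x).mul (((y x).mul (y x)).mul (y x))).cmul (1 / 12))).add ((rS x).mul (y x))))).congr
      (g := c₂) (Filter.Eventually.of_forall fun p => by simp only [c₂, coeff₁]; ring)
    have h3 : pd 1 c x = R (x 2) - (1 / 2) * x 0 := by linarith
    have h4 : pd 0 c x = S (x 2) - (1 / 2) * x 1 + (1 / 4) * (R (x 2) * (x 0 * x 0))
      + (1 / 12) * (x 0 * (x 0 * x 0)) := by simp only [c₁] at h2; linarith
    constructor
    · rw [e.2]; beta_reduce; rw [h4]; simp; ring
    · rw [e.2]; beta_reduce; rw [h3]; simp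
  obtain ⟨K, hK, hKc⟩ := exists_eq_comp_coord_two s₂ (e₂.mono fun _ h => h.1)
    (e₂.mono fun _ h => h.2)
  refine ⟨R, S, K, hR, hS, hK, ?_⟩
  filter_upwards [hKc] with x hx
  rw [← hx]
  simp only [c₂]
  ring

/-- A linear differential equation of first order. -/
theorem exists_linear_ode {R K : ℝ → ℝ} (hR : ContDiff ℝ ∞ R) (hK : ContDiff ℝ ∞ K) :
    ∃ g : ℝ → ℝ, ContDiff ℝ ∞ g ∧ ∀ t, 2 * deriv g t + g t * R t + K t = 0 := by
  obtain ⟨A, hA, hA'⟩ := exists_primitive_real hR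
  have hexp : ContDiff ℝ ∞ fun t => Real.exp ((1 / 2) * A t) :=
    Real.contDiff_exp.comp (contDiff_const.mul hA)
  have hexp' : ContDiff ℝ ∞ fun t => Real.exp (-(1 / 2) * A t) :=
    Real.contDiff_exp.comp (contDiff_const.mul hA)
  obtain ⟨B, hB, hB'⟩ := exists_primitive_real (hexp.mul hK)
  -- Variation of constants: the integrating factor is exp(A/2) with A' = R, and B' = exp(A/2) K.
  refine ⟨fun t => -(1 / 2) * (Real.exp (-(1 / 2) * A t) * B t),
    contDiff_const.mul (hexp'.mul hB), fun t => ?_⟩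
  have d := (((((hA' t).const_mul (-(1 / 2))).exp).mul (hB' t)).const_mul (-(1 / 2)))
  rw [HasDerivAt.deriv (f := fun t => -(1 / 2) * (Real.exp (-(1 / 2) * A t) * B t)) d]
  have h1 : Real.exp (-(1 / 2) * A t) * Real.exp ((1 / 2) * A t) = 1 := by
    rw [← Real.exp_add]; simp
  linear_combination (-K t) * h1

section Manifold
variable {M : Type*} [TopologicalSpace M] [ChartedSpace E3 M] [IsManifold (𝓡 3) ∞ M]
  {W : WeylStructure M} {ε : ℝ} {p : M} {a : E3} {b c : E3 → ℝ}

/-- If `∂b/∂x = 0`, the Weyl structure belongs to the first family. -/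
theorem Rep.exists_family₁ (r : Rep W ε p (ansatz b c) ydt a) (hε : ε ≠ 0)
    (hEW : W.IsEinsteinWeyl) (hS : W.IsScalarFlat) (hb : SmoothNear b a)
    (hb1 : ∀ᶠ x in 𝓝 a, pd 1 b x = 0) :
    ∃ (R S : ℝ → ℝ) (a : E3), ContDiff ℝ ∞ R ∧ ContDiff ℝ ∞ S ∧ Rep W ε p (h₁ R S) ydt a := by
  -- a shift makes `b` vanish
  obtain ⟨g, hg, hg1, hg0⟩ := exists_planar_primitive hb.neg
    (by filter_upwards [hb1] with x hx; rw [pd_neg, hx, neg_zero])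
  obtain ⟨b', c', hb', hc', r', hbb, -⟩ := r.exists_shift hε hg hg1
  have hmap := map_nhds_shift hg hg1.self_of_nhds
  have hb0 : ∀ᶠ y in 𝓝 (shift g a), b' y = 0 := by
    rw [← hmap, Filter.eventually_map]
    filter_upwards [hbb, hg0] with x h1 h2
    rw [h1, h2]; ring
  have r₂ : Rep W ε p (ansatz (fun _ => 0) c') ydt (shift g a) :=
    r'.congr (by filter_upwards [hb0] with y hy; simp only [ansatz, hy])
      (Filter.Eventually.of_forall fun _ => rfl)
  have eqs := r₂.ansatzEquations hε hEW hS (SmoothNear.const 0) hc'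
  have z1 : ∀ i, pd i (fun _ : E3 => (0 : ℝ)) = fun _ => 0 := fun i => funext fun z => pd_const 0
  obtain ⟨R, S, K, hR, hS', hK, hcc⟩ := exists_coeff₁ hc'
    (by filter_upwards [eqs] with x h; simpa [z1] using h.c_xx)
    (by filter_upwards [eqs] with x h; simpa [z1] using h.c_xy)
    (by
      filter_upwards [eqs] with x h
      have := h.c_yy
      rw [h.c_xx] at this
      simp [z1] at this
      linarith)
  -- a second shift removes the term of degree zero
  obtain ⟨k, hk, hode⟩ := exists_linear_ode hR hK
  have pk : ∀ x i, pd i (fun z : E3 => k (z 2)) x = deriv k (x 2) * if 2 = i then 1 else 0 :=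
    fun x => (hasPd_comp_coord_of_contDiff hk 2 x).2
  obtain ⟨b₃, c₃, hb₃, hc₃, r₃, hbb₃, hcc₃⟩ := r₂.exists_shift hε (smoothNear_comp_coord hk 2 _)
    (Filter.Eventually.of_forall fun x => by rw [pk]; simp)
  -- Under x = x' + k the term x (R - y/2) produces kR - ky/2. The part linear in y is absorbed into
  -- S, and the equation for k cancels kR + K + 2k'.
  refine ⟨R, fun t => S t - (1 / 2) * k t, _, hR, hS'.sub (contDiff_const.mul hk),
    r₃.congr ?_ (Filter.Eventually.of_forall fun _ => rfl)⟩
  rw [← map_nhds_shift (smoothNear_comp_coord hk 2 _) (by rw [pk]; simp), Filter.eventually_map]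
  filter_upwards [hbb₃, hcc₃, hcc] with x h1 h2 h3
  rw [h₁_eq]
  simp only [ansatz]
  rw [h1, h2, h3, pk, pk]
  have := hode (x 2)
  have e : coeff₁ R (fun t => S t - (1 / 2) * k t) (shift (fun z => k (z 2)) x)
      = coeff₁ R S x + K (x 2) + 2 * (deriv k (x 2) * 1) := by
    simp [coeff₁, shift]
    linear_combination (-1) * this
  rw [e]
  simp

end Manifold

/-! ### The normal form when ∂b/∂x ≠ 0 -/

/-- The triangular matrix is the Jacobian of y' = (y - A) q, x' = q³ x, t' = T(t), with Q = q, t =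
T' and -Qm the t-derivative of y'. The relation Qt = 1 matches the coefficient of dx dt after the
rescaling by Q². -/
theorem scaled_congruence {Q t : ℝ} (hQ : Q * t = 1) (m b c A x : ℝ) :
    Q ^ 2 • (!![1, 0, b; 0, 0, 1; b, 1, c] : Matrix (Fin 3) (Fin 3) ℝ)
      = !![Q, 0, -Q * m; 0, Q ^ 3, -(3 / 2) * A * x * Q ^ 3; 0, 0, t].transpose
        * !![1, 0, (m + b) * (Q * Q); 0, 0, 1;
            (m + b) * (Q * Q), 1, (m ^ 2 + 2 * b * m + c) * Q ^ 4 + 3 * A * x * Q ^ 4]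
        * !![Q, 0, -Q * m; 0, Q ^ 3, -(3 / 2) * A * x * Q ^ 3; 0, 0, t] := by
  ext i j
  fin_cases i <;> fin_cases j <;> simp [Matrix.mul_apply, Fin.sum_univ_three]
  · ring
  · linear_combination (-(b + m) * Q ^ 2) * hQ
  · linear_combination (-Q ^ 2) * hQ
  · linear_combination (-(b + m) * Q ^ 2) * hQ
  · linear_combination (-Q ^ 2) * hQ
  · linear_combination (-(Q ^ 2 * ((m ^ 2 + 2 * b * m + c + 3 * A * x) * (Q * t) + c - m ^ 2))) * hQ

section Manifold
variable {M : Type*} [TopologicalSpace M] [ChartedSpace E3 M] [IsManifold (𝓡 3) ∞ M]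
  {W : WeylStructure M} {ε : ℝ} {p : M} {a : E3} {b c : E3 → ℝ}

/-- If `∂b/∂x ≠ 0`, a change of coordinates and of the representative gives `∂b/∂x = -2/y`. -/
theorem Rep.exists_scaled (r : Rep W ε p (ansatz b c) ydt a) (hε : ε ≠ 0)
    (hEW : W.IsEinsteinWeyl) (hS : W.IsScalarFlat) (hb : SmoothNear b a) (hc : SmoothNear c a)
    (hb1 : pd 1 b a ≠ 0) :
    ∃ (b c : E3 → ℝ) (a : E3), SmoothNear b a ∧ SmoothNear c a ∧ Rep W ε p (ansatz b c) ydt a ∧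
      a 0 ≠ 0 ∧ ∀ᶠ x in 𝓝 a, pd 1 b x = -2 / x 0 := by
  have eqs := r.ansatzEquations hε hEW hS hb hc
  have sy : SmoothNear (fun z : E3 => z 0) a := smoothNear_coord 0
  have sx : SmoothNear (fun z : E3 => z 1) a := smoothNear_coord 1
  have y (z : E3) := hasPd_coord (x := z) 0
  have u (z : E3) := hasPd_coord (x := z) 1
  have hbn := (hb.pd 1).continuousAt.eventually_ne hb1
  -- The equation b_xy = (1/2) b_x² says that 1/b_x has y-derivative -1/2, and b_xx = 0 removes x.
  -- So y + 2/b_x is a function A of t, and b_x = -2/(y - A).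
  have sα : SmoothNear (fun z => z 0 + 2 * (pd 1 b z)⁻¹) a :=
    sy.add ((SmoothNear.const 2).mul ((hb.pd 1).inv hb1))
  have eα : ∀ᶠ x in 𝓝 a, ∀ i, pd i (fun z => z 0 + 2 * (pd 1 b z)⁻¹) x
      = (if 0 = i then 1 else 0) + 2 * (-pd i (pd 1 b) x / pd 1 b x ^ 2) := by
    filter_upwards [eventually_hasPd_pd hb, hbn] with x hx h0 i
    exact ((y x).add (((hx 1).inv h0).cmul 2)).2 i
  obtain ⟨A, hA, hAc⟩ := exists_eq_comp_coord_two sα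
    (by
      filter_upwards [eα, eqs, hbn] with x h1 h2 h0
      rw [h1, h2.b_xy]
      simp only [if_pos]
      field_simp
      ring)
    (by filter_upwards [eα, eqs] with x h1 h2; rw [h1, h2.b_xx]; simp)
  obtain ⟨P, hP, hP'⟩ := exists_primitive_real hA
  -- The factor is chosen so that 2 d ln q = -A dt, which turns y dt into (y - A) dt. With dt' = τ
  -- dt and qτ = 1 this equals y' dt' for y' = (y - A) q.
  let q : ℝ → ℝ := fun t => Real.exp (-(1 / 2) * P t)
  let τ : ℝ → ℝ := fun t => Real.exp ((1 / 2) * P t)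
  have hq : ContDiff ℝ ∞ q := Real.contDiff_exp.comp (contDiff_const.mul hP)
  have hτ : ContDiff ℝ ∞ τ := Real.contDiff_exp.comp (contDiff_const.mul hP)
  have hqτ : ∀ t, q t * τ t = 1 := fun t => by simp only [q, τ]; rw [← Real.exp_add]; simp
  have hq0 : ∀ t, 0 < q t := fun t => Real.exp_pos _
  have hq' : ∀ t, deriv q t = -(1 / 2) * (A t * q t) := fun t => by
    have := ((hP' t).const_mul (-(1 / 2))).exp.deriv
    refine this.trans ?_
    simp only [q]; ring
  obtain ⟨T, hT, hT'⟩ := exists_primitive_real hτ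
  have rA := hasPd_comp_coord_of_contDiff hA 2
  have rq := hasPd_comp_coord_of_contDiff hq 2
  have rT := hasPd_comp_coord_of_contDiff hT 2
  have rP := hasPd_comp_coord_of_contDiff hP 2
  have hA1 : ContDiff ℝ ∞ (deriv A) := (contDiff_infty_iff_deriv.1 hA).2
  have rA' := hasPd_comp_coord_of_contDiff hA1 2
  have sA := smoothNear_comp_coord hA 2 a
  have sq := smoothNear_comp_coord hq 2 a
  let ψ : E3 → E3 := fun x => !₂[(x 0 - A (x 2)) * q (x 2), x 1 * (q (x 2) * (q (x 2) * q (x 2))),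
    T (x 2)]
  have hψ : SmoothNear ψ a := smoothNear_of_coord fun i => by
    fin_cases i
    exacts [(sy.sub sA).mul sq, sx.mul (sq.mul (sq.mul sq)), smoothNear_comp_coord hT 2 a]
  have hJ : ∀ x, jac ψ x = !![q (x 2), 0, -q (x 2) * ((1 / 2) * A (x 2) * (x 0 - A (x 2))
        + deriv A (x 2));
      0, q (x 2) ^ 3, -(3 / 2) * A (x 2) * x 1 * q (x 2) ^ 3;
      0, 0, τ (x 2)] := by
    intro x
    have e0 := (((y x).sub (rA x)).mul (rq x)).2
    have e1 := ((u x).mul ((rq x).mul ((rq x).mul (rq x)))).2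
    have e2 := (rT x).2
    ext i j
    rw [jac_apply]
    fin_cases i
    · refine (e0 j).trans ?_
      rw [hq']
      fin_cases j <;> simp <;> ring
    · refine (e1 j).trans ?_
      rw [hq']
      fin_cases j <;> simp <;> ring
    · refine (e2 j).trans ?_
      rw [(hT' _).deriv]
      fin_cases j <;> simp
  have hdet : ∀ x, (jac ψ x).det = q (x 2) ^ 3 := by
    intro x
    rw [hJ, Matrix.det_fin_three]
    simp
    linear_combination q (x 2) ^ 3 * hqτ (x 2)
  have hdet0 : ∀ x, (jac ψ x).det ≠ 0 := fun x => by
    rw [hdet]; exact pow_ne_zero 3 (hq0 _).ne'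
  have r₁ := r.gauge (χ := fun x => q (x 2)) sq (hq0 _)
  have hlog : (fun z : E3 => Real.log (q (z 2))) = fun z => -(1 / 2) * P (z 2) := by
    ext z; simp [q]
  let m : E3 → ℝ := fun x => (1 / 2) * (A (x 2) * (x 0 - A (x 2))) + deriv A (x 2)
  obtain ⟨b', c', hb', hc', r₂, hbb, -⟩ := r₁.ansatz_chart hε hψ (hdet0 a)
    (B := fun x => (m x + b x) * (q (x 2) * q (x 2)))
    (C := fun x => (m x ^ 2 + 2 * b x * m x + c x) * q (x 2) ^ 4 + 3 * A (x 2) * x 1 * q (x 2) ^ 4)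
    (Filter.Eventually.of_forall fun x => by
      rw [hJ, mul_assoc (1 / 2 : ℝ)]
      exact scaled_congruence (hqτ (x 2)) (m x) (b x) (c x) (A (x 2)) (x 1))
    (Filter.Eventually.of_forall fun x i => by
      rw [hJ, hlog, ((rP x).cmul (-(1 / 2))).2, (hP' _).deriv]
      fin_cases i <;> simp [ydt, ψ]
      linear_combination (-(x 0 - A (x 2))) * hqτ (x 2))
  have hmap := map_nhds_of_jac_det_ne_zero hψ (hdet0 a)
  refine ⟨b', c', ψ a, hb', hc', r₂, ?_, ?_⟩
  · show (a 0 - A (a 2)) * q (a 2) ≠ 0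
    rw [← hAc.self_of_nhds]
    refine mul_ne_zero ?_ (hq0 _).ne'
    have := inv_ne_zero hb1
    intro h
    apply this
    linarith
  · have hb'' := hb'.eventually
    rw [← hmap, Filter.eventually_map] at hb'' ⊢
    filter_upwards [hb'', hbb.eventually_nhds, hψ, hb.hasPd, hAc, hbn] with x h1 h2 h3 h4 h5 h6
    have e := pd_comp h1.diff (h3.differentiableAt (by simp)) 1
    have em := (((((rA x).mul ((y x).sub (rA x))).cmul (1 / 2)).add (rA' x)).add h4).mul
      ((rq x).mul (rq x))
    rw [pd_congr h2, em.2, hJ] at e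
    simp [Fin.sum_univ_three] at e
    have hQ := (hq0 (x 2)).ne'
    have h7 : x 0 - A (x 2) = -2 * (pd 1 b x)⁻¹ := by linarith
    show pd 1 b' (ψ x) = -2 / ((x 0 - A (x 2)) * q (x 2))
    rw [h7]
    field_simp
    have : q (x 2) ^ 2 * (pd 1 b' (ψ x) * q (x 2) - pd 1 b x) = 0 := by
      linear_combination (-1) * e
    have := (mul_eq_zero.1 this).resolve_left (pow_ne_zero 2 hQ)
    linarith

end Manifold

theorem pd_shift₂ {x : E3} (h0 : x 0 ≠ 0) (i : Fin 3) : pd i (fun p : E3 => -2 * p 1 / p 0) x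
    = -2 * ((if 1 = i then 1 else 0) * (x 0)⁻¹) + 2 * (x 1 * (x 0)⁻¹ ^ 2) * (if 0 = i then 1 else 0) := by
  have e := (((hasPd_coord (x := x) 1).mul ((hasPd_coord (x := x) 0).inv h0)).cmul (-2)).congr
    (g := fun p : E3 => -2 * p 1 / p 0) (Filter.Eventually.of_forall fun p => by ring)
  rw [e.2]
  field_simp
  ring

/-- The equations for the coefficient of `dt²` in the second family. -/
theorem AnsatzEquations.of_shift₂ {c : E3 → ℝ} {x : E3}
    (h : AnsatzEquations (fun p => -2 * p 1 / p 0) c x) (h0 : x 0 ≠ 0) :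
    pd 1 (pd 1 c) x = 2 * (x 0)⁻¹ ^ 2 ∧ pd 0 (pd 1 c) x = 1 / 2 - 4 * x 1 * (x 0)⁻¹ ^ 3 ∧
      pd 0 (pd 0 c) x = -2 * x 1 * (x 0)⁻¹ + 8 * x 1 ^ 2 * (x 0)⁻¹ ^ 4 + 2 * (x 0)⁻¹ * pd 0 c x
        - 2 * (x 0)⁻¹ ^ 2 * c x + 2 * x 1 * (x 0)⁻¹ ^ 2 * pd 1 c x + (1 / 2) * x 0 * pd 1 c x
        + (1 / 2) * x 0 ^ 2 := by
  have h0n : ∀ᶠ z : E3 in 𝓝 x, z 0 ≠ 0 := (smoothNear_coord 0).continuousAt.eventually_ne h0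
  have p2 : ∀ i, pd i (pd 2 (fun p : E3 => -2 * p 1 / p 0)) x = 0 := fun i => by
    rw [pd_congr (g := fun _ => 0) (by
      filter_upwards [h0n] with z hz
      rw [pd_shift₂ hz]
      simp), pd_const]
  have e1 := h.c_xx
  have e2 := h.c_xy
  have e3 := h.c_yy
  rw [p2] at e2 e3
  rw [p2, e1, e2] at e3
  rw [pd_shift₂ h0] at e1 e2 e3
  rw [pd_shift₂ h0] at e3
  simp at e1 e2 e3
  have hv : x 0 * (x 0)⁻¹ = 1 := mul_inv_cancel₀ h0
  refine ⟨?_, ?_, ?_⟩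
  · rw [e1]; ring
  · rw [e2]; field_simp; ring
  · have : pd 0 (pd 0 c) x = 2 * (2⁻¹ * pd 0 (pd 0 c) x) := by ring
    rw [this, e3]; field_simp; ring

/-- Integration of the equations for the coefficient of `dt²` in the second family. -/
theorem exists_coeff₂ {c : E3 → ℝ} {a : E3} (hc : SmoothNear c a) (h0 : a 0 ≠ 0)
    (heq : ∀ᶠ x in 𝓝 a, AnsatzEquations (fun p => -2 * p 1 / p 0) c x)
    (h1 : ∀ᶠ x in 𝓝 a, pd 1 c x = 2 * x 1 * (x 0)⁻¹ ^ 2 + (1 / 2) * x 0) :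
    ∃ R S : ℝ → ℝ, ContDiff ℝ ∞ R ∧ ContDiff ℝ ∞ S ∧ ∀ᶠ x in 𝓝 a, c x = coeff₂ R S x := by
  have sy : SmoothNear (fun z : E3 => z 0) a := smoothNear_coord 0
  have sx : SmoothNear (fun z : E3 => z 1) a := smoothNear_coord 1
  have sv : SmoothNear (fun z : E3 => (z 0)⁻¹) a := sy.inv h0
  have h0n : ∀ᶠ z : E3 in 𝓝 a, z 0 ≠ 0 := sy.continuousAt.eventually_ne h0
  have y (z : E3) := hasPd_coord (x := z) 0
  have u (z : E3) := hasPd_coord (x := z) 1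
  -- The homogeneous equation for c in y is of Euler type with solutions y² and y. Here w is the
  -- y-derivative of c/y minus that of a particular solution, so it isolates the coefficient R of
  -- y².
  let w : E3 → ℝ := fun z => pd 0 c z * (z 0)⁻¹ - c z * ((z 0)⁻¹ * (z 0)⁻¹)
    + 3 * ((z 1 * z 1) * (((z 0)⁻¹ * (z 0)⁻¹) * ((z 0)⁻¹ * (z 0)⁻¹))) - (3 / 8) * (z 0 * z 0)
  have sw : SmoothNear w a := ((((hc.pd 0).mul sv).sub (hc.mul (sv.mul sv))).add
    ((SmoothNear.const 3).mul ((sx.mul sx).mul ((sv.mul sv).mul (sv.mul sv))))).sub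
    ((SmoothNear.const (3 / 8)).mul (sy.mul sy))
  have ew : ∀ᶠ x in 𝓝 a, pd 0 w x = 0 ∧ pd 1 w x = 0 := by
    filter_upwards [hc.hasPd, eventually_hasPd_pd hc, heq, h1, h0n, hc.eventually]
      with x hx hx' h2 h3 h4 h5
    obtain ⟨e11, e01, e00⟩ := h2.of_shift₂ h4
    have v := (y x).inv h4
    have e := ((((hx' 0).mul v).sub (hx.mul (v.mul v))).add
      ((((u x).mul (u x)).mul ((v.mul v).mul (v.mul v))).cmul 3)).sub
      (((y x).mul (y x)).cmul (3 / 8))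
    have e10 := h5.pd_comm 1 0
    constructor
    · rw [e.2]; beta_reduce; rw [e00, h3]; simp; field_simp; ring
    · rw [e.2]; beta_reduce; rw [e10, e01, h3]; simp; field_simp; ring
  obtain ⟨R, hR, hRc⟩ := exists_eq_comp_coord_two sw (ew.mono fun _ h => h.1)
    (ew.mono fun _ h => h.2)
  have rR := hasPd_comp_coord_of_contDiff hR 2
  -- With R known, dividing by y and subtracting all other terms leaves the coefficient S of y.
  let s : E3 → ℝ := fun z => c z * (z 0)⁻¹ - (z 1 * z 1) * ((z 0)⁻¹ * ((z 0)⁻¹ * (z 0)⁻¹))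
    - (1 / 2) * z 1 - (1 / 8) * (z 0 * (z 0 * z 0)) - z 0 * R (z 2)
  have ss : SmoothNear s a := ((((hc.mul sv).sub ((sx.mul sx).mul (sv.mul (sv.mul sv)))).sub
    ((SmoothNear.const (1 / 2)).mul sx)).sub ((SmoothNear.const (1 / 8)).mul
    (sy.mul (sy.mul sy)))).sub (sy.mul (smoothNear_comp_coord hR 2 a))
  have es : ∀ᶠ x in 𝓝 a, pd 0 s x = 0 ∧ pd 1 s x = 0 := by
    filter_upwards [hc.hasPd, h1, h0n, hRc] with x hx h3 h4 h5
    have v := (y x).inv h4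
    have e := (((((hx.mul v).sub (((u x).mul (u x)).mul (v.mul (v.mul v)))).sub
      ((u x).cmul (1 / 2))).sub (((y x).mul ((y x).mul (y x))).cmul (1 / 8))).sub
      ((y x).mul (rR x)))
    constructor
    · rw [e.2]; beta_reduce; rw [← h5]; simp [w]; field_simp; ring
    · rw [e.2]; beta_reduce; rw [h3]; simp; field_simp; ring
  obtain ⟨S, hS, hSc⟩ := exists_eq_comp_coord_two ss (es.mono fun _ h => h.1)
    (es.mono fun _ h => h.2)
  refine ⟨R, S, hR, hS, ?_⟩
  filter_upwards [hSc, h0n] with x h2 h3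
  simp only [coeff₂, ← h2, s]
  field_simp
  ring

section Manifold
variable {M : Type*} [TopologicalSpace M] [ChartedSpace E3 M] [IsManifold (𝓡 3) ∞ M]
  {W : WeylStructure M} {ε : ℝ} {p : M} {a : E3} {b c : E3 → ℝ}

/-- If `∂b/∂x = -2/y`, a shift gives `b = -2x/y`. -/
theorem Rep.exists_shifted (r : Rep W ε p (ansatz b c) ydt a) (hε : ε ≠ 0) (hb : SmoothNear b a)
    (h0 : a 0 ≠ 0) (hb1 : ∀ᶠ x in 𝓝 a, pd 1 b x = -2 / x 0) :
    ∃ (c : E3 → ℝ) (a : E3), SmoothNear c a ∧ a 0 ≠ 0 ∧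
      Rep W ε p (ansatz (fun p => -2 * p 1 / p 0) c) ydt a := by
  have sy : SmoothNear (fun z : E3 => z 0) a := smoothNear_coord 0
  have sx : SmoothNear (fun z : E3 => z 1) a := smoothNear_coord 1
  have sv : SmoothNear (fun z : E3 => (z 0)⁻¹) a := sy.inv h0
  have h0n : ∀ᶠ z : E3 in 𝓝 a, z 0 ≠ 0 := sy.continuousAt.eventually_ne h0
  have y (z : E3) := hasPd_coord (x := z) 0
  have u (z : E3) := hasPd_coord (x := z) 1
  -- A shift by g gives b = -2x/y in the new coordinates when g_y - 2g/y = -(b + 2x/y). With g = y²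
  -- k this reads k_y = β, and β is independent of x because b_x = -2/y.
  let β : E3 → ℝ := fun z => -1 * ((b z + 2 * (z 1 * (z 0)⁻¹)) * ((z 0)⁻¹ * (z 0)⁻¹))
  have sβ : SmoothNear β a := (SmoothNear.const (-1)).mul
    ((hb.add ((SmoothNear.const 2).mul (sx.mul sv))).mul (sv.mul sv))
  obtain ⟨k, hk, hk1, hk0⟩ := exists_planar_primitive sβ (by
    filter_upwards [hb.hasPd, hb1, h0n] with x hx h1 h2
    have v := (y x).inv h2
    rw [(((hx.add (((u x).mul v).cmul 2)).mul (v.mul v)).cmul (-1)).2]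
    beta_reduce
    rw [h1]
    simp
    left
    field_simp
    ring)
  have eg : ∀ᶠ x in 𝓝 a, ∀ i, pd i (fun z => (z 0 * z 0) * k z) x
      = ((if 0 = i then 1 else 0) * x 0 + x 0 * if 0 = i then 1 else 0) * k x
        + (x 0 * x 0) * pd i k x := by
    filter_upwards [hk.hasPd] with x hx i
    exact (((y x).mul (y x)).mul hx).2 i
  have sg : SmoothNear (fun z => (z 0 * z 0) * k z) a := (sy.mul sy).mul hk
  have eg1 : ∀ᶠ x in 𝓝 a, pd 1 (fun z => (z 0 * z 0) * k z) x = 0 := by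
    filter_upwards [eg, hk1] with x h1 h2
    rw [h1, h2]; simp
  obtain ⟨b', c', hb', hc', r', hbb, -⟩ := r.exists_shift hε sg eg1
  refine ⟨c', _, hc', h0, r'.congr ?_ (Filter.Eventually.of_forall fun _ => rfl)⟩
  rw [← map_nhds_shift sg eg1.self_of_nhds, Filter.eventually_map]
  filter_upwards [hbb, eg, hk0, h0n] with x h1 h2 h3 h4
  have e : -2 * (shift (fun z => (z 0 * z 0) * k z) x) 1
      / (shift (fun z => (z 0 * z 0) * k z) x) 0
      = b' (shift (fun z => (z 0 * z 0) * k z) x) := by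
    rw [h1, h2, h3]
    simp [shift, β]
    field_simp
    ring
  simp only [ansatz]
  rw [e]

/-- If `∂b/∂x ≠ 0`, the Weyl structure belongs to the second family. -/
theorem Rep.exists_family₂ (r : Rep W ε p (ansatz b c) ydt a) (hε : ε ≠ 0)
    (hEW : W.IsEinsteinWeyl) (hS : W.IsScalarFlat) (hb : SmoothNear b a) (hc : SmoothNear c a)
    (hb1 : pd 1 b a ≠ 0) :
    ∃ (R S : ℝ → ℝ) (a : E3), ContDiff ℝ ∞ R ∧ ContDiff ℝ ∞ S ∧ a 0 ≠ 0 ∧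
      Rep W ε p (h₂ R S) ydt a := by
  obtain ⟨b, c, a, hb, hc, r, h0, hb1⟩ := r.exists_scaled hε hEW hS hb hc hb1
  obtain ⟨c, a, hc, h0, r⟩ := r.exists_shifted hε hb h0 hb1
  have sy : SmoothNear (fun z : E3 => z 0) a := smoothNear_coord 0
  have sx : SmoothNear (fun z : E3 => z 1) a := smoothNear_coord 1
  have sv : SmoothNear (fun z : E3 => (z 0)⁻¹) a := sy.inv h0
  have h0n : ∀ᶠ z : E3 in 𝓝 a, z 0 ≠ 0 := sy.continuousAt.eventually_ne h0
  have y (z : E3) := hasPd_coord (x := z) 0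
  have u (z : E3) := hasPd_coord (x := z) 1
  have sb : ∀ {a : E3}, a 0 ≠ 0 → SmoothNear (fun p : E3 => -2 * p 1 / p 0) a := fun {a} h => by
    filter_upwards [(smoothNear_coord 0).continuousAt.eventually_ne h] with x hx
      using contDiffAt_shift₂ hx
  have eqs := r.ansatzEquations hε hEW hS (sb h0) hc
  -- a second shift normalizes the terms of degree one in `x`
  have sk : SmoothNear (fun z => pd 1 c z - 2 * (z 1 * ((z 0)⁻¹ * (z 0)⁻¹)) - (1 / 2) * z 0) a :=
    ((hc.pd 1).sub ((SmoothNear.const 2).mul (sx.mul (sv.mul sv)))).sub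
      ((SmoothNear.const (1 / 2)).mul sy)
  have ek : ∀ᶠ x in 𝓝 a,
      pd 0 (fun z => pd 1 c z - 2 * (z 1 * ((z 0)⁻¹ * (z 0)⁻¹)) - (1 / 2) * z 0) x = 0 ∧
      pd 1 (fun z => pd 1 c z - 2 * (z 1 * ((z 0)⁻¹ * (z 0)⁻¹)) - (1 / 2) * z 0) x = 0 := by
    filter_upwards [eventually_hasPd_pd hc, eqs, h0n] with x hx h2 h4
    obtain ⟨e11, e01, -⟩ := h2.of_shift₂ h4
    have v := (y x).inv h4
    have e := ((hx 1).sub (((u x).mul (v.mul v)).cmul 2)).sub ((y x).cmul (1 / 2))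
    constructor
    · rw [e.2]; beta_reduce; rw [e01]; simp; field_simp; ring
    · rw [e.2]; beta_reduce; rw [e11]; simp; field_simp; ring
  obtain ⟨k, hk, hkc⟩ := exists_eq_comp_coord_two sk (ek.mono fun _ h => h.1)
    (ek.mono fun _ h => h.2)
  have rk := hasPd_comp_coord_of_contDiff hk 2
  -- Shifts with g_y = 2g/y, that is, g equal to y² times a function of t, preserve b = -2x/y. This
  -- one cancels k(t) in c_x = 2x/y² + y/2 + k.
  let g : E3 → ℝ := fun z => -(1 / 2) * ((z 0 * z 0) * k (z 2))
  have sg : SmoothNear g a := (SmoothNear.const _).mul ((sy.mul sy).mul (smoothNear_comp_coord hk 2 a))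
  have pg := fun x => (((((y x).mul (y x)).mul (rk x))).cmul (-(1 / 2))).2
  have pg1 : ∀ x, pd 1 g x = 0 := fun x => by rw [pg]; simp
  obtain ⟨b', c', hb', hc', r', hbb, hcc⟩ := r.exists_shift hε sg (Filter.Eventually.of_forall pg1)
  have hmap := map_nhds_shift sg (pg1 a)
  have h0' : shift g a 0 ≠ 0 := h0
  have hb₂ : ∀ᶠ x in 𝓝 (shift g a), -2 * x 1 / x 0 = b' x := by
    rw [← hmap, Filter.eventually_map]
    filter_upwards [hbb, h0n] with x h1 h2
    rw [h1, pg]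
    simp [shift, g]
    field_simp
    ring
  have r₂ : Rep W ε p (ansatz (fun p => -2 * p 1 / p 0) c') ydt (shift g a) :=
    r'.congr (by filter_upwards [hb₂] with x hx; simp only [ansatz, hx])
      (Filter.Eventually.of_forall fun _ => rfl)
  have eqs' := r₂.ansatzEquations hε hEW hS (sb h0') hc'
  have hc1 : ∀ᶠ x in 𝓝 (shift g a), pd 1 c' x = 2 * x 1 * (x 0)⁻¹ ^ 2 + (1 / 2) * x 0 := by
    have hc'' := hc'.eventually
    rw [← hmap, Filter.eventually_map] at hc'' ⊢
    filter_upwards [hc'', hcc.eventually_nhds, sg.eventually, hc.hasPd, hkc, h0n]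
      with x h1 h2 h3 h4 h5 h6
    have e := pd_comp (ψ := shift g) h1.diff
      ((smoothNear_shift h3).contDiffAt.differentiableAt (by simp)) 1
    have e2 : pd 1 (fun z => 2 * pd 2 g z) x = 0 := by
      rw [pd_const_mul _ (h3.pd 2).diff, h3.pd_comm,
        pd_congr (g := fun _ => 0) (Filter.Eventually.of_forall pg1), pd_const, mul_zero]
    rw [pd_congr h2, pd_add h4.1 ((h3.pd 2).diff.const_mul 2), e2, jac_shift h3.diff (pg1 x)] at e
    simp [Fin.sum_univ_three] at e
    rw [← e]
    simp [shift, g]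
    rw [← h5]
    field_simp
    ring
  obtain ⟨R, S, hR, hS', hco⟩ := exists_coeff₂ hc' h0' eqs' hc1
  refine ⟨R, S, _, hR, hS', h0', r₂.congr ?_ (Filter.Eventually.of_forall fun _ => rfl)⟩
  filter_upwards [hco] with x hx
  rw [h₂_eq]
  simp only [ansatz, hx]

/-! ### The normal forms -/

omit [IsManifold (𝓡 3) ∞ M] in
/-- The chart and the representative may be restricted to a small neighbourhood. -/
theorem Rep.exists_restricted_chart {h : E3 → Matrix (Fin 3) (Fin 3) ℝ} {om : E3 → Fin 3 → ℝ}
    (r : Rep W ε p h om a) {Q : E3 → Prop} (hQ : ∀ᶠ x in 𝓝 a, Q x) :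
    ∃ e ∈ IsManifold.maximalAtlas (𝓡 3) ∞ M, p ∈ e.source ∧
      ∃ φ : E3 → ℝ, ContDiffOn ℝ ∞ φ e.target ∧ ∀ x ∈ e.target, Q x ∧ 0 < φ x ∧
        (φ x ^ 2 * ε) • W.hc e x = h x ∧
        ∀ i, W.omc e x i + 2 * pd i (fun z => Real.log (φ z)) x = om x i := by
  obtain ⟨e, he, hp, rfl, φ, hφ, hφ0, hh, ho⟩ := r
  have hall := hQ.and (hφ.and ((hφ.continuousAt.eventually_const_lt hφ0).and (hh.and ho)))
  obtain ⟨V, hV, hVo, hpV⟩ := eventually_nhds_iff.1 hall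
  let s : Set M := e.source ∩ e ⁻¹' V
  have hs : IsOpen s := e.isOpen_inter_preimage hVo
  have ht : ∀ x ∈ (e.restr s).target, x ∈ V := by
    intro x hx
    have hx' : x ∈ e.target ∧ e.symm x ∈ interior s := by
      simpa [OpenPartialHomeomorph.restr_target] using hx
    rw [hs.interior_eq] at hx'
    have := hx'.2.2
    rwa [Set.mem_preimage, e.right_inv hx'.1] at this
  refine ⟨e.restr s, restr_mem_maximalAtlas _ he hs, ?_, φ, fun x hx => ?_, fun x hx => ?_⟩
  · rw [OpenPartialHomeomorph.restr_source, hs.interior_eq]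
    exact ⟨hp, hp, hpV⟩
  · exact (hV x (ht x hx)).2.1.contDiffWithinAt
  · obtain ⟨c1, c2, c3, c4, c5⟩ := hV x (ht x hx)
    exact ⟨c1, c3, c4.symm, fun i => (c5 i).symm⟩

theorem Rep.hasForm₁ (r : Rep W ε p (ansatz b c) ydt a) (hε : ε ≠ 0)
    (hEW : W.IsEinsteinWeyl) (hS : W.IsScalarFlat) (hb : SmoothNear b a)
    (hb1 : ∀ᶠ x in 𝓝 a, pd 1 b x = 0) : W.HasForm₁ ε p := by
  obtain ⟨R, S, a, hR, hS, r⟩ := r.exists_family₁ hε hEW hS hb hb1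
  obtain ⟨e, he, hp, φ, hφ, H⟩ := r.exists_restricted_chart (Q := fun _ => True) (by simp)
  exact ⟨R, S, hR, hS, e, he, hp, φ, hφ, fun x hx => (H x hx).2⟩

theorem Rep.hasForm₂ (r : Rep W ε p (ansatz b c) ydt a) (hε : ε ≠ 0)
    (hEW : W.IsEinsteinWeyl) (hS : W.IsScalarFlat) (hb : SmoothNear b a) (hc : SmoothNear c a)
    (hb1 : pd 1 b a ≠ 0) : W.HasForm₂ ε p := by
  obtain ⟨R, S, a, hR, hS, h0, r⟩ := r.exists_family₂ hε hEW hS hb hc hb1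
  obtain ⟨e, he, hp, φ, hφ, H⟩ := r.exists_restricted_chart
    ((smoothNear_coord 0).continuousAt.eventually_ne h0)
  exact ⟨R, S, hR, hS, e, he, hp, φ, hφ, H⟩

end Manifold

/-! ### The signature is locally constant -/

theorem hasSignaturePPM_congr {A Q : Matrix (Fin 3) (Fin 3) ℝ} (hQ : Q.det ≠ 0) :
    HasSignaturePPM (Q.transpose * A * Q) ↔ HasSignaturePPM A := by
  constructor
  · rintro ⟨P, hP, h⟩
    refine ⟨Q * P, by rw [Matrix.det_mul]; exact mul_ne_zero hQ hP, ?_⟩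
    rw [← h, Matrix.transpose_mul]
    simp only [Matrix.mul_assoc]
  · rintro ⟨P, hP, h⟩
    have u : IsUnit Q.det := hQ.isUnit
    have u' : IsUnit Q.transpose.det := by rwa [Matrix.det_transpose]
    refine ⟨Q⁻¹ * P, ?_, ?_⟩
    · rw [Matrix.det_mul]
      exact mul_ne_zero ((Matrix.isUnit_nonsing_inv_det_iff.2 u).ne_zero) hP
    · rw [← h, Matrix.transpose_mul, Matrix.transpose_nonsing_inv]
      calc _ = P.transpose * (Q.transpose⁻¹ * Q.transpose) * A * (Q * Q⁻¹) * P := by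
            simp only [Matrix.mul_assoc]
        _ = _ := by
            rw [Matrix.nonsing_inv_mul _ u', Matrix.mul_nonsing_inv _ u, Matrix.mul_one,
              Matrix.mul_one]

theorem HasSignaturePPM.det_neg {A : Matrix (Fin 3) (Fin 3) ℝ} (h : HasSignaturePPM A) :
    A.det < 0 := by
  obtain ⟨P, hP, h⟩ := h
  have e := congrArg Matrix.det h
  rw [Matrix.det_mul, Matrix.det_mul, Matrix.det_transpose, Matrix.det_diagonal] at e
  simp [Fin.prod_univ_three] at e
  by_contra! hc
  have := mul_nonneg (sq_nonneg P.det) hc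
  nlinarith

theorem hasSignaturePPM_smul {A : Matrix (Fin 3) (Fin 3) ℝ} {r : ℝ} (hr : r ≠ 0) :
    HasSignaturePPM (r ^ 2 • A) ↔ HasSignaturePPM A := by
  rw [← hasSignaturePPM_congr (A := A) (Q := r • 1) (by simp [hr])]
  rw [Matrix.transpose_smul, Matrix.transpose_one, Matrix.smul_mul, Matrix.one_mul, Matrix.mul_smul,
    Matrix.mul_one, smul_smul, sq]

/-- Symmetric elimination, when the leading minors have prescribed signs. -/
theorem exists_congruent_signs {S : Matrix (Fin 3) (Fin 3) ℝ} (hS : S.IsSymm) {s₀ s₁ s₂ : ℝ}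
    (h₀ : s₀ ^ 2 = 1) (h₁ : s₁ ^ 2 = 1) (h₂ : s₂ ^ 2 = 1) (m₀ : 0 < s₀ * S 0 0)
    (m₁ : 0 < s₀ * s₁ * (S 0 0 * S 1 1 - S 0 1 ^ 2)) (m₂ : 0 < s₀ * s₁ * s₂ * S.det) :
    ∃ Q : Matrix (Fin 3) (Fin 3) ℝ, Q.det ≠ 0 ∧
      Q.transpose * S * Q = Matrix.diagonal ![s₀, s₁, s₂] := by
  have e10 : S 1 0 = S 0 1 := hS.apply 0 1
  have e20 : S 2 0 = S 0 2 := hS.apply 0 2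
  have e21 : S 2 1 = S 1 2 := hS.apply 1 2
  rw [Matrix.det_fin_three, e10, e20, e21] at m₂
  generalize ha : S 0 0 = a at *
  generalize hb : S 0 1 = b at *
  generalize hc : S 0 2 = c at *
  generalize hd : S 1 1 = d at *
  generalize he : S 1 2 = e at *
  generalize hf : S 2 2 = f at *
  have a0 : a ≠ 0 := by rintro rfl; simp at m₀
  have n0 : a * d - b ^ 2 ≠ 0 := fun h => by rw [h] at m₁; simp at m₁
  obtain ⟨k, hk⟩ : ∃ k, a * k = 1 := ⟨a⁻¹, mul_inv_cancel₀ a0⟩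
  obtain ⟨r, hr⟩ : ∃ r, (a * d - b ^ 2) * r = 1 := ⟨_, mul_inv_cancel₀ n0⟩
  have key : ∀ s u : ℝ, s ^ 2 = 1 → 0 < s * u → ∃ α : ℝ, α ≠ 0 ∧ α ^ 2 * u = s := by
    intro s u hs hp
    have hne : Real.sqrt (s * u) ≠ 0 := Real.sqrt_ne_zero'.2 hp
    refine ⟨(Real.sqrt (s * u))⁻¹, inv_ne_zero hne, ?_⟩
    rw [inv_pow, Real.sq_sqrt hp.le, inv_mul_eq_div, div_eq_iff hp.ne']
    linear_combination (-u) * hs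
  -- The three pivots of the elimination are the quotients of consecutive leading minors. Their
  -- signs are the prescribed ones, and α, β, γ normalize them to ±1.
  obtain ⟨α, hα, eα⟩ := key s₀ a h₀ m₀
  obtain ⟨β, hβ, eβ⟩ := key s₁ ((a * d - b ^ 2) * k) h₁ (by
    have : s₁ * ((a * d - b ^ 2) * k) = (s₀ * s₁ * (a * d - b ^ 2)) * (s₀ * a) * k ^ 2 := by
      linear_combination (-(s₁ * (a * d - b ^ 2) * k * (a * k))) * h₀
        - s₁ * (a * d - b ^ 2) * k * hk
    have hk0 : k ≠ 0 := right_ne_zero_of_mul_eq_one hk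
    rw [this]; positivity)
  obtain ⟨γ, hγ, eγ⟩ := key s₂
    ((a * d * f - a * e * e - b * b * f + b * e * c + c * b * e - c * d * c) * r) h₂ (by
    generalize a * d * f - a * e * e - b * b * f + b * e * c + c * b * e - c * d * c = Δ at *
    generalize a * d - b ^ 2 = n at *
    have : s₂ * (Δ * r) = (s₀ * s₁ * s₂ * Δ) * (s₀ * s₁ * n) * r ^ 2 := by
      linear_combination (-(s₂ * Δ * n * r ^ 2)) * (s₁ ^ 2 * h₀ + h₁) - s₂ * Δ * r * hr
    have hr0 : r ≠ 0 := right_ne_zero_of_mul_eq_one hr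
    rw [this]; positivity)
  have hSe : S = !![a, b, c; b, d, e; c, e, f] := by
    ext i j
    fin_cases i <;> fin_cases j <;> simp <;> assumption
  -- Columns of the upper triangular elimination matrix, with `k` the inverse of the first minor and
  -- `r` the inverse of the second.
  refine ⟨!![α, -b * k * β, (b * e - c * d) * r * γ; 0, β, (b * c - a * e) * r * γ; 0, 0, γ], ?_, ?_⟩
  · rw [Matrix.det_fin_three]
    simp [hα, hβ, hγ]
  · rw [hSe]
    ext i j
    fin_cases i <;> fin_cases j <;>
      simp [Matrix.mul_apply, Fin.sum_univ_three, Matrix.diagonal, -mul_eq_zero]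
    · linear_combination eα
    · linear_combination (-α * b * β) * hk
    · linear_combination (-α * γ * c) * hr
    · linear_combination (-α * b * β) * hk
    · linear_combination eβ + β ^ 2 * (b ^ 2 * k - d) * hk
    · linear_combination β * γ * (b * k * c - e) * hr
    · linear_combination (-α * γ * c) * hr
    · linear_combination β * γ * (b * k * c - e) * hr
    · linear_combination eγ - γ ^ 2 * (((b * e - c * d) * c + (b * c - a * e) * e) * r + f) * hr

theorem exists_congruent_diagonal {A : Matrix (Fin 3) (Fin 3) ℝ} (hA : A.IsSymm)
    (hd : A.det ≠ 0) : ∃ (P : Matrix (Fin 3) (Fin 3) ℝ) (l : Fin 3 → ℝ), P.det ≠ 0 ∧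
      (∀ i, l i ≠ 0) ∧ P.transpose * A * P = Matrix.diagonal l := by
  have hA' : A.IsHermitian := by
    rw [Matrix.IsHermitian, Matrix.conjTranspose_eq_transpose_of_trivial]; exact hA
  have h1 := hA'.conjStarAlgAut_star_eigenvectorUnitary
  rw [Unitary.conjStarAlgAut_star_apply] at h1
  have hU : (hA'.eigenvectorUnitary : Matrix (Fin 3) (Fin 3) ℝ).det ≠ 0 := by
    intro h0
    have := congrArg Matrix.det (Unitary.coe_star_mul_self hA'.eigenvectorUnitary)
    rw [Matrix.det_mul, h0] at this
    simp at this
  refine ⟨hA'.eigenvectorUnitary, hA'.eigenvalues, hU, ?_, ?_⟩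
  · intro i hi
    apply hd
    rw [hA'.det_eq_prod_eigenvalues]
    exact Finset.prod_eq_zero (Finset.mem_univ i) (by rw [hi]; rfl)
  · rw [Matrix.star_eq_conjTranspose, Matrix.conjTranspose_eq_transpose_of_trivial] at h1
    exact h1

theorem continuousAt_eventually_pos {X : Type*} [TopologicalSpace X] {a : X} {f : X → ℝ}
    (h : 0 < f a) (hf : ContinuousAt f a) : ∀ᶠ x in 𝓝 a, 0 < f x :=
  hf.tendsto.eventually_const_lt h

/-- In a basis diagonalizing the form at `a` the leading minors are nonzero there, so by continuity
they keep their signs nearby. By elimination all nearby forms are congruent to one fixed diagonal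
matrix of signs. -/
theorem eventually_hasSignaturePPM_iff {X : Type*} [TopologicalSpace X] {a : X}
    {f : X → Matrix (Fin 3) (Fin 3) ℝ} (hf : ∀ i j, ContinuousAt (fun x => f x i j) a)
    (hs : ∀ᶠ x in 𝓝 a, (f x).IsSymm) (hd : (f a).det ≠ 0) :
    ∀ᶠ x in 𝓝 a, HasSignaturePPM (f x) ↔ HasSignaturePPM (f a) := by
  obtain ⟨P, l, hP, hl, hPl⟩ := exists_congruent_diagonal hs.self_of_nhds hd
  let g : X → Matrix (Fin 3) (Fin 3) ℝ := fun x => P.transpose * f x * P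
  have hg : ∀ i j, ContinuousAt (fun x => g x i j) a := by
    intro i j
    simp only [g, Matrix.mul_apply, Fin.sum_univ_three, Matrix.transpose_apply]
    have := hf
    fun_prop
  have hsq : ∀ i, (l i / |l i|) ^ 2 = 1 := fun i => by
    rw [div_pow, sq_abs, div_self (pow_ne_zero 2 (hl i))]
  have hpos : ∀ i, 0 < l i / |l i| * l i := fun i => by
    rw [div_mul_eq_mul_div, ← sq]
    have := hl i
    positivity
  have hga : g a = Matrix.diagonal l := hPl
  have m₀ : ∀ᶠ x in 𝓝 a, 0 < l 0 / |l 0| * g x 0 0 := by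
    refine continuousAt_eventually_pos (f := fun x => l 0 / |l 0| * g x 0 0) ?_
      (continuousAt_const.mul (hg 0 0))
    rw [hga]
    simpa using hpos 0
  have m₁ : ∀ᶠ x in 𝓝 a, 0 < l 0 / |l 0| * (l 1 / |l 1|) * (g x 0 0 * g x 1 1 - g x 0 1 ^ 2) := by
    refine continuousAt_eventually_pos (f := fun x => l 0 / |l 0| * (l 1 / |l 1|) * (g x 0 0 * g x 1 1 - g x 0 1 ^ 2)) ?_
      (continuousAt_const.mul (((hg 0 0).mul (hg 1 1)).sub ((hg 0 1).pow 2)))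
    rw [hga]
    have := mul_pos (hpos 0) (hpos 1)
    simp
    linarith
  have m₂ : ∀ᶠ x in 𝓝 a, 0 < l 0 / |l 0| * (l 1 / |l 1|) * (l 2 / |l 2|) * (g x).det := by
    have hc : ContinuousAt (fun x => (g x).det) a := by
      simp only [Matrix.det_fin_three]
      fun_prop
    refine continuousAt_eventually_pos (f := fun x => l 0 / |l 0| * (l 1 / |l 1|) * (l 2 / |l 2|) * (g x).det) ?_
      (continuousAt_const.mul hc)
    rw [hga, Matrix.det_diagonal, Fin.prod_univ_three]
    have := mul_pos (mul_pos (hpos 0) (hpos 1)) (hpos 2)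
    linarith
  have key : ∀ᶠ x in 𝓝 a, HasSignaturePPM (f x)
      ↔ HasSignaturePPM (Matrix.diagonal ![l 0 / |l 0|, l 1 / |l 1|, l 2 / |l 2|]) := by
    filter_upwards [hs, m₀, m₁, m₂] with x h1 h2 h3 h4
    have hgs : (g x).IsSymm := by
      simp only [g, Matrix.IsSymm, Matrix.transpose_mul, Matrix.transpose_transpose, h1.eq,
        Matrix.mul_assoc]
    obtain ⟨Q, hQ, e⟩ := exists_congruent_signs hgs (hsq 0) (hsq 1) (hsq 2) h2 h3 h4
    rw [← e, hasSignaturePPM_congr hQ, hasSignaturePPM_congr hP]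
  filter_upwards [key] with x hx
  rw [hx, key.self_of_nhds]

section Manifold
variable {M : Type*} [TopologicalSpace M] [ChartedSpace E3 M]

/-- The metric at a point of the manifold, in the standard basis of the model space. -/
def WeylStructure.gram (W : WeylStructure M) (p : M) : Matrix (Fin 3) (Fin 3) ℝ :=
  let H : E3 →L[ℝ] E3 →L[ℝ] ℝ := W.h p
  Matrix.of fun i j => H (EuclideanSpace.single i 1) (EuclideanSpace.single j 1)

/-- The matrix `gram` refers to no chosen chart and no continuity of it is asserted. Being congruent
to the components in every chart, it still carries their signature and makes the signature a
function on the manifold. -/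
theorem WeylStructure.exists_congruent_gram (W : WeylStructure M) {e : OpenPartialHomeomorph M E3}
    (he : e ∈ IsManifold.maximalAtlas (𝓡 3) ∞ M) {x : E3} (hx : x ∈ e.target) :
    ∃ J : Matrix (Fin 3) (Fin 3) ℝ, J.det ≠ 0 ∧
      W.hc e x = J.transpose * W.gram (e.symm x) * J := by
  let J : Matrix (Fin 3) (Fin 3) ℝ := Matrix.of fun b i =>
    chartDeriv e x (EuclideanSpace.single i 1) b
  have hJ : W.hc e x = J.transpose * W.gram (e.symm x) * J := by
    let H : E3 →L[ℝ] E3 →L[ℝ] ℝ := W.h (e.symm x)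
    ext i j
    have e1 : W.hc e x i j = H (chartDeriv e x (EuclideanSpace.single i 1))
      (chartDeriv e x (EuclideanSpace.single j 1)) := rfl
    rw [e1, ← sum_coord_smul (chartDeriv e x (EuclideanSpace.single i 1)),
      ← sum_coord_smul (chartDeriv e x (EuclideanSpace.single j 1))]
    simp only [map_sum, map_smul, smul_eq_mul, sum_apply, smul_apply]
    simp only [Matrix.mul_apply, Matrix.transpose_apply, Finset.sum_mul]
    refine Finset.sum_congr rfl fun b _ => ?_
    rw [Finset.mul_sum]
    refine Finset.sum_congr rfl fun c _ => ?_
    have e2 : W.gram (e.symm x) c b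
      = H (EuclideanSpace.single c 1) (EuclideanSpace.single b 1) := rfl
    rw [e2]
    simp only [J, Matrix.of_apply]
    ring
  -- Invertibility of the derivative of the chart is read off from the nondegeneracy of the
  -- components.
  refine ⟨J, fun h0 => (W.isWeylOn e he).nondeg x hx ?_, hJ⟩
  show (W.hc e x).det = 0
  rw [hJ, Matrix.det_mul, h0, mul_zero]

theorem WeylStructure.hasSignaturePPM_iff_gram (W : WeylStructure M) (ε : ℝ)
    {e : OpenPartialHomeomorph M E3} (he : e ∈ IsManifold.maximalAtlas (𝓡 3) ∞ M) {x : E3}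
    (hx : x ∈ e.target) :
    HasSignaturePPM (ε • W.hc e x) ↔ HasSignaturePPM (ε • W.gram (e.symm x)) := by
  obtain ⟨J, hJ, h⟩ := W.exists_congruent_gram he hx
  rw [h, ← hasSignaturePPM_congr (A := ε • W.gram (e.symm x)) hJ, Matrix.mul_smul, Matrix.smul_mul]

variable [IsManifold (𝓡 3) ∞ M]

theorem WeylStructure.eventually_signature (W : WeylStructure M) {ε : ℝ} (hε : ε ≠ 0) (p : M) :
    ∀ᶠ q in 𝓝 p, HasSignaturePPM (ε • W.gram q) ↔ HasSignaturePPM (ε • W.gram p) := by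
  let e := chartAt E3 p
  have he : e ∈ IsManifold.maximalAtlas (𝓡 3) ∞ M := IsManifold.chart_mem_maximalAtlas p
  have hp : p ∈ e.source := mem_chart_source E3 p
  have w := W.weylNear he (e.map_source hp)
  have h1 : ∀ᶠ x in 𝓝 (e p), HasSignaturePPM (ε • W.hc e x) ↔ HasSignaturePPM (ε • W.hc e (e p)) := by
    refine eventually_hasSignaturePPM_iff (f := fun x => ε • W.hc e x) (fun i j => ?_) ?_ ?_
    · exact continuousAt_const.mul (w.smooth_h i j).continuousAt
    · filter_upwards [w.symm] with x hx
      rw [Matrix.IsSymm, Matrix.transpose_smul, hx.eq]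
    · rw [Matrix.det_smul]
      exact mul_ne_zero (pow_ne_zero _ hε) w.nondeg.self_of_nhds
  filter_upwards [(e.continuousAt hp).eventually h1, e.open_source.mem_nhds hp] with q hq hqs
  rw [W.hasSignaturePPM_iff_gram ε he (e.map_source hqs),
    W.hasSignaturePPM_iff_gram ε he (e.map_source hp), e.left_inv hqs, e.left_inv hp] at hq
  exact hq

/-- On a connected manifold the signature is constant. -/
theorem WeylStructure.signature_of_exists [ConnectedSpace M] (W : WeylStructure M) {ε : ℝ}
    (hε : ε ≠ 0) {p : M} (hp : HasSignaturePPM (ε • W.gram p)) (q : M) :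
    HasSignaturePPM (ε • W.gram q) := by
  have hc : IsClopen {q : M | HasSignaturePPM (ε • W.gram q)} := by
    constructor
    · rw [← isOpen_compl_iff, isOpen_iff_mem_nhds]
      intro x hx
      filter_upwards [W.eventually_signature hε x] with y hy
      exact fun h => hx (hy.1 h)
    · rw [isOpen_iff_mem_nhds]
      intro x hx
      filter_upwards [W.eventually_signature hε x] with y hy
      exact hy.2 hx
  have := hc.eq_univ ⟨p, hp⟩
  exact Set.eq_univ_iff_forall.1 this q

variable {W : WeylStructure M} {p : M} {ε : ℝ}

omit [IsManifold (𝓡 3) ∞ M] in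
theorem rep_chart (hε : ε ≠ 0) {e : OpenPartialHomeomorph M E3}
    (he : e ∈ IsManifold.maximalAtlas (𝓡 3) ∞ M) (hp : p ∈ e.source) :
    Rep W ε p (fun x => ε • W.hc e x) (W.omc e) (e p) ∧
      (CurvZeroAt (fun x => ε • W.hc e x) (W.omc e) (e p) → CurvZeroAt (W.hc e) (W.omc e) (e p)) := by
  have hh : ∀ᶠ x in 𝓝 (e p), ε • W.hc e x = ((1 : ℝ) ^ 2 * ε) • W.hc e x :=
    Filter.Eventually.of_forall fun x => by simp
  have ho : ∀ᶠ x in 𝓝 (e p), ∀ i, W.omc e x i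
      = W.omc e x i + 2 * pd i (fun _ => Real.log 1) x :=
    Filter.Eventually.of_forall fun x i => by rw [pd_const]; simp
  refine ⟨⟨e, he, hp, rfl, fun _ => 1, SmoothNear.const 1, one_pos, hh, ho⟩, fun h l k i j => ?_⟩
  rw [← weylCurv_congr (weylConn_rep hε (W.weylNear he (e.map_source hp)) (SmoothNear.const 1)
    one_pos hh ho)]
  exact h l k i j

/-- Existence of the adapted representative near a point of nonzero curvature. -/
theorem WeylStructure.exists_ansatz (hε : ε ≠ 0) (hEW : W.IsEinsteinWeyl) (hS : W.IsScalarFlat)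
    {e : OpenPartialHomeomorph M E3} (he : e ∈ IsManifold.maximalAtlas (𝓡 3) ∞ M)
    (hp : p ∈ e.source) (hd : (ε • W.hc e (e p)).det < 0)
    (hv : ¬ CurvZeroAt (W.hc e) (W.omc e) (e p)) :
    ∃ (b c : E3 → ℝ) (a : E3), SmoothNear b a ∧ SmoothNear c a ∧ Rep W ε p (ansatz b c) ydt a :=
  (rep_chart hε he hp).1.exists_ansatz hε hEW hS hd fun h => hv ((rep_chart hε he hp).2 h)

omit [IsManifold (𝓡 3) ∞ M] in
theorem Rep.signature {b c : E3 → ℝ} {a : E3} (r : Rep W ε p (ansatz b c) ydt a) :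
    HasSignaturePPM (ε • W.gram p) := by
  obtain ⟨e, he, hp, rfl, φ, -, hφ0, hh, -⟩ := r
  have h := hasSignaturePPM_ansatz b c (e p)
  rw [hh.self_of_nhds, mul_smul, hasSignaturePPM_smul hφ0.ne',
    W.hasSignaturePPM_iff_gram ε he (e.map_source hp), e.left_inv hp] at h
  exact h

theorem exists_ansatz_of_signature (hε : ε ≠ 0) (hEW : W.IsEinsteinWeyl) (hS : W.IsScalarFlat)
    (hsig : ∀ q, HasSignaturePPM (ε • W.gram q)) (hp : ¬ W.FlatAt p) :
    ∃ (b c : E3 → ℝ) (a : E3), SmoothNear b a ∧ SmoothNear c a ∧ Rep W ε p (ansatz b c) ydt a := by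
  simp only [WeylStructure.FlatAt, not_forall] at hp
  obtain ⟨e, he, hpe, hv⟩ := hp
  refine WeylStructure.exists_ansatz hε hEW hS he hpe ?_ hv
  exact ((W.hasSignaturePPM_iff_gram ε he (e.map_source hpe)).2 (hsig _)).det_neg

/-! ### The global classification -/

/-- A nonflat scalar-flat Einstein–Weyl structure has signature `(++-)`, up to sign. -/
theorem exists_signature [ConnectedSpace M] (hEW : W.IsEinsteinWeyl) (hS : W.IsScalarFlat)
    (hp : ¬ W.FlatAt p) : ∃ ε : ℝ, (ε = 1 ∨ ε = -1) ∧ ∀ q, HasSignaturePPM (ε • W.gram q) := by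
  simp only [WeylStructure.FlatAt, not_forall] at hp
  obtain ⟨e, he, hpe, hv⟩ := hp
  have hd : (W.hc e (e p)).det ≠ 0 := (W.isWeylOn e he).nondeg _ (e.map_source hpe)
  -- In odd dimension h and -h have determinants of opposite sign. A negative determinant alone
  -- would still allow (---), which is excluded by the adapted form of the metric.
  obtain ⟨ε, hε, hdε⟩ : ∃ ε : ℝ, (ε = 1 ∨ ε = -1) ∧ (ε • W.hc e (e p)).det < 0 := by
    rcases lt_or_gt_of_ne hd with h | h
    · exact ⟨1, Or.inl rfl, by simpa using h⟩
    · refine ⟨-1, Or.inr rfl, ?_⟩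
      rw [Matrix.det_smul]
      simp
      linarith
  have hε0 : ε ≠ 0 := by rcases hε with rfl | rfl <;> norm_num
  obtain ⟨b, c, a, -, -, r⟩ := WeylStructure.exists_ansatz hε0 hEW hS he hpe hdε hv
  exact ⟨ε, hε, W.signature_of_exists hε0 r.signature⟩

/-- A point without a flat neighbourhood has nonflat points arbitrarily close, where the adapted
form is available. There b_x either vanishes on a neighbourhood, giving the first form, or is
nonzero at points arbitrarily near, giving the second. -/
theorem dense_normal_forms (hε : ε ≠ 0) (hEW : W.IsEinsteinWeyl) (hS : W.IsScalarFlat)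
    (hsig : ∀ q, HasSignaturePPM (ε • W.gram q)) :
    Dense {p : M | (∀ᶠ q in 𝓝 p, W.FlatAt q) ∨ W.HasForm₁ ε p ∨ W.HasForm₂ ε p} := by
  rw [dense_iff_inter_open]
  rintro U hU ⟨p, hpU⟩
  by_cases hf : ∀ᶠ q in 𝓝 p, W.FlatAt q
  · exact ⟨p, hpU, Or.inl hf⟩
  · obtain ⟨q, hq, hqU⟩ := ((Filter.not_eventually.1 hf).and_eventually (hU.mem_nhds hpU)).exists
    obtain ⟨b, c, a, hb, hc, r⟩ := exists_ansatz_of_signature hε hEW hS hsig hq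
    by_cases h1 : ∀ᶠ x in 𝓝 a, pd 1 b x = 0
    · exact ⟨q, hqU, Or.inr (Or.inl (r.hasForm₁ hε hEW hS hb h1))⟩
    · obtain ⟨e, he, hqe, rfl, hr⟩ := r.eventually
      have hsymm : Filter.Tendsto e.symm (𝓝 (e q)) (𝓝 q) := by
        have := (e.continuousAt_symm (e.map_source hqe)).tendsto
        rwa [e.left_inv hqe] at this
      obtain ⟨x, h2, h3, h4, h5, h6⟩ := ((Filter.not_eventually.1 h1).and_eventually
        (hr.and (hb.eventually.and (hc.eventually.and
          (hsymm.eventually (hU.mem_nhds hqU)))))).exists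
      exact ⟨e.symm x, h6, Or.inr (Or.inr (h3.hasForm₂ hε hEW hS h4 h5 h2))⟩

/-- In the adapted form at a nonflat point, recurrence of F nearby means that b_x vanishes on a
neighbourhood, and failure of recurrence at the point means b_x ≠ 0 there. These are the hypotheses
of the two normal forms. -/
theorem classification [ConnectedSpace M] (W : WeylStructure M) (hEW : W.IsEinsteinWeyl)
    (hS : W.IsScalarFlat) : W.IsFlat ∨ ∃ ε : ℝ, (ε = 1 ∨ ε = -1) ∧
      (∀ e ∈ IsManifold.maximalAtlas (𝓡 3) ∞ M, ∀ x ∈ e.target, HasSignaturePPM (ε • W.hc e x)) ∧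
      Dense {p : M | (∀ᶠ q in 𝓝 p, W.FlatAt q) ∨ W.HasForm₁ ε p ∨ W.HasForm₂ ε p} ∧
      (∀ p : M, ¬ W.FlatAt p → (∀ᶠ q in 𝓝 p, W.IsRecurrentAt q) → W.HasForm₁ ε p) ∧
      (∀ p : M, ¬ W.FlatAt p → W.IsNonrecurrentAt p → W.HasForm₂ ε p) := by
  by_cases hflat : W.IsFlat
  · exact Or.inl hflat
  right
  obtain ⟨p, hp⟩ := not_forall.1 hflat
  obtain ⟨ε, hε, hsig⟩ := exists_signature hEW hS hp
  have hε0 : ε ≠ 0 := by rcases hε with rfl | rfl <;> norm_num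
  refine ⟨ε, hε, fun e he x hx => (W.hasSignaturePPM_iff_gram ε he hx).2 (hsig _),
    dense_normal_forms hε0 hEW hS hsig, fun q hq hrec => ?_, fun q hq hrec => ?_⟩
  · obtain ⟨b, c, a, hb, hc, r⟩ := exists_ansatz_of_signature hε0 hEW hS hsig hq
    refine r.hasForm₁ hε0 hEW hS hb ?_
    filter_upwards [r.eventually_recurrentAt hε0 hrec] with x hx
    exact (recurrentAt_ansatz_iff b c x).1 hx
  · obtain ⟨b, c, a, hb, hc, r⟩ := exists_ansatz_of_signature hε0 hEW hS hsig hq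
    refine r.hasForm₂ hε0 hEW hS hb hc fun h => ?_
    exact r.not_recurrentAt hε0 hrec ((recurrentAt_ansatz_iff b c a).2 h)

end Manifold

end EinsteinWeyl

end

open EinsteinWeyl in
theorem mainTheorem1 :
    -- Classification of scalar-flat Einstein–Weyl structures on connected 3-manifolds.
    (∀ (M : Type*) [TopologicalSpace M] [ChartedSpace E3 M] [IsManifold (𝓡 3) ∞ M]
        [ConnectedSpace M] (W : WeylStructure M),
      W.IsEinsteinWeyl → W.IsScalarFlat →
        W.IsFlat ∨
        ∃ ε : ℝ, (ε = 1 ∨ ε = -1) ∧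
          -- the signature is (++-), after replacing h by -h if necessary
          (∀ e ∈ IsManifold.maximalAtlas (𝓡 3) ∞ M, ∀ x ∈ e.target,
            HasSignaturePPM (ε • W.hc e x)) ∧
          -- near the points of an open dense set: flat, or one of the two normal forms
          Dense {p : M | (∀ᶠ q in 𝓝 p, W.FlatAt q) ∨ W.HasForm₁ ε p ∨ W.HasForm₂ ε p} ∧
          -- which form occurs at a point of nonzero curvature
          (∀ p : M, ¬ W.FlatAt p → (∀ᶠ q in 𝓝 p, W.IsRecurrentAt q) → W.HasForm₁ ε p) ∧
          (∀ p : M, ¬ W.FlatAt p → W.IsNonrecurrentAt p → W.HasForm₂ ε p)) ∧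
    -- Conversely, both families consist of non-flat solutions, for arbitrary functions R and S.
    (∀ (J : Set ℝ) (R S : ℝ → ℝ), IsOpen J → ContDiffOn ℝ 2 R J → ContDiffOn ℝ 2 S J →
      (IsWeylOn 2 {p : E3 | p 2 ∈ J} (h₁ R S) ydt ∧
        ∀ p : E3, p 2 ∈ J → HasSignaturePPM (h₁ R S p) ∧ EWAt (h₁ R S) ydt p ∧
          weylScalar (h₁ R S) ydt p = 0 ∧ ¬ CurvZeroAt (h₁ R S) ydt p) ∧
      (IsWeylOn 2 {p : E3 | p 2 ∈ J ∧ p 0 ≠ 0} (h₂ R S) ydt ∧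
        ∀ p : E3, p 2 ∈ J → p 0 ≠ 0 → HasSignaturePPM (h₂ R S p) ∧ EWAt (h₂ R S) ydt p ∧
          weylScalar (h₂ R S) ydt p = 0 ∧ ¬ CurvZeroAt (h₂ R S) ydt p)) := by
  refine ⟨?_, families_are_solutions⟩
  intro M _ _ _ _ W hEW hS
  exact classification W hEW hS
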